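/- Let $\Omega=(L,R)\subset\mathbb R$ be a bounded interval, $n\in(0,3)$, and let $u_{in}\in H^1(\Omega)$, $u_{in}\ge 0$, $\int_\Omega u_{in}\,dx=1$. For $\varepsilon\in(0,1)$ put $$B(s)=\int_0^s\int_r^\infty\frac{dv\,dr}{v^{n-1}+v^2},\qquad B^\varepsilon(s)=\frac{1}{|\ln\varepsilon|}B(s/\varepsilon).$$ For every $\varepsilon\in(0,1)$ let $u^\varepsilon$ be a non-negative weak solution, continuous on $[0,\infty)\times\overline\Omega$ with $u^\varepsilon(t,\cdot)\in H^1(\Omega)$ for all $t\ge 0$, of $$|\ln\varepsilon|^{-1}\partial_t u+\partial_x\big((\varepsilon^{3-n}u^n+u^3)u_{xxx}\big)=0\ \text{ in }(0,\infty)\times\Omega,\qquad (\varepsilon^{3-n}u^n+u^3)u_{xxx}=0,\ u_x=0\ \text{ on }(0,\infty)\times\partial\Omega,\qquad u(0,\cdot)=u_{in}$$ (where, for a.e. $t$, $u_{xx},u_{xxx}$ are weak derivatives on $\{u(t,\cdot)>0\}$, products such as $u\,u_{xxx}$, $u\,u_{xx}^2$ and the flux are taken to vanish on $\{u=0\}$,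 and $u_x(t,\cdot)$ is continuous on $\overline\Omega$ and vanishes on $\partial\Omega$), with the following properties. First, $u\,u_{xxx}\in L^2((0,S)\times\Omega)$ for all $S>0$, and $u\,u_{xxx}=(u\,u_{xx})_x-\frac12(u_x^2)_x$ as distributions on $\Omega$ for a.e. $t$. Second, for all $t>0$, $\int_\Omega u^\varepsilon(t)\,dx=\int_\Omega u_{in}\,dx$ and, with $\rho^\varepsilon=B^\varepsilon(u^\varepsilon)$, $$\int_\Omega\tfrac12|u^\varepsilon_x(t)|^2dx+\int_0^t\!\int_{\{u^\varepsilon>0\}}|\ln\varepsilon|\big(\varepsilon^{3-n}(u^\varepsilon)^n+(u^\varepsilon)^3\big)|u^\varepsilon_{xxx}|^2dx\,ds\le\int_\Omega\tfrac12|\partial_xu_{in}|^2dx,$$ $$\int_\Omega\rho^\varepsilon(t)\,dx\ge\int_0^t\!\int_\Omega u^\varepsilon|u^\varepsilon_{xx}|^2dx\,ds+\int_\Omega\rho^\varepsilon(0)\,dx .$$ Third, $\partial_t\rho^\varepsilon=T^\varepsilon+\partial_xR^\varepsilon$ in the sense of distributions on $(0,\infty)\times\Omega$, where $$T^\varepsilon=-u^\varepsilon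 u^\varepsilon_xu^\varepsilon_{xxx},\qquad R^\varepsilon=-|\ln\varepsilon|\,(B^{\varepsilon})'(u^\varepsilon)\big(\varepsilon^{3-n}(u^\varepsilon)^{n-1}+(u^\varepsilon)^2\big)u^\varepsilon u^\varepsilon_{xxx},$$ and, for a.e. $t>0$ and all $\varphi\in C^\infty(\overline\Omega)$, $$\int_\Omega T^\varepsilon\varphi\,dx=\int_\Omega u^\varepsilon(u^\varepsilon_{xx})^2\varphi\,dx-\tfrac56\int_\Omega(u_x^\varepsilon)^3\varphi'\,dx-\tfrac12\int_\Omega u^\varepsilon(u_x^\varepsilon)^2\varphi''\,dx .$$ Let $p\in[1,\infty)$, $T\in(0,\infty]$, and let $\varepsilon_k\in(0,1)$, $\varepsilon_k\to0$, and the function $\rho(t,x)$ (integrable on $(0,S)\times\Omega$ for all finite $S\le T$) be such that $\rho^{\varepsilon_k}\to\rho$ strongly in $L^p(0,S;W^{-1,1}(\Omega))$ for every finite $S\le T$. Let $$\Sigma(t)=\Big\{x\in\Omega:\ \exists r>0,\ \int_{B_r(x)\cap\Omega}[1-\rho(t,y)]\,dy=0\Big\}.$$ Here an accumulation point of $\{u^{\varepsilon_k}(t,\cdot)\}$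 means a function in $C^0(\overline\Omega)\cap H^1(\Omega)$ that is the uniform limit of a subsequence. Then there is a subsequence $\varepsilon_k'$ of $\varepsilon_k$ such that: (i) for a.e. $t\in(0,T)$ every accumulation point $v$ of $\{u^{\varepsilon_k'}(t,\cdot)\}$ satisfies $v'''=0$ in $\{v>0\}$, $\int_\Omega v\,dx=1$, $\{v>0\}\subset\Sigma(t)$ and $\partial\{v>0\}\cap\Sigma(t)=\emptyset$; (ii) for a.e. $t\in(0,T)$, if $\Sigma(t)=(a,b)$ with $L<a<b<R$, then $\{u^{\varepsilon_k'}(t,\cdot)\}$ has exactly one accumulation point $v$; it vanishes outside $(a,b)$, there is a constant $\lambda$ with $v''=-\lambda$ in $(a,b)$, and $\int_{(a,b)}v\,dx=1$; moreover the whole sequence $u^{\varepsilon_k'}(t,\cdot)$ converges to $v$ uniformly on $\overline\Omega$ and weakly in $H^1(\Omega)$. -/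

import Mathlib

open Set Filter Topology MeasureTheory
open scoped ContDiff ENNReal

noncomputable section

namespace ThinFilm

/-- Test functions `C_c^∞(U)` for a set `U` in a real normed space. -/
def IsTest {E : Type*} [NormedAddCommGroup E] [NormedSpace ℝ E] (U : Set E) (φ : E → ℝ) : Prop :=
  ContDiff ℝ ∞ φ ∧ HasCompactSupport φ ∧ tsupport φ ⊆ U

/-- `g` is the weak (distributional) derivative of order `k` of `f` on the open set `U ⊆ ℝ`. -/
def HasWeakDeriv (k : ℕ) (U : Set ℝ) (f g : ℝ → ℝ) : Prop :=
  LocallyIntegrableOn f U ∧ LocallyIntegrableOn g U ∧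
    ∀ φ : ℝ → ℝ, IsTest U φ →
      ∫ x in U, f x * iteratedDeriv k φ x = (-1) ^ k * ∫ x in U, g x * φ x

/-- `f ∈ H¹(L,R)` with weak derivative `g`. -/
def HasH1Deriv (L R : ℝ) (f g : ℝ → ℝ) : Prop :=
  MemLp f 2 (volume.restrict (Ioo L R)) ∧ MemLp g 2 (volume.restrict (Ioo L R)) ∧
    HasWeakDeriv 1 (Ioo L R) f g

/-- `f ∈ H¹(L,R)`. -/
def MemH1 (L R : ℝ) (f : ℝ → ℝ) : Prop := ∃ g, HasH1Deriv L R f g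

/-- Weak convergence `f k ⇀ v` in the Hilbert space `H¹(L,R)`. -/
def TendstoWeakH1 (L R : ℝ) (f : ℕ → ℝ → ℝ) (v : ℝ → ℝ) : Prop :=
  ∃ (g : ℕ → ℝ → ℝ) (dv : ℝ → ℝ), (∀ k, HasH1Deriv L R (f k) (g k)) ∧ HasH1Deriv L R v dv ∧
    ∀ ψ dψ : ℝ → ℝ, HasH1Deriv L R ψ dψ →
      Tendsto (fun k => ∫ x in Ioo L R, (f k x * ψ x + g k x * dψ x)) atTop
        (𝓝 (∫ x in Ioo L R, (v x * ψ x + dv x * dψ x)))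

/-- The norm of an integrable function `f` in `W^{-1,1}(L,R)`, by duality with
`{φ ∈ C_c^∞(L,R) : |φ| ≤ 1, |φ'| ≤ 1}`. On integrable functions it coincides with
`inf {‖f₀‖_{L¹} + ‖f₁‖_{L¹} : f = f₀ + f₁'}`. -/
def normWneg (L R : ℝ) (f : ℝ → ℝ) : ℝ≥0∞ :=
  ⨆ (φ : ℝ → ℝ) (_ : IsTest (Ioo L R) φ) (_ : ∀ x, |φ x| ≤ 1) (_ : ∀ x, |deriv φ x| ≤ 1),
    ENNReal.ofReal |∫ x in Ioo L R, f x * φ x|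

/-- `B(s) = ∫_0^s ∫_r^∞ dv / (v^{n-1} + v²) dr`. -/
def B (n s : ℝ) : ℝ := ∫ r in (0 : ℝ)..s, ∫ v in Ioi r, 1 / (v ^ (n - 1) + v ^ 2)

/-- `B^ε(s) = B(s/ε) / |ln ε|`. -/
def Beps (n ε s : ℝ) : ℝ := B n (s / ε) / |Real.log ε|

/-- The mobility `ε^{3-n} u^n + u³`. -/
def mobility (n ε s : ℝ) : ℝ := ε ^ (3 - n) * s ^ n + s ^ 3

/-- `u` is a nonnegative weak solution of the rescaled thin film equation
`|ln ε|⁻¹ ∂_t u + ∂_x ((ε^{3-n} u^n + u³) u_xxx) = 0` on `(0,∞) × (L,R)` with null flux and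
`u_x = 0` at the boundary and initial value `u₀`, satisfying mass conservation and the energy and
entropy inequalities, and such that `ρ^ε = B^ε(u)` solves its evolution equation. Here `u1`, `u2`,
`u3` stand for `u_x`, `u_xx`, `u_xxx`; the last two are prescribed on `{u > 0}` only, and
every integrand below in which they occur has a factor that vanishes on `{u = 0}`. -/
structure IsSolutionWith (L R n ε : ℝ) (u₀ : ℝ → ℝ) (u u1 u2 u3 : ℝ → ℝ → ℝ) : Prop where
  /-- The continuous representative. -/
  cont : ContinuousOn (Function.uncurry u) (Ici 0 ×ˢ Icc L R)
  nonneg : ∀ t, 0 ≤ t → ∀ x ∈ Icc L R, 0 ≤ u t x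
  initial : ∀ x ∈ Icc L R, u 0 x = u₀ x
  meas1 : AEStronglyMeasurable (Function.uncurry u1) (volume.restrict (Ioi 0 ×ˢ Ioo L R))
  meas2 : AEStronglyMeasurable (Function.uncurry u2) (volume.restrict (Ioi 0 ×ˢ Ioo L R))
  meas3 : AEStronglyMeasurable (Function.uncurry u3) (volume.restrict (Ioi 0 ×ˢ Ioo L R))
  deriv1 : ∀ t, 0 ≤ t → HasH1Deriv L R (u t) (u1 t)
  deriv2 : ∀ᵐ t, 0 < t → HasWeakDeriv 2 {x ∈ Ioo L R | 0 < u t x} (u t) (u2 t)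
  deriv3 : ∀ᵐ t, 0 < t → HasWeakDeriv 3 {x ∈ Ioo L R | 0 < u t x} (u t) (u3 t)
  /-- `u_x = 0` on the boundary. -/
  neumann : ∀ᵐ t, 0 < t → ContinuousOn (u1 t) (Icc L R) ∧ u1 t L = 0 ∧ u1 t R = 0
  /-- `u u_xxx ∈ L²((0,S) × (L,R))`. -/
  memLp : ∀ S : ℝ, 0 < S →
    MemLp (fun q : ℝ × ℝ => u q.1 q.2 * u3 q.1 q.2) 2 (volume.restrict (Ioo 0 S ×ˢ Ioo L R))
  /-- `u u_xxx = (u u_xx)_x - ½ (u_x²)_x` as distributions on `(L,R)`. -/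
  uuxxx : ∀ᵐ t, 0 < t → ∀ φ : ℝ → ℝ, IsTest (Ioo L R) φ →
    ∫ x in Ioo L R, u t x * u3 t x * φ x =
      - (∫ x in Ioo L R, u t x * u2 t x * deriv φ x)
        + (1 / 2) * ∫ x in Ioo L R, u1 t x ^ 2 * deriv φ x
  /-- Weak form of the equation with the null flux condition and the initial condition. -/
  weak : ∀ φ : ℝ × ℝ → ℝ, IsTest univ φ →
    |Real.log ε|⁻¹ *
        ((∫ t in Ioi (0 : ℝ), ∫ x in Ioo L R, u t x * deriv (fun s => φ (s, x)) t)
          + ∫ x in Ioo L R, u₀ x * φ (0, x))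
      + ∫ t in Ioi (0 : ℝ), ∫ x in Ioo L R,
          mobility n ε (u t x) * u3 t x * deriv (fun y => φ (t, y)) x = 0
  /-- Conservation of mass. -/
  mass : ∀ t, 0 ≤ t → ∫ x in Ioo L R, u t x = ∫ x in Ioo L R, u₀ x
  /-- Energy inequality. -/
  energy : ∀ t, 0 < t →
    (∫⁻ x in Ioo L R, ENNReal.ofReal ((1 / 2) * u1 t x ^ 2))
      + (∫⁻ s in Ioo 0 t, ∫⁻ x in Ioo L R,
          ENNReal.ofReal (|Real.log ε| * mobility n ε (u s x) * u3 s x ^ 2))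
      ≤ ∫⁻ x in Ioo L R, ENNReal.ofReal ((1 / 2) * u1 0 x ^ 2)
  /-- Entropy inequality. -/
  entropy : ∀ t, 0 < t →
    (∫⁻ s in Ioo 0 t, ∫⁻ x in Ioo L R, ENNReal.ofReal (u s x * u2 s x ^ 2))
      + ENNReal.ofReal (∫ x in Ioo L R, Beps n ε (u₀ x))
      ≤ ENNReal.ofReal (∫ x in Ioo L R, Beps n ε (u t x))
  /-- `∂_t ρ^ε = T^ε + ∂_x R^ε` as distributions on `(0,∞) × (L,R)`, where `T^ε = - u u_x u_xxx` and
  `R^ε = - |ln ε| (B^ε)'(u) (ε^{3-n} u^n + u³) u_xxx`. -/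
  rho_eq : ∀ φ : ℝ × ℝ → ℝ, IsTest (Ioi 0 ×ˢ Ioo L R) φ →
    - (∫ t in Ioi (0 : ℝ), ∫ x in Ioo L R, Beps n ε (u t x) * deriv (fun s => φ (s, x)) t) =
      (∫ t in Ioi (0 : ℝ), ∫ x in Ioo L R, - (u t x * u1 t x * u3 t x) * φ (t, x))
      - ∫ t in Ioi (0 : ℝ), ∫ x in Ioo L R,
          - (|Real.log ε| * deriv (Beps n ε) (u t x) * mobility n ε (u t x) * u3 t x)
            * deriv (fun y => φ (t, y)) x
  /-- The representation of `T^ε` tested against smooth functions on `[L,R]`. -/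
  T_eq : ∀ᵐ t, 0 < t → ∀ φ : ℝ → ℝ, ContDiff ℝ ∞ φ →
    ∫ x in Ioo L R, - (u t x * u1 t x * u3 t x) * φ x =
      (∫ x in Ioo L R, u t x * u2 t x ^ 2 * φ x)
        - (5 / 6) * (∫ x in Ioo L R, u1 t x ^ 3 * deriv φ x)
        - (1 / 2) * ∫ x in Ioo L R, u t x * u1 t x ^ 2 * iteratedDeriv 2 φ x

/-- See `IsSolutionWith`. -/
def IsSolution (L R n ε : ℝ) (u₀ : ℝ → ℝ) (u : ℝ → ℝ → ℝ) : Prop :=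
  ∃ u1 u2 u3 : ℝ → ℝ → ℝ, IsSolutionWith L R n ε u₀ u u1 u2 u3

/-- The apparent support: the complement in `(L,R)` of the support of `1 - r`
(to be used with `r = ρ(t,·)`). -/
def apparentSupport (L R : ℝ) (r : ℝ → ℝ) : Set ℝ :=
  {x ∈ Ioo L R | ∃ δ > 0, ∫ y in Metric.ball x δ ∩ Ioo L R, (1 - r y) = 0}

/-- `v ∈ C⁰ ∩ H¹` is an accumulation point, for uniform convergence, of the sequence `f`. -/
def IsAccPoint (L R : ℝ) (f : ℕ → ℝ → ℝ) (v : ℝ → ℝ) : Prop :=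
  ContinuousOn v (Icc L R) ∧ MemH1 L R v ∧
    ∃ j : ℕ → ℕ, StrictMono j ∧ TendstoUniformlyOn (fun k => f (j k)) v atTop (Icc L R)

/-- With `P = {v > 0}`: `v''' = 0` in `P`, `∫ v = 1`, `P ⊆ S` and `∂P ∩ S = ∅`. -/
def IsProfile (L R : ℝ) (S : Set ℝ) (v : ℝ → ℝ) : Prop :=
  (∃ v1 v2 : ℝ → ℝ, ∀ x ∈ Ioo L R, 0 < v x →
      HasDerivAt v (v1 x) x ∧ HasDerivAt v1 (v2 x) x ∧ HasDerivAt v2 0 x) ∧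
    ∫ x in Ioo L R, v x = 1 ∧
    {x ∈ Ioo L R | 0 < v x} ⊆ S ∧
    frontier {x ∈ Ioo L R | 0 < v x} ∩ S = ∅

end ThinFilm

end

/-! Write `D` for the integral of `u³ u_xxx²` over `(L,R)`. The energy inequality bounds the time
integral of `D` by a constant over `|ln ε|`, so along a subsequence `D → 0` at almost every time.
Where a uniform limit `v` of the solutions is positive, the oscillation of `u_xx` then vanishes in
the limit: `v` is a quadratic polynomial on each component of `{v > 0}` and inherits the Neumann
condition at `L` and `R` where it is positive there. Since `B z` grows like `log z`, `B^ε(s) → 1`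
for every `s > 0`; hence `ρ ≤ 1`, with `ρ = 1` where `v > 0`, and `{v > 0}` is contained in the
apparent support.

The main point is that no component of `{v > 0}` ends inside the apparent support. Cutting `u` off
at height `δ`, integrating by parts and completing a square gives `∫ T ψ² ≥ (1/3) ∫ (step δ)'(u)
u_x⁴ ψ² - C (δ ∫ u_x² + D / δ²)` (`Slice.exists_lower_bound`). By the coarea formula the first
integral is an average, over levels between `δ` and `2δ`, of the sum of `|u_x|³ ψ²` over the level
set. Letting `ε → 0` and then `δ → 0`, `∫ T ψ²` is asymptotically nonnegative; and it stays away
from zero if `v` has a contact point where `ψ = 1`, because a quadratic component leaves its contact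
point with nonzero slope (`QuadraticWherePos.slope`, `not_tendsto_zero_of_contact`).

On the other hand `∂_t ρ = T + ∂_x R`, and the flux `R` vanishes with the dissipation
(`flux_coeff_sq_le`). In the limit `∫ ρ ψ²` can therefore only increase in time, while it is at most
`∫ ψ²`. After a time at which it attains this maximum there is no room left, and `∫ T ψ² → 0` in
`L¹` (`ae_tendsto_zero_after_zero`). Near a point of the apparent support `ρ = 1`, so the maximum is
attained for every `ψ` supported nearby, which excludes contact points. One subsequence and one null
set of times must serve all `ψ`; this is achieved by rational bumps and rational time intervals
(`SolutionSeq.exists_subseq`).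

If the apparent support is `(a,b)`, then `{v > 0}` is relatively open and closed in it and nonempty
by conservation of mass, so `v` is the parabola of mass one over `(a,b)`. Uniqueness of the limit
together with the Arzelà–Ascoli theorem yields uniform convergence of the whole sequence, and the
energy bound yields weak convergence in `H¹`. -/

namespace ThinFilm

/-! ### Primitives on compact intervals and integration by parts -/

/-- `F` is a primitive of `f` on every compact interval contained in `U`. -/
def PrimOn (U : Set ℝ) (F f : ℝ → ℝ) : Prop :=
  ∀ x y, x ≤ y → Icc x y ⊆ U →
    IntervalIntegrable f volume x y ∧ ∫ z in x..y, f z = F y - F x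

theorem PrimOn.of_hasDerivAt {U : Set ℝ} {F f : ℝ → ℝ} (h : ∀ x ∈ U, HasDerivAt F (f x) x)
    (hf : ContinuousOn f U) : PrimOn U F f := by
  intro x y hxy hU
  have hi : IntervalIntegrable f volume x y :=
    (hf.mono (by rwa [uIcc_of_le hxy])).intervalIntegrable
  exact ⟨hi, intervalIntegral.integral_eq_sub_of_hasDerivAt
    (fun z hz => h z (hU (by rwa [uIcc_of_le hxy] at hz))) hi⟩

theorem PrimOn.add {U : Set ℝ} {F f G g : ℝ → ℝ} (hF : PrimOn U F f) (hG : PrimOn U G g) :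
    PrimOn U (fun x => F x + G x) (fun x => f x + g x) := by
  intro x y hxy hU
  obtain ⟨h1, h2⟩ := hF x y hxy hU
  obtain ⟨h3, h4⟩ := hG x y hxy hU
  refine ⟨h1.add h3, ?_⟩
  rw [intervalIntegral.integral_add h1 h3, h2, h4]; ring

/-- Primitives of integrable functions are absolutely continuous, and the product rule holds for
these. The classical rule would not suffice: `u_xxx` is only locally integrable, yet it has to be
integrated by parts against `u_xx`. -/
theorem PrimOn.mul {U : Set ℝ} {F f G g : ℝ → ℝ} (hF : PrimOn U F f) (hG : PrimOn U G g) :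
    PrimOn U (fun x => F x * G x) (fun x => f x * G x + F x * g x) := by
  intro x y hxy hU
  -- `H` is controlled on `[x, y]` only; absolute continuity is proved for `z ↦ H x + ∫ t in x..z, h
  -- t`, which agrees with `H` there.
  have key : ∀ {H h : ℝ → ℝ}, PrimOn U H h → IntervalIntegrable h volume x y ∧
      (∀ z ∈ Icc x y, H x + ∫ t in x..z, h t = H z) ∧
      AbsolutelyContinuousOnInterval (fun z => H x + ∫ t in x..z, h t) x y ∧
      ∀ᵐ z, z ∈ uIcc x y → deriv (fun z => H x + ∫ t in x..z, h t) z = h z := by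
    intro H h hH
    have hi := (hH x y hxy hU).1
    refine ⟨hi, fun z hz => ?_, ?_, ?_⟩
    · rw [(hH x z hz.1 ((Icc_subset_Icc_right hz.2).trans hU)).2]; ring
    · have h0 : AbsolutelyContinuousOnInterval (fun _ : ℝ => H x) x y :=
        (contDiff_const.contDiffOn).absolutelyContinuousOnInterval
      exact h0.add (hi.absolutelyContinuousOnInterval_intervalIntegral left_mem_uIcc)
    · filter_upwards [hi.ae_hasDerivAt_integral] with z hz hzm
      exact ((hz hzm x left_mem_uIcc).const_add (H x)).deriv
  obtain ⟨hfi, hFe, hFa, hFd⟩ := key hF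
  obtain ⟨hgi, hGe, hGa, hGd⟩ := key hG
  have hu := uIcc_of_le hxy
  have hFc : ContinuousOn F (uIcc x y) := by
    refine hFa.continuousOn.congr (fun z hz => ?_)
    rw [hu] at hz; exact (hFe z hz).symm
  have hGc : ContinuousOn G (uIcc x y) := by
    refine hGa.continuousOn.congr (fun z hz => ?_)
    rw [hu] at hz; exact (hGe z hz).symm
  refine ⟨(hfi.mul_continuousOn hGc).add (hgi.continuousOn_mul hFc), ?_⟩
  have := hFa.integral_deriv_mul_eq_sub hGa
  rw [hFe y (right_mem_Icc.2 hxy), hGe y (right_mem_Icc.2 hxy), hFe x (left_mem_Icc.2 hxy),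
    hGe x (left_mem_Icc.2 hxy)] at this
  rw [← this]
  apply intervalIntegral.integral_congr_ae
  filter_upwards [hFd, hGd] with z hz1 hz2 hzm
  have hzm' : z ∈ uIcc x y := uIoc_subset_uIcc hzm
  have hzi : z ∈ Icc x y := by rwa [hu] at hzm'
  rw [hz1 hzm', hz2 hzm', hFe z hzi, hGe z hzi]

theorem PrimOn.mono {U V : Set ℝ} {F f : ℝ → ℝ} (h : PrimOn U F f) (hV : V ⊆ U) : PrimOn V F f :=
  fun x y hxy hU => h x y hxy (hU.trans hV)

theorem exists_Icc_mem_nhds_subset {U : Set ℝ} (hU : IsOpen U) {x : ℝ} (hx : x ∈ U) :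
    ∃ r > 0, Icc (x - r) (x + r) ⊆ U := by
  obtain ⟨r, hr, h⟩ := Metric.nhds_basis_closedBall.mem_iff.1 (hU.mem_nhds hx)
  exact ⟨r, hr, by rwa [← Real.closedBall_eq_Icc]⟩

/-- Each point of `[x, y]` has a neighbourhood inside one of the two open sets, and by additivity of
the integral the formula can be continued past the infimum of the points where it fails. -/
theorem PrimOn.union {U V : Set ℝ} (hU : IsOpen U) (hV : IsOpen V) {F f : ℝ → ℝ}
    (hFU : PrimOn U F f) (hFV : PrimOn V F f) : PrimOn (U ∪ V) F f := by
  intro x y hxy hxyU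
  have hloc : ∀ z ∈ Icc x y, ∃ r > 0, PrimOn (Ioo (z - r) (z + r)) F f := by
    intro z hz
    rcases hxyU hz with h | h
    · obtain ⟨r, hr, hs⟩ := exists_Icc_mem_nhds_subset hU h
      exact ⟨r, hr, hFU.mono (Ioo_subset_Icc_self.trans hs)⟩
    · obtain ⟨r, hr, hs⟩ := exists_Icc_mem_nhds_subset hV h
      exact ⟨r, hr, hFV.mono (Ioo_subset_Icc_self.trans hs)⟩
  obtain ⟨hP, hcl⟩ : True ∧ ∀ z ∈ Icc x y, IntervalIntegrable f volume x z ∧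
      ∫ t in x..z, f t = F z - F x := by
    refine ⟨trivial, ?_⟩
    by_contra hcon
    push Not at hcon
    let A : Set ℝ := {z ∈ Icc x y | ¬ (IntervalIntegrable f volume x z ∧
      ∫ t in x..z, f t = F z - F x)}
    have hAne : A.Nonempty := by
      obtain ⟨z, hz, h⟩ := hcon
      exact ⟨z, hz, fun h' => h h'.1 h'.2⟩
    have hAb : BddBelow A := ⟨x, fun z hz => hz.1.1⟩
    set s := sInf A
    have hsx : x ≤ s := le_csInf hAne fun z hz => hz.1.1
    obtain ⟨z0, hz0⟩ := hAne
    have hsy : s ≤ y := (csInf_le hAb hz0).trans hz0.1.2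
    obtain ⟨r, hr, hs⟩ := hloc s ⟨hsx, hsy⟩
    obtain ⟨z1, hz1A, hz1⟩ := exists_lt_of_csInf_lt ⟨z0, hz0⟩ (show sInf A < s + r by
      change s < s + r; linarith)
    have hsz1 : s ≤ z1 := csInf_le hAb hz1A
    set w := max x (s - r / 2)
    have hws : w ≤ s := max_le hsx (by linarith)
    have hw : IntervalIntegrable f volume x w ∧ ∫ t in x..w, f t = F w - F x := by
      rcases eq_or_lt_of_le (le_max_left x (s - r / 2)) with h | h
      · have : w = x := h.symm
        rw [this]; simp
      · by_contra hc
        have hwlt : w < s := by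
          rcases max_choice x (s - r / 2) with h' | h'
          · exact absurd h'.symm (ne_of_lt h)
          · change max x (s - r / 2) < s
            rw [h']; linarith
        exact absurd (csInf_le hAb (show w ∈ A from ⟨⟨le_max_left _ _, hws.trans hsy⟩, hc⟩))
          (not_le.2 hwlt)
    have hwz : IntervalIntegrable f volume w z1 ∧ ∫ t in w..z1, f t = F z1 - F w := by
      refine hs w z1 (hws.trans hsz1) (fun t ht => ⟨?_, ?_⟩)
      · have : s - r / 2 ≤ w := le_max_right _ _
        linarith [ht.1]
      · linarith [ht.2]
    apply hz1A.2
    refine ⟨hw.1.trans hwz.1, ?_⟩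
    rw [← intervalIntegral.integral_add_adjacent_intervals hw.1 hwz.1, hw.2, hwz.2]; ring
  exact hcl y (right_mem_Icc.2 hxy)

/-- Extended by zero, `F` is a primitive on the whole line, so the integral is a difference of
values of `F` outside `K`. This is integration by parts without boundary terms; the main case is `U
= {u > 0}` with `K` a superlevel set of `u` inside the support of a test function. -/
theorem PrimOn.integral_eq_zero {U K : Set ℝ} (hU : IsOpen U) (hK : IsCompact K) (hKU : K ⊆ U)
    {F f : ℝ → ℝ} (hF : PrimOn U F f) (hF0 : ∀ x ∉ K, F x = 0) (hf0 : ∀ x ∉ K, f x = 0) :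
    Integrable f ∧ ∫ x, f x = 0 := by
  have h0 : PrimOn Kᶜ F f := by
    intro x y hxy hs
    have h : EqOn f (fun _ => (0 : ℝ)) (uIcc x y) := fun z hz => hf0 z (hs (by
      rwa [uIcc_of_le hxy] at hz))
    refine ⟨IntervalIntegrable.congr (fun z hz => (h (uIoc_subset_uIcc hz)).symm)
      (intervalIntegrable_const (c := 0)), ?_⟩
    rw [hF0 y (hs (right_mem_Icc.2 hxy)), hF0 x (hs (left_mem_Icc.2 hxy)), sub_zero]
    rw [intervalIntegral.integral_congr h]; simp
  have hall := PrimOn.union hU hK.isClosed.isOpen_compl hF h0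
  have hun : U ∪ Kᶜ = univ := by
    rw [eq_univ_iff_forall]; intro x
    by_cases h : x ∈ K
    · exact Or.inl (hKU h)
    · exact Or.inr h
  obtain ⟨r, hr⟩ := hK.isBounded.subset_closedBall 0
  rw [Real.closedBall_eq_Icc] at hr
  set c := max r 0 + 1
  have hc : 0 < c := by positivity
  have hKc : ∀ x ∈ K, -c < x ∧ x < c := by
    intro x hx
    have := hr hx
    have h2 : r ≤ max r 0 := le_max_left _ _
    constructor <;> linarith [this.1, this.2]
  obtain ⟨hi, he⟩ := hall (-c) c (by linarith) (by rw [hun]; exact subset_univ _)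
  have hsub : ∀ x, x ∉ Ioc (-c) c → f x = 0 := fun x hx => hf0 x (fun h => hx
    ⟨(hKc x h).1, (hKc x h).2.le⟩)
  have hio : IntegrableOn f (Ioc (-c) c) := by
    rwa [intervalIntegrable_iff_integrableOn_Ioc_of_le (by linarith)] at hi
  refine ⟨?_, ?_⟩
  · exact hio.integrable_of_forall_notMem_eq_zero hsub
  · rw [← setIntegral_eq_integral_of_forall_compl_eq_zero hsub,
      ← intervalIntegral.integral_of_le (by linarith), he,
      hF0 c (fun h => absurd (hKc c h).2 (lt_irrefl _)),
      hF0 (-c) (fun h => absurd (hKc _ h).1 (lt_irrefl _)), sub_zero]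

/-! ### Weak derivatives of order one -/

theorem hasWeakDeriv_one_mono {U V : Set ℝ} (hVU : V ⊆ U) {f g : ℝ → ℝ}
    (h : HasWeakDeriv 1 U f g) : HasWeakDeriv 1 V f g := by
  have key : ∀ (a b : ℝ → ℝ), (∀ x ∉ V, a x = 0) → ∫ x in V, b x * a x = ∫ x in U, b x * a x := by
    intro a b ha
    rw [setIntegral_eq_integral_of_forall_compl_eq_zero (fun x hx => by rw [ha x hx, mul_zero]),
      setIntegral_eq_integral_of_forall_compl_eq_zero
        (fun x hx => by rw [ha x (fun h => hx (hVU h)), mul_zero])]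
  refine ⟨h.1.mono_set hVU, h.2.1.mono_set hVU, fun φ hφ => ?_⟩
  have h0 : ∀ x ∉ V, φ x = 0 := fun x hx => image_eq_zero_of_notMem_tsupport fun h => hx (hφ.2.2 h)
  have h1 : ∀ x ∉ V, iteratedDeriv 1 φ x = 0 := fun x hx => by
    rw [iteratedDeriv_one]
    exact image_eq_zero_of_notMem_tsupport
      (f := deriv φ) fun h => hx (hφ.2.2 (closure_minimal (support_deriv_subset)
        (isClosed_tsupport _) h))
  rw [key _ _ h0, key _ _ h1]
  exact h.2.2 φ ⟨hφ.1, hφ.2.1, hφ.2.2.trans hVU⟩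

theorem IsTest.exists_primitive {a b : ℝ} {θ : ℝ → ℝ} (hθ : IsTest (Ioo a b) θ)
    (h0 : ∫ x, θ x = 0) :
    IsTest (Ioo a b) (fun x => ∫ t in a..x, θ t) ∧
      deriv (fun x => ∫ t in a..x, θ t) = θ := by
  have hc : Continuous θ := hθ.1.continuous
  have hd : ∀ x, HasDerivAt (fun x => ∫ t in a..x, θ t) (θ x) x := fun x =>
    intervalIntegral.integral_hasDerivAt_right (hc.intervalIntegrable _ _)
      (hc.stronglyMeasurableAtFilter _ _) hc.continuousAt
  have hderiv : deriv (fun x => ∫ t in a..x, θ t) = θ := funext fun x => (hd x).deriv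
  have hsm : ContDiff ℝ ∞ (fun x => ∫ t in a..x, θ t) := by
    rw [contDiff_infty_iff_deriv, hderiv]
    exact ⟨fun x => (hd x).differentiableAt, hθ.1⟩
  have hz : ∀ x ∉ tsupport θ, θ x = 0 := fun x hx => image_eq_zero_of_notMem_tsupport hx
  obtain ⟨a', b', ha', hb', hsub⟩ : ∃ a' b', a < a' ∧ b' < b ∧ tsupport θ ⊆ Icc a' b' := by
    rcases (tsupport θ).eq_empty_or_nonempty with he | hne
    · exact ⟨a + 1, b - 1, by linarith, by linarith, by rw [he]; exact empty_subset _⟩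
    · have hk : IsCompact (tsupport θ) := hθ.2.1
      refine ⟨sInf (tsupport θ), sSup (tsupport θ), (hθ.2.2 (hk.sInf_mem hne)).1,
        (hθ.2.2 (hk.sSup_mem hne)).2, fun x hx => ⟨csInf_le hk.bddBelow hx,
          le_csSup hk.bddAbove hx⟩⟩
  have hout : ∀ x ∉ Icc a' b', ∫ t in a..x, θ t = 0 := by
    intro x hx
    rw [mem_Icc, not_and_or, not_le, not_le] at hx
    rcases hx with hx | hx
    · rw [intervalIntegral.integral_congr (g := fun _ => 0)]
      · simp
      · intro t ht
        refine hz t fun h => ?_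
        have h1 := hsub h
        rw [mem_uIcc] at ht
        rcases ht with ht | ht <;> linarith [h1.1, h1.2]
    · by_cases hax : a ≤ x
      · rw [intervalIntegral.integral_of_le hax,
          setIntegral_eq_integral_of_forall_compl_eq_zero, h0]
        intro t ht
        refine hz t fun h => ht ⟨ha'.trans_le (hsub h).1, (hsub h).2.trans hx.le⟩
      · rw [intervalIntegral.integral_congr (g := fun _ => 0)]
        · simp
        · intro t ht
          refine hz t fun h => ?_
          have h1 := hsub h
          rw [mem_uIcc] at ht
          rcases ht with ht | ht <;> linarith [h1.1, h1.2]
  have hts : tsupport (fun x => ∫ t in a..x, θ t) ⊆ Icc a' b' :=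
    closure_minimal (fun x hx => by
      by_contra h; exact hx (hout x h)) isClosed_Icc
  exact ⟨⟨hsm, isCompact_Icc.of_isClosed_subset (isClosed_tsupport _) hts,
    hts.trans fun x hx => ⟨ha'.trans_le hx.1, hx.2.trans_lt hb'⟩⟩, hderiv⟩

theorem exists_bump_isTest {U : Set ℝ} (hU : IsOpen U) {x : ℝ} (hx : x ∈ U) :
    ∃ η : ℝ → ℝ, IsTest U η ∧ ∫ y, η y = 1 := by
  obtain ⟨r, hr, hs⟩ := Metric.nhds_basis_closedBall.mem_iff.1 (hU.mem_nhds hx)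
  let b : ContDiffBump x := ⟨r / 2, r, by positivity, by linarith⟩
  refine ⟨b.normed volume, ⟨b.contDiff_normed, b.hasCompactSupport_normed, ?_⟩, b.integral_normed⟩
  rw [b.tsupport_normed_eq]
  exact hs

theorem integrable_mul_of_tsupport_subset {U : Set ℝ} {f φ : ℝ → ℝ}
    (hf : LocallyIntegrableOn f U) (hφ : Continuous φ) (hφc : HasCompactSupport φ)
    (hφU : tsupport φ ⊆ U) : Integrable (fun x => f x * φ x) := by
  have h1 : IntegrableOn f (tsupport φ) :=
    hf.integrableOn_compact_subset hφU hφc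
  have h2 : IntegrableOn (fun x => f x * φ x) (tsupport φ) :=
    h1.mul_continuousOn hφ.continuousOn hφc
  exact h2.integrable_of_forall_notMem_eq_zero fun x hx => by
    rw [image_eq_zero_of_notMem_tsupport hx, mul_zero]

/-- The lemma of du Bois-Reymond. If `η` is a bump of integral one, `φ - (∫ φ) η` has mean zero and
is the derivative of a test function, so `∫ h φ = (∫ h η) ∫ φ`. -/
theorem exists_ae_eq_const_of_integral_mul_deriv_eq_zero {a b : ℝ} (hab : a < b) {h : ℝ → ℝ}
    (hh : LocallyIntegrableOn h (Ioo a b))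
    (H : ∀ φ, IsTest (Ioo a b) φ → ∫ x in Ioo a b, h x * deriv φ x = 0) :
    ∃ c : ℝ, ∀ᵐ x, x ∈ Ioo a b → h x = c := by
  obtain ⟨η, hη, hη1⟩ := exists_bump_isTest (isOpen_Ioo (a := a) (b := b))
    (x := (a + b) / 2) ⟨by linarith, by linarith⟩
  have hext : ∀ φ : ℝ → ℝ, IsTest (Ioo a b) φ →
      ∫ x in Ioo a b, h x * φ x = ∫ x, h x * φ x := fun φ hφ =>
    setIntegral_eq_integral_of_forall_compl_eq_zero fun x hx => by
      rw [image_eq_zero_of_notMem_tsupport fun hx' => hx (hφ.2.2 hx'), mul_zero]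
  refine ⟨∫ x, h x * η x, ?_⟩
  set c := ∫ x, h x * η x
  have hloc : LocallyIntegrableOn (fun x => h x - c) (Ioo a b) :=
    hh.sub (locallyIntegrableOn_const c)
  have := isOpen_Ioo.ae_eq_zero_of_integral_contDiff_smul_eq_zero hloc (fun φ h1 h2 h3 => ?_)
  · filter_upwards [this] with x hx hm using by linarith [hx hm]
  have hφ : IsTest (Ioo a b) φ := ⟨h1, h2, h3⟩
  set m := ∫ x, φ x
  have hφi : Integrable φ := h1.continuous.integrable_of_hasCompactSupport h2
  have hηi : Integrable η := hη.1.continuous.integrable_of_hasCompactSupport hη.2.1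
  have hθ : IsTest (Ioo a b) (fun x => φ x - m * η x) := by
    refine ⟨h1.sub (contDiff_const.mul hη.1), ?_, ?_⟩
    · exact h2.sub (hη.2.1.mul_left)
    · refine (tsupport_sub _ _).trans (union_subset h3 ?_)
      exact (closure_mono (Function.support_mul_subset_right _ _)).trans hη.2.2
  have hθ0 : ∫ x, (φ x - m * η x) = 0 := by
    rw [integral_sub hφi (hηi.const_mul m), integral_const_mul, hη1]; simp [m]
  obtain ⟨hψ, hψd⟩ := hθ.exists_primitive hθ0
  have h4 := H _ hψ
  rw [hψd, hext _ hθ] at h4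
  have i1 := integrable_mul_of_tsupport_subset hh h1.continuous h2 h3
  have i2 := integrable_mul_of_tsupport_subset hh hη.1.continuous hη.2.1 hη.2.2
  have h5 : ∫ x, h x * (φ x - m * η x) = (∫ x, h x * φ x) - m * c := by
    rw [← integral_const_mul, ← integral_sub i1 (i2.const_mul m)]
    congr 1; ext x; ring
  have h6 : ∫ x, φ x • (h x - c) = (∫ x, h x * φ x) - c * m := by
    rw [← integral_const_mul, ← integral_sub i1 (hφi.const_mul c)]
    congr 1; ext x; simp only [smul_eq_mul]; ring
  rw [h6]; linarith

theorem PrimOn.continuousOn {U : Set ℝ} (hU : IsOpen U) {F f : ℝ → ℝ} (h : PrimOn U F f) :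
    ContinuousOn F U := by
  intro x hx
  obtain ⟨r, hr, hs⟩ := exists_Icc_mem_nhds_subset hU hx
  have hc := intervalIntegral.continuousOn_primitive_interval'
    (h (x - r) (x + r) (by linarith) hs).1 (left_mem_uIcc)
  rw [uIcc_of_le (by linarith)] at hc
  have hn : Icc (x - r) (x + r) ∈ 𝓝 x := Icc_mem_nhds (by linarith) (by linarith)
  refine (((hc.continuousAt hn).const_add (F (x - r))).congr ?_).continuousWithinAt
  filter_upwards [hn] with y hy
  rw [(h (x - r) y hy.1 ((Icc_subset_Icc_right hy.2).trans hs)).2]; ring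

/-- The difference between `f` and a primitive of `g` has weak derivative zero, because the
primitive can be integrated by parts against test functions. -/
theorem HasWeakDeriv.exists_ae_eq_add_integral {a b m : ℝ} {f g : ℝ → ℝ}
    (hm : m ∈ Ioo a b) (h : HasWeakDeriv 1 (Ioo a b) f g) :
    PrimOn (Ioo a b) (fun x => ∫ t in m..x, g t) g ∧
      ∃ c : ℝ, ∀ᵐ x, x ∈ Ioo a b → f x = c + ∫ t in m..x, g t := by
  have hgi : ∀ x ∈ Ioo a b, ∀ y ∈ Ioo a b, IntervalIntegrable g volume x y := by
    intro x hx y hy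
    rw [intervalIntegrable_iff]
    refine (h.2.1.integrableOn_compact_subset ?_ (isCompact_uIcc (a := x) (b := y))).mono_set
      uIoc_subset_uIcc
    exact ordConnected_Ioo.uIcc_subset hx hy
  have hP : PrimOn (Ioo a b) (fun x => ∫ t in m..x, g t) g := by
    intro x y hxy hs
    have hx := hs (left_mem_Icc.2 hxy)
    have hy := hs (right_mem_Icc.2 hxy)
    exact ⟨hgi x hx y hy, (intervalIntegral.integral_interval_sub_left (hgi m hm y hy)
      (hgi m hm x hx)).symm⟩
  refine ⟨hP, ?_⟩
  have hGc : ContinuousOn (fun x => ∫ t in m..x, g t) (Ioo a b) := hP.continuousOn isOpen_Ioo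
  have hloc : LocallyIntegrableOn (fun x => f x - ∫ t in m..x, g t) (Ioo a b) :=
    h.1.sub (hGc.locallyIntegrableOn measurableSet_Ioo)
  have hab : a < b := hm.1.trans hm.2
  suffices H : ∀ φ, IsTest (Ioo a b) φ →
      ∫ x in Ioo a b, (f x - ∫ t in m..x, g t) * deriv φ x = 0 by
    obtain ⟨c, hc⟩ := exists_ae_eq_const_of_integral_mul_deriv_eq_zero hab hloc H
    exact ⟨c, by filter_upwards [hc] with x hx hxm using by linarith [hx hxm]⟩
  intro φ hφ
  have hd1 : Continuous (deriv φ) := hφ.1.continuous_deriv (by simp)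
  have hd2 : tsupport (deriv φ) ⊆ tsupport φ :=
    closure_minimal support_deriv_subset (isClosed_tsupport _)
  have i1 := integrable_mul_of_tsupport_subset h.1 hd1 hφ.2.1.deriv (hd2.trans hφ.2.2)
  have i2 := integrable_mul_of_tsupport_subset (hGc.locallyIntegrableOn measurableSet_Ioo) hd1
    hφ.2.1.deriv (hd2.trans hφ.2.2)
  have i3 := integrable_mul_of_tsupport_subset h.2.1 hφ.1.continuous hφ.2.1 hφ.2.2
  have hw := h.2.2 φ hφ
  rw [iteratedDeriv_one] at hw
  have hibp := (hP.mul (PrimOn.of_hasDerivAt (F := φ) (f := deriv φ)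
    (fun x _ => (hφ.1.differentiable (by simp) x).hasDerivAt) hd1.continuousOn)).integral_eq_zero
      (K := tsupport φ) isOpen_Ioo hφ.2.1 hφ.2.2
      (fun x hx => by rw [image_eq_zero_of_notMem_tsupport hx, mul_zero])
      (fun x hx => by
        rw [image_eq_zero_of_notMem_tsupport hx, mul_zero, image_eq_zero_of_notMem_tsupport
          (fun h => hx (hd2 h)), mul_zero, add_zero])
  have hs : ∀ k : ℝ → ℝ, (∀ x ∉ tsupport φ, k x = 0) →
      ∫ x in Ioo a b, k x = ∫ x, k x := fun k hk =>
    setIntegral_eq_integral_of_forall_compl_eq_zero fun x hx => hk x fun hx' => hx (hφ.2.2 hx')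
  have z0 : ∀ x ∉ tsupport φ, φ x = 0 := fun x hx => image_eq_zero_of_notMem_tsupport hx
  have z1 : ∀ x ∉ tsupport φ, deriv φ x = 0 := fun x hx =>
    image_eq_zero_of_notMem_tsupport fun h => hx (hd2 h)
  rw [hs _ fun x hx => by rw [z1 x hx, mul_zero], hs _ fun x hx => by rw [z0 x hx, mul_zero]] at hw
  rw [hs _ fun x hx => by rw [z1 x hx, mul_zero]]
  have h7 := hibp.2
  rw [integral_add i3 i2] at h7
  have h8 : ∫ x, (f x - ∫ t in m..x, g t) * deriv φ x
      = (∫ x, f x * deriv φ x) - ∫ x, (∫ t in m..x, g t) * deriv φ x := by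
    rw [← integral_sub i1 i2]; congr 1; ext x; ring
  rw [h8, hw]; linarith

theorem ae_eq_imp_eq_of_continuousOn {U : Set ℝ} (hU : IsOpen U) {f g : ℝ → ℝ}
    (hf : ContinuousOn f U) (hg : ContinuousOn g U) (h : ∀ᵐ x, x ∈ U → f x = g x) :
    EqOn f g U := by
  refine Measure.eqOn_open_of_ae_eq (μ := volume) ?_ hU hf hg
  exact (ae_restrict_iff' hU.measurableSet).2 h

theorem HasWeakDeriv.primOn {a b : ℝ} {f g : ℝ → ℝ} (h : HasWeakDeriv 1 (Ioo a b) f g)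
    (hf : ContinuousOn f (Ioo a b)) : PrimOn (Ioo a b) f g := by
  intro x y hxy hs
  obtain ⟨hP, c, hc⟩ := h.exists_ae_eq_add_integral (hs (left_mem_Icc.2 hxy))
  have he := ae_eq_imp_eq_of_continuousOn isOpen_Ioo hf
    (continuousOn_const.add (hP.continuousOn isOpen_Ioo)) hc
  obtain ⟨h1, h2⟩ := hP x y hxy hs
  refine ⟨h1, ?_⟩
  rw [h2, he (hs (left_mem_Icc.2 hxy)), he (hs (right_mem_Icc.2 hxy))]
  simp only [Pi.add_apply]; ring

/-- Derivatives of test functions are test functions. This turns the weak derivatives of orders one,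
two and three of `u` into a chain of first-order ones. -/
theorem HasWeakDeriv.of_succ {k : ℕ} {U : Set ℝ} {f g h : ℝ → ℝ} (hg : HasWeakDeriv k U f g)
    (hh : HasWeakDeriv (k + 1) U f h) : HasWeakDeriv 1 U g h := by
  refine ⟨hg.2.1, hh.2.1, fun φ hφ => ?_⟩
  have hφ' : IsTest U (deriv φ) := by
    refine ⟨?_, hφ.2.1.deriv, (closure_minimal support_deriv_subset
      (isClosed_tsupport _)).trans hφ.2.2⟩
    exact (contDiff_infty_iff_deriv.1 hφ.1).2
  have h1 := hg.2.2 _ hφ'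
  have h2 := hh.2.2 _ hφ
  rw [iteratedDeriv_succ', h1] at h2
  rw [iteratedDeriv_one]
  have h3 : ((-1 : ℝ) ^ k) * ∫ x in U, g x * deriv φ x
      = (-1) ^ k * ((-1) ^ 1 * ∫ x in U, h x * φ x) := by rw [h2]; ring
  exact mul_left_cancel₀ (pow_ne_zero _ (by norm_num)) h3

theorem exists_Ioo_subset_of_Icc_subset {U : Set ℝ} (hU : IsOpen U) {x y : ℝ} (hxy : x ≤ y)
    (h : Icc x y ⊆ U) : ∃ a b, a < x ∧ y < b ∧ Ioo a b ⊆ U := by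
  obtain ⟨r, hr, hr'⟩ := exists_Icc_mem_nhds_subset hU (h (left_mem_Icc.2 hxy))
  obtain ⟨s, hs, hs'⟩ := exists_Icc_mem_nhds_subset hU (h (right_mem_Icc.2 hxy))
  refine ⟨x - r, y + s, by linarith, by linarith, fun z hz => ?_⟩
  rcases le_or_gt z x with h1 | h1
  · exact hr' ⟨hz.1.le, by linarith⟩
  · rcases le_or_gt z y with h2 | h2
    · exact h ⟨h1.le, h2⟩
    · exact hs' ⟨by linarith, hz.2.le⟩

theorem ae_of_forall_Ioo_subset {U : Set ℝ} (hU : IsOpen U) {P : ℝ → Prop}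
    (h : ∀ a b, a < b → Ioo a b ⊆ U → ∀ᵐ x, x ∈ Ioo a b → P x) : ∀ᵐ x, x ∈ U → P x := by
  have h1 : ∀ p q : ℚ, ∀ᵐ x : ℝ, Ioo (p : ℝ) q ⊆ U → x ∈ Ioo (p : ℝ) q → P x := by
    intro p q
    by_cases hpq : Ioo (p : ℝ) q ⊆ U
    · rcases lt_or_ge (p : ℝ) q with h2 | h2
      · filter_upwards [h p q h2 hpq] with x hx _ using hx
      · exact Eventually.of_forall fun x _ hx => absurd (hx.1.trans hx.2) (not_lt.2 h2)
    · exact Eventually.of_forall fun x hx => absurd hx hpq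
  filter_upwards [ae_all_iff.2 fun p => ae_all_iff.2 (h1 p)] with x hx hxU
  obtain ⟨r, hr, hs⟩ := exists_Icc_mem_nhds_subset hU hxU
  obtain ⟨p, hp1, hp2⟩ := exists_rat_btwn (show x - r < x by linarith)
  obtain ⟨q, hq1, hq2⟩ := exists_rat_btwn (show x < x + r by linarith)
  exact hx p q (fun z hz => hs ⟨by linarith [hz.1], by linarith [hz.2]⟩) ⟨hp2, hq1⟩

theorem PrimOn.hasDerivAt {U : Set ℝ} (hU : IsOpen U) {F f : ℝ → ℝ} (h : PrimOn U F f)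
    (hf : ContinuousOn f U) {x : ℝ} (hx : x ∈ U) : HasDerivAt F (f x) x := by
  obtain ⟨r, hr, hs⟩ := exists_Icc_mem_nhds_subset hU hx
  have hxr : x - r ∈ Icc (x - r) (x + r) := ⟨le_rfl, by linarith⟩
  have hn : Icc (x - r) (x + r) ∈ 𝓝 x := Icc_mem_nhds (by linarith) (by linarith)
  have hd : HasDerivAt (fun y => ∫ t in (x - r)..y, f t) (f x) x := by
    refine intervalIntegral.integral_hasDerivAt_right
      (h (x - r) x (by linarith) ((Icc_subset_Icc_right (by linarith)).trans hs)).1 ?_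
      (hf.continuousAt (hU.mem_nhds hx))
    exact ContinuousOn.stronglyMeasurableAtFilter hU hf x hx
  refine (hd.add_const (F (x - r))).congr_of_eventuallyEq ?_
  filter_upwards [hn] with y hy
  rw [(h (x - r) y hy.1 ((Icc_subset_Icc_right hy.2).trans hs)).2]; ring

/-- Having a locally integrable weak derivative, `f2` agrees almost everywhere with a continuous
function, so `f1` is continuously differentiable and `deriv f1` is that function. From here on
`deriv u_x` stands for `u_xx`, which is prescribed only up to null sets. -/
theorem HasWeakDeriv.deriv_regularity {U : Set ℝ} (hU : IsOpen U) {f1 f2 f3 : ℝ → ℝ}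
    (hf1 : ContinuousOn f1 U) (h2 : HasWeakDeriv 1 U f1 f2) (h3 : HasWeakDeriv 1 U f2 f3) :
    (∀ x ∈ U, HasDerivAt f1 (deriv f1 x) x) ∧ PrimOn U (deriv f1) f3 ∧
      ∀ᵐ x, x ∈ U → f2 x = deriv f1 x := by
  -- The constant of integration depends on the interval, but the conclusions are local and mention
  -- only `deriv f1`, so they patch together.
  have key : ∀ a b, a < b → Ioo a b ⊆ U → (∀ x ∈ Ioo a b, HasDerivAt f1 (deriv f1 x) x) ∧
      PrimOn (Ioo a b) (deriv f1) f3 ∧ ∀ᵐ x, x ∈ Ioo a b → f2 x = deriv f1 x := by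
    intro a b hab hs
    obtain ⟨hP, c, hc⟩ := (hasWeakDeriv_one_mono hs h3).exists_ae_eq_add_integral
      (m := (a + b) / 2) ⟨by linarith, by linarith⟩
    set h : ℝ → ℝ := fun x => c + ∫ t in ((a + b) / 2)..x, f3 t
    have hcont : ContinuousOn h (Ioo a b) := continuousOn_const.add (hP.continuousOn isOpen_Ioo)
    have h1 := (hasWeakDeriv_one_mono hs h2).primOn (hf1.mono hs)
    have h1' : PrimOn (Ioo a b) f1 h := by
      intro x y hxy hxs
      have hae : ∀ᵐ z, z ∈ uIoc x y → f2 z = h z := by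
        filter_upwards [hc] with z hz hzm
        rw [uIoc_of_le hxy] at hzm
        exact hz (hxs (Ioc_subset_Icc_self hzm))
      refine ⟨(h1 x y hxy hxs).1.congr_ae ((ae_restrict_iff' measurableSet_uIoc).2 hae), ?_⟩
      rw [← intervalIntegral.integral_congr_ae hae]
      exact (h1 x y hxy hxs).2
    have hd : ∀ x ∈ Ioo a b, HasDerivAt f1 (h x) x := fun x hx =>
      h1'.hasDerivAt isOpen_Ioo hcont hx
    have hde : ∀ x ∈ Ioo a b, deriv f1 x = h x := fun x hx => (hd x hx).deriv
    refine ⟨fun x hx => by rw [hde x hx]; exact hd x hx, ?_, ?_⟩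
    · intro x y hxy hxs
      refine ⟨(hP x y hxy hxs).1, ?_⟩
      rw [hde x (hxs (left_mem_Icc.2 hxy)), hde y (hxs (right_mem_Icc.2 hxy)),
        (hP x y hxy hxs).2]
      simp only [h]; ring
    · filter_upwards [hc] with x hx hxm
      rw [hde x hxm, hx hxm]
  refine ⟨fun x hx => ?_, fun x y hxy hs => ?_, ?_⟩
  · obtain ⟨r, hr, hs⟩ := exists_Icc_mem_nhds_subset hU hx
    exact (key (x - r) (x + r) (by linarith) (Ioo_subset_Icc_self.trans hs)).1 x
      ⟨by linarith, by linarith⟩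
  · obtain ⟨a, b, ha, hb, hab⟩ := exists_Ioo_subset_of_Icc_subset hU hxy hs
    exact (key a b (by linarith) hab).2.1 x y hxy fun z hz => ⟨ha.trans_le hz.1, hz.2.trans_lt hb⟩
  · exact ae_of_forall_Ioo_subset hU fun a b hab hs => (key a b hab hs).2.2

/-! ### Cutoffs of the identity -/

/-- A smooth nondecreasing function, equal to `0` on `(-∞,δ]` and to `1` on `[2δ,∞)`. -/
noncomputable def step (δ s : ℝ) : ℝ := Real.smoothTransition ((s - δ) / δ)

/-- The primitive of `step δ`; it vanishes on `(-∞,δ]` and has slope `1` on `[2δ,∞)`. -/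
noncomputable def cutoff (δ s : ℝ) : ℝ := ∫ r in (0 : ℝ)..s, step δ r

theorem contDiff_step (δ : ℝ) : ContDiff ℝ ∞ (step δ) :=
  Real.smoothTransition.contDiff.comp ((contDiff_id.sub contDiff_const).div_const δ)

theorem continuous_step (δ : ℝ) : Continuous (step δ) := (contDiff_step δ).continuous

theorem hasDerivAt_step (δ s : ℝ) : HasDerivAt (step δ) (deriv (step δ) s) s :=
  ((contDiff_step δ).differentiable (by simp) s).hasDerivAt

theorem continuous_deriv_step (δ : ℝ) : Continuous (deriv (step δ)) :=
  (contDiff_step δ).continuous_deriv (by simp)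

theorem hasDerivAt_cutoff (δ s : ℝ) : HasDerivAt (cutoff δ) (step δ s) s :=
  intervalIntegral.integral_hasDerivAt_right ((continuous_step δ).intervalIntegrable _ _)
    ((continuous_step δ).stronglyMeasurableAtFilter _ _) (continuous_step δ).continuousAt

theorem continuous_cutoff (δ : ℝ) : Continuous (cutoff δ) :=
  continuous_iff_continuousAt.2 fun s => (hasDerivAt_cutoff δ s).continuousAt

theorem step_nonneg (δ s : ℝ) : 0 ≤ step δ s := Real.smoothTransition.nonneg _

theorem step_le_one (δ s : ℝ) : step δ s ≤ 1 := Real.smoothTransition.le_one _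

theorem monotone_step {δ : ℝ} (hδ : 0 < δ) : Monotone (step δ) := fun s t h =>
  Real.smoothTransition.monotone (by gcongr)

theorem step_of_le {δ s : ℝ} (hδ : 0 < δ) (h : s ≤ δ) : step δ s = 0 :=
  Real.smoothTransition.zero_of_nonpos (div_nonpos_of_nonpos_of_nonneg (by linarith) hδ.le)

theorem step_of_ge {δ s : ℝ} (hδ : 0 < δ) (h : 2 * δ ≤ s) : step δ s = 1 :=
  Real.smoothTransition.one_of_one_le (by rw [le_div_iff₀ hδ]; linarith)

theorem deriv_step_nonneg {δ : ℝ} (hδ : 0 < δ) (s : ℝ) : 0 ≤ deriv (step δ) s :=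
  (monotone_step hδ).deriv_nonneg

theorem deriv_step_of_lt {δ s : ℝ} (hδ : 0 < δ) (h : s < δ) : deriv (step δ) s = 0 := by
  have : step δ =ᶠ[𝓝 s] fun _ => 0 := by
    filter_upwards [Iio_mem_nhds h] with t ht using step_of_le hδ (le_of_lt ht)
  rw [this.deriv_eq]; simp

theorem cutoff_of_le {δ s : ℝ} (hδ : 0 < δ) (h : s ≤ δ) : cutoff δ s = 0 := by
  unfold cutoff
  rw [intervalIntegral.integral_congr (g := fun _ => 0)]
  · simp
  · intro r hr
    refine step_of_le hδ ?_
    rw [mem_uIcc] at hr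
    rcases hr with hr | hr <;> linarith

theorem cutoff_nonneg (δ : ℝ) {s : ℝ} (hs : 0 ≤ s) : 0 ≤ cutoff δ s :=
  intervalIntegral.integral_nonneg hs fun r _ => step_nonneg δ r

theorem cutoff_le (δ : ℝ) {s : ℝ} (hs : 0 ≤ s) : cutoff δ s ≤ s := by
  have := intervalIntegral.integral_mono_on (μ := volume) hs ((continuous_step δ).intervalIntegrable 0 s)
    (intervalIntegrable_const (c := (1 : ℝ))) (fun r _ => step_le_one δ r)
  simpa [cutoff] using this

theorem sub_cutoff_le {δ s : ℝ} (hδ : 0 < δ) (hs : 0 ≤ s) : s - cutoff δ s ≤ 2 * δ := by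
  rcases le_or_gt s (2 * δ) with h | h
  · linarith [cutoff_nonneg δ hs]
  · have h1 : cutoff δ s = cutoff δ (2 * δ) + ∫ r in (2 * δ)..s, step δ r :=
      (intervalIntegral.integral_add_adjacent_intervals (μ := volume) (f := step δ)
        ((continuous_step δ).intervalIntegrable _ _)
        ((continuous_step δ).intervalIntegrable _ _)).symm
    have h2 : ∫ r in (2 * δ)..s, step δ r = s - 2 * δ := by
      rw [intervalIntegral.integral_congr (g := fun _ => 1)]
      · simp
      · intro r hr
        rw [uIcc_of_le h.le] at hr
        exact step_of_ge hδ hr.1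
    linarith [cutoff_nonneg δ (show 0 ≤ 2 * δ by linarith)]

/-! ### Solutions at a fixed time -/

/-- The properties of a solution at a generic time: `f`, `f1`, `f3` stand for `u`, `u_x`, `u_xxx`,
and `u_xx = deriv f1`. -/
structure Slice (L R : ℝ) (f f1 f3 : ℝ → ℝ) : Prop where
  cont : ContinuousOn f (Icc L R)
  nonneg : ∀ x ∈ Icc L R, 0 ≤ f x
  hasDerivAt : ∀ x ∈ Ioo L R, HasDerivAt f (f1 x) x
  cont1 : ContinuousOn f1 (Icc L R)
  left : f1 L = 0
  right : f1 R = 0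
  hasDerivAt1 : ∀ x ∈ Ioo L R, 0 < f x → HasDerivAt f1 (deriv f1 x) x
  prim : PrimOn {x ∈ Ioo L R | 0 < f x} (deriv f1) f3
  meas3 : AEStronglyMeasurable (fun x => f x * f3 x) (volume.restrict (Ioo L R))
  int2 : IntegrableOn (fun x => f x * deriv f1 x ^ 2) (Ioo L R)
  T_eq : ∀ φ : ℝ → ℝ, ContDiff ℝ ∞ φ →
    ∫ x in Ioo L R, - (f x * f1 x * f3 x) * φ x =
      (∫ x in Ioo L R, f x * deriv f1 x ^ 2 * φ x)
        - (5 / 6) * (∫ x in Ioo L R, f1 x ^ 3 * deriv φ x)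
        - (1 / 2) * ∫ x in Ioo L R, f x * f1 x ^ 2 * iteratedDeriv 2 φ x

namespace Slice

variable {L R : ℝ} {f f1 f3 : ℝ → ℝ}

theorem isOpen_pos (h : Slice L R f f1 f3) : IsOpen {x ∈ Ioo L R | 0 < f x} := by
  have : {x ∈ Ioo L R | 0 < f x} = Ioo L R ∩ f ⁻¹' Ioi 0 := rfl
  rw [this]
  exact (h.cont.mono Ioo_subset_Icc_self).isOpen_inter_preimage isOpen_Ioo isOpen_Ioi

theorem continuousOn2 (h : Slice L R f f1 f3) :
    ContinuousOn (deriv f1) {x ∈ Ioo L R | 0 < f x} :=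
  h.prim.continuousOn h.isOpen_pos

theorem deriv_eq_zero (h : Slice L R f f1 f3) {x : ℝ} (hx : x ∈ Ioo L R) (h0 : f x = 0) :
    f1 x = 0 := by
  refine IsLocalMin.hasDerivAt_eq_zero ?_ (h.hasDerivAt x hx)
  filter_upwards [isOpen_Ioo.mem_nhds hx] with y hy
  rw [h0]; exact h.nonneg y (Ioo_subset_Icc_self hy)

theorem isCompact_superlevel (h : Slice L R f f1 f3) {K : Set ℝ} (hK : IsCompact K)
    (hKs : K ⊆ Ioo L R) (δ : ℝ) : IsCompact {x ∈ K | δ ≤ f x} := by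
  have : {x ∈ K | δ ≤ f x} = K ∩ f ⁻¹' Ici δ := rfl
  rw [this]
  exact hK.of_isClosed_subset ((h.cont.mono (hKs.trans Ioo_subset_Icc_self)).preimage_isClosed_of_isClosed
    hK.isClosed isClosed_Ici) inter_subset_left

/-- The integrand is the derivative of `cutoff δ (f) f1² φ'`, which vanishes where `f < δ`; only the
region in which `f1` is differentiable enters. -/
theorem integral_cutoff_deriv (h : Slice L R f f1 f3) {φ : ℝ → ℝ} (hφ : IsTest (Ioo L R) φ) {δ : ℝ}
    (hδ : 0 < δ) :
    ∫ x in Ioo L R, (step δ (f x) * f1 x ^ 3 * deriv φ x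
      + 2 * cutoff δ (f x) * f1 x * deriv f1 x * deriv φ x
      + cutoff δ (f x) * f1 x ^ 2 * iteratedDeriv 2 φ x) = 0 := by
  have hU := h.isOpen_pos
  have hφ1 : ContDiff ℝ ∞ (deriv φ) := (contDiff_infty_iff_deriv.1 hφ.1).2
  have hφ2 : ∀ x, HasDerivAt (deriv φ) (iteratedDeriv 2 φ x) x := fun x => by
    rw [iteratedDeriv_succ, iteratedDeriv_one]
    exact (hφ1.differentiable (by simp) x).hasDerivAt
  have hφ2c : Continuous (iteratedDeriv 2 φ) := by
    rw [iteratedDeriv_succ, iteratedDeriv_one]; exact hφ1.continuous_deriv (by simp)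
  have cf : ContinuousOn f {x ∈ Ioo L R | 0 < f x} :=
    h.cont.mono fun x hx => Ioo_subset_Icc_self hx.1
  have cf1 : ContinuousOn f1 {x ∈ Ioo L R | 0 < f x} :=
    h.cont1.mono fun x hx => Ioo_subset_Icc_self hx.1
  have cf2 := h.continuousOn2
  have cs : ContinuousOn (fun x => step δ (f x)) {x ∈ Ioo L R | 0 < f x} :=
    (continuous_step δ).comp_continuousOn cf
  have cc : ContinuousOn (fun x => cutoff δ (f x)) {x ∈ Ioo L R | 0 < f x} :=
    (continuous_cutoff δ).comp_continuousOn cf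
  have cφ1 := hφ1.continuous.continuousOn (s := {x ∈ Ioo L R | 0 < f x})
  have cφ2 := hφ2c.continuousOn (s := {x ∈ Ioo L R | 0 < f x})
  have hts : tsupport (deriv φ) ⊆ tsupport φ :=
    closure_minimal support_deriv_subset (isClosed_tsupport _)
  have z1 : ∀ x ∉ tsupport φ, deriv φ x = 0 := fun x hx =>
    image_eq_zero_of_notMem_tsupport fun h => hx (hts h)
  have z2 : ∀ x ∉ tsupport φ, iteratedDeriv 2 φ x = 0 := fun x hx => by
    rw [iteratedDeriv_succ, iteratedDeriv_one]
    exact image_eq_zero_of_notMem_tsupport fun h => hx (hts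
      (closure_minimal support_deriv_subset (isClosed_tsupport _) h))
  have key := (PrimOn.of_hasDerivAt (U := {x ∈ Ioo L R | 0 < f x})
    (F := fun x => cutoff δ (f x) * f1 x ^ 2 * deriv φ x)
    (f := fun x => step δ (f x) * f1 x ^ 3 * deriv φ x
      + 2 * cutoff δ (f x) * f1 x * deriv f1 x * deriv φ x
      + cutoff δ (f x) * f1 x ^ 2 * iteratedDeriv 2 φ x)
    (fun x hx => by
      have d0 := (hasDerivAt_cutoff δ (f x)).comp x (h.hasDerivAt x hx.1)
      have d1 := h.hasDerivAt1 x hx.1 hx.2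
      convert! (d0.mul (d1.pow 2)).mul (hφ2 x) using 1
      simp; ring)
    (by fun_prop)).integral_eq_zero hU
    (h.isCompact_superlevel (hφ.2.1 : IsCompact (tsupport φ)) hφ.2.2 δ)
    (fun x hx => ⟨hφ.2.2 hx.1, hδ.trans_le hx.2⟩)
    (fun x hx => by
      by_cases hxt : x ∈ tsupport φ
      · have : f x < δ := not_le.1 fun h' => hx ⟨hxt, h'⟩
        simp [cutoff_of_le hδ this.le]
      · simp [z1 x hxt])
    (fun x hx => by
      by_cases hxt : x ∈ tsupport φ
      · have : f x < δ := not_le.1 fun h' => hx ⟨hxt, h'⟩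
        simp [cutoff_of_le hδ this.le, step_of_le hδ this.le]
      · simp [z1 x hxt, z2 x hxt])
  rw [setIntegral_eq_integral_of_forall_compl_eq_zero]
  · exact key.2
  · intro x hx
    have hxt : x ∉ tsupport φ := fun h => hx (hφ.2.2 h)
    simp [z1 x hxt, z2 x hxt]

/-- Integrating `cutoff δ (f) f1 f3 φ` by parts produces `step δ (f) f1² f1' φ`, a third of `step δ
(f) (f1³)' φ`. A second integration by parts turns it into the term with `f1⁴`, which detects
contact angles. The coefficient `5/3` is `1 + 2/3`, the second part coming from the correction in
`φ'`. -/
theorem integral_cutoff_T (h : Slice L R f f1 f3) {φ : ℝ → ℝ} (hφ : IsTest (Ioo L R) φ) {δ : ℝ}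
    (hδ : 0 < δ) :
    Integrable (fun x => cutoff δ (f x) * deriv f1 x ^ 2 * φ x
      + cutoff δ (f x) * f1 x * f3 x * φ x
      + 5 / 3 * cutoff δ (f x) * f1 x * deriv f1 x * deriv φ x
      - 1 / 3 * deriv (step δ) (f x) * f1 x ^ 4 * φ x
      + 1 / 3 * cutoff δ (f x) * f1 x ^ 2 * iteratedDeriv 2 φ x) (volume.restrict (Ioo L R)) ∧
    ∫ x in Ioo L R, (cutoff δ (f x) * deriv f1 x ^ 2 * φ x
      + cutoff δ (f x) * f1 x * f3 x * φ x
      + 5 / 3 * cutoff δ (f x) * f1 x * deriv f1 x * deriv φ x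
      - 1 / 3 * deriv (step δ) (f x) * f1 x ^ 4 * φ x
      + 1 / 3 * cutoff δ (f x) * f1 x ^ 2 * iteratedDeriv 2 φ x) = 0 := by
  have hU := h.isOpen_pos
  have hφ1 : ContDiff ℝ ∞ (deriv φ) := (contDiff_infty_iff_deriv.1 hφ.1).2
  have hφd : ∀ x, HasDerivAt φ (deriv φ x) x := fun x =>
    (hφ.1.differentiable (by simp) x).hasDerivAt
  have hφ2 : ∀ x, HasDerivAt (deriv φ) (iteratedDeriv 2 φ x) x := fun x => by
    rw [iteratedDeriv_succ, iteratedDeriv_one]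
    exact (hφ1.differentiable (by simp) x).hasDerivAt
  have hφ2c : Continuous (iteratedDeriv 2 φ) := by
    rw [iteratedDeriv_succ, iteratedDeriv_one]; exact hφ1.continuous_deriv (by simp)
  have cf : ContinuousOn f {x ∈ Ioo L R | 0 < f x} :=
    h.cont.mono fun x hx => Ioo_subset_Icc_self hx.1
  have cf1 : ContinuousOn f1 {x ∈ Ioo L R | 0 < f x} :=
    h.cont1.mono fun x hx => Ioo_subset_Icc_self hx.1
  have cf2 := h.continuousOn2
  have cs : ContinuousOn (fun x => step δ (f x)) {x ∈ Ioo L R | 0 < f x} :=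
    (continuous_step δ).comp_continuousOn cf
  have cs1 : ContinuousOn (fun x => deriv (step δ) (f x)) {x ∈ Ioo L R | 0 < f x} :=
    (continuous_deriv_step δ).comp_continuousOn cf
  have cc : ContinuousOn (fun x => cutoff δ (f x)) {x ∈ Ioo L R | 0 < f x} :=
    (continuous_cutoff δ).comp_continuousOn cf
  have cφ := hφ.1.continuous.continuousOn (s := {x ∈ Ioo L R | 0 < f x})
  have cφ1 := hφ1.continuous.continuousOn (s := {x ∈ Ioo L R | 0 < f x})
  have cφ2 := hφ2c.continuousOn (s := {x ∈ Ioo L R | 0 < f x})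
  have hts : tsupport (deriv φ) ⊆ tsupport φ :=
    closure_minimal support_deriv_subset (isClosed_tsupport _)
  have z0 : ∀ x ∉ tsupport φ, φ x = 0 := fun x hx => image_eq_zero_of_notMem_tsupport hx
  have z1 : ∀ x ∉ tsupport φ, deriv φ x = 0 := fun x hx =>
    image_eq_zero_of_notMem_tsupport fun h => hx (hts h)
  have z2 : ∀ x ∉ tsupport φ, iteratedDeriv 2 φ x = 0 := fun x hx => by
    rw [iteratedDeriv_succ, iteratedDeriv_one]
    exact image_eq_zero_of_notMem_tsupport fun h => hx (hts
      (closure_minimal support_deriv_subset (isClosed_tsupport _) h))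
  have p1 : PrimOn {x ∈ Ioo L R | 0 < f x} (fun x => cutoff δ (f x) * f1 x * φ x)
      (fun x => step δ (f x) * f1 x ^ 2 * φ x + cutoff δ (f x) * deriv f1 x * φ x
        + cutoff δ (f x) * f1 x * deriv φ x) :=
    PrimOn.of_hasDerivAt (fun x hx => by
      have d0 := (hasDerivAt_cutoff δ (f x)).comp x (h.hasDerivAt x hx.1)
      have d1 := h.hasDerivAt1 x hx.1 hx.2
      convert! (d0.mul d1).mul (hφd x) using 1
      simp; ring) (by fun_prop)
  -- Two corrections. The second cancels `step δ (f) f1² f1' φ` in favour of the term with `f1⁴`;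
  -- the first cancels the `step δ (f) f1³ φ'` that the second leaves behind.
  have p2 : PrimOn {x ∈ Ioo L R | 0 < f x}
      (fun x => 1 / 3 * (cutoff δ (f x) * f1 x ^ 2 * deriv φ x)
        - 1 / 3 * (step δ (f x) * f1 x ^ 3 * φ x))
      (fun x => 1 / 3 * (step δ (f x) * f1 x ^ 3 * deriv φ x
          + 2 * cutoff δ (f x) * f1 x * deriv f1 x * deriv φ x
          + cutoff δ (f x) * f1 x ^ 2 * iteratedDeriv 2 φ x)
        - 1 / 3 * (deriv (step δ) (f x) * f1 x ^ 4 * φ x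
          + 3 * step δ (f x) * f1 x ^ 2 * deriv f1 x * φ x
          + step δ (f x) * f1 x ^ 3 * deriv φ x)) :=
    PrimOn.of_hasDerivAt (fun x hx => by
      have d0 := (hasDerivAt_cutoff δ (f x)).comp x (h.hasDerivAt x hx.1)
      have ds := (hasDerivAt_step δ (f x)).comp x (h.hasDerivAt x hx.1)
      have d1 := h.hasDerivAt1 x hx.1 hx.2
      convert! (((d0.mul (d1.pow 2)).mul (hφ2 x)).const_mul (1 / 3)).sub
        (((ds.mul (d1.pow 3)).mul (hφd x)).const_mul (1 / 3)) using 1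
      simp; ring) (by fun_prop)
  have e : (fun x => cutoff δ (f x) * deriv f1 x ^ 2 * φ x
      + cutoff δ (f x) * f1 x * f3 x * φ x
      + 5 / 3 * cutoff δ (f x) * f1 x * deriv f1 x * deriv φ x
      - 1 / 3 * deriv (step δ) (f x) * f1 x ^ 4 * φ x
      + 1 / 3 * cutoff δ (f x) * f1 x ^ 2 * iteratedDeriv 2 φ x)
      = fun x => ((step δ (f x) * f1 x ^ 2 * φ x + cutoff δ (f x) * deriv f1 x * φ x
        + cutoff δ (f x) * f1 x * deriv φ x) * deriv f1 x
        + cutoff δ (f x) * f1 x * φ x * f3 x)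
        + (1 / 3 * (step δ (f x) * f1 x ^ 3 * deriv φ x
          + 2 * cutoff δ (f x) * f1 x * deriv f1 x * deriv φ x
          + cutoff δ (f x) * f1 x ^ 2 * iteratedDeriv 2 φ x)
        - 1 / 3 * (deriv (step δ) (f x) * f1 x ^ 4 * φ x
          + 3 * step δ (f x) * f1 x ^ 2 * deriv f1 x * φ x
          + step δ (f x) * f1 x ^ 3 * deriv φ x)) := by
    ext x; ring
  have key := ((p1.mul h.prim).add p2).integral_eq_zero hU
    (h.isCompact_superlevel (hφ.2.1 : IsCompact (tsupport φ)) hφ.2.2 (δ / 2))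
    (fun x hx => ⟨hφ.2.2 hx.1, (half_pos hδ).trans_le hx.2⟩)
    (fun x hx => by
      by_cases hxt : x ∈ tsupport φ
      · have : f x < δ / 2 := not_le.1 fun h' => hx ⟨hxt, h'⟩
        have : f x < δ := by linarith
        simp [cutoff_of_le hδ this.le, step_of_le hδ this.le]
      · simp [z0 x hxt, z1 x hxt])
    (fun x hx => by
      by_cases hxt : x ∈ tsupport φ
      · have : f x < δ / 2 := not_le.1 fun h' => hx ⟨hxt, h'⟩
        have : f x < δ := by linarith
        simp [cutoff_of_le hδ this.le, step_of_le hδ this.le, deriv_step_of_lt hδ this]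
      · simp [z0 x hxt, z1 x hxt, z2 x hxt])
  rw [← e] at key
  refine ⟨key.1.integrableOn, ?_⟩
  rw [setIntegral_eq_integral_of_forall_compl_eq_zero]
  · exact key.2
  · intro x hx
    have hxt : x ∉ tsupport φ := fun h => hx (hφ.2.2 h)
    simp [z0 x hxt, z1 x hxt, z2 x hxt]

end Slice

/-! ### Removal of the cutoff and the lower bound for the source -/

theorem ContDiff.exists_abs_bound {a b : ℝ} {φ : ℝ → ℝ} (h : ContinuousOn φ (Icc a b)) :
    ∃ C, 0 ≤ C ∧ ∀ x ∈ Icc a b, |φ x| ≤ C := by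
  obtain ⟨C, hC⟩ := isCompact_Icc.exists_bound_of_continuousOn h
  exact ⟨max C 0, le_max_right _ _, fun x hx => (hC x hx).trans (le_max_left _ _)⟩

namespace Slice

variable {L R : ℝ} {f f1 f3 : ℝ → ℝ}

theorem aesm (h : Slice L R f f1 f3) : AEStronglyMeasurable f (volume.restrict (Ioo L R)) :=
  (h.cont.mono Ioo_subset_Icc_self).aestronglyMeasurable measurableSet_Ioo

theorem aesm1 (h : Slice L R f f1 f3) : AEStronglyMeasurable f1 (volume.restrict (Ioo L R)) :=
  (h.cont1.mono Ioo_subset_Icc_self).aestronglyMeasurable measurableSet_Ioo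

theorem aesm2 : AEStronglyMeasurable (deriv f1) (volume.restrict (Ioo L R)) :=
  (measurable_deriv f1).aestronglyMeasurable

theorem integrable_sq_mul (h : Slice L R f f1 f3) {φ : ℝ → ℝ} (hφ : Continuous φ) :
    Integrable (fun x => f x * deriv f1 x ^ 2 * φ x) (volume.restrict (Ioo L R)) := by
  obtain ⟨P, hP0, hP⟩ := ContDiff.exists_abs_bound (a := L) (b := R) hφ.continuousOn
  refine (Integrable.const_mul h.int2 P).mono'
    ((h.aesm.mul (aesm2.pow 2)).mul hφ.aestronglyMeasurable) ?_
  refine (ae_restrict_iff' measurableSet_Ioo).2 (Eventually.of_forall fun x hx => ?_)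
  have hx' := Ioo_subset_Icc_self hx
  have h0 : 0 ≤ f x * deriv f1 x ^ 2 := mul_nonneg (h.nonneg x hx') (sq_nonneg _)
  rw [Real.norm_eq_abs, abs_mul, abs_of_nonneg h0, mul_comm]
  exact mul_le_mul_of_nonneg_right (hP x hx') h0

theorem integrable_mixed (h : Slice L R f f1 f3) {φ : ℝ → ℝ} (hφ : Continuous φ) :
    Integrable (fun x => f x * f1 x * deriv f1 x * φ x) (volume.restrict (Ioo L R)) := by
  obtain ⟨P, hP0, hP⟩ := ContDiff.exists_abs_bound (a := L) (b := R) hφ.continuousOn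
  have i1 : IntegrableOn (fun x => f x * f1 x ^ 2) (Ioo L R) :=
    ((h.cont.mul (h.cont1.pow 2)).integrableOn_Icc).mono_set Ioo_subset_Icc_self
  refine ((Integrable.add i1 h.int2).const_mul P).mono'
    (((h.aesm.mul h.aesm1).mul aesm2).mul hφ.aestronglyMeasurable) ?_
  refine (ae_restrict_iff' measurableSet_Ioo).2 (Eventually.of_forall fun x hx => ?_)
  have hx' := Ioo_subset_Icc_self hx
  have h0 := h.nonneg x hx'
  rw [Real.norm_eq_abs, abs_mul, mul_comm]
  refine mul_le_mul (hP x hx') ?_ (abs_nonneg _) hP0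
  rw [mul_assoc, abs_mul, abs_of_nonneg h0, abs_mul]
  simp only [Pi.add_apply]
  nlinarith [sq_nonneg (|f1 x| - |deriv f1 x|), sq_abs (f1 x), sq_abs (deriv f1 x),
    mul_nonneg h0 (sq_nonneg (|f1 x| - |deriv f1 x|)),
    mul_nonneg h0 (add_nonneg (sq_nonneg (|f1 x|)) (sq_nonneg (|deriv f1 x|)))]

theorem integrable_cont {g : ℝ → ℝ} (hg : ContinuousOn g (Icc L R)) :
    Integrable g (volume.restrict (Ioo L R)) :=
  IntegrableOn.mono_set (hg.integrableOn_Icc) Ioo_subset_Icc_self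

/-- This is the limit `δ → 0` of `integral_cutoff_deriv`. Since `cutoff δ (f) ≤ f`, the integrand is
dominated with the help of the bound on `∫ f f1'²`; on `{f = 0}` the term with `step` converges to
the right limit because `f1` vanishes at interior zeros of `f ≥ 0`. -/
theorem integral_cube (h : Slice L R f f1 f3) {φ : ℝ → ℝ} (hφ : IsTest (Ioo L R) φ) :
    (∫ x in Ioo L R, f1 x ^ 3 * deriv φ x)
      + 2 * (∫ x in Ioo L R, f x * f1 x * deriv f1 x * deriv φ x)
      + ∫ x in Ioo L R, f x * f1 x ^ 2 * iteratedDeriv 2 φ x = 0 := by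
  have hφ1 : ContDiff ℝ ∞ (deriv φ) := (contDiff_infty_iff_deriv.1 hφ.1).2
  have hφ2c : Continuous (iteratedDeriv 2 φ) := by
    rw [iteratedDeriv_succ, iteratedDeriv_one]; exact hφ1.continuous_deriv (by simp)
  have c := h.cont
  have c1 := h.cont1
  have cφ1 := hφ1.continuous.continuousOn (s := Icc L R)
  have cφ2 := hφ2c.continuousOn (s := Icc L R)
  have i1 : Integrable (fun x => f1 x ^ 3 * deriv φ x) (volume.restrict (Ioo L R)) :=
    integrable_cont (by fun_prop)
  have i2 := h.integrable_mixed hφ1.continuous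
  have i3 : Integrable (fun x => f x * f1 x ^ 2 * iteratedDeriv 2 φ x)
    (volume.restrict (Ioo L R)) := integrable_cont (by fun_prop)
  let δ : ℕ → ℝ := fun j => 1 / ((j : ℝ) + 1)
  have hδ : ∀ j, 0 < δ j := fun j => by positivity
  have hδ0 : Tendsto δ atTop (𝓝 0) := tendsto_one_div_add_atTop_nhds_zero_nat
  have hz := fun j => h.integral_cutoff_deriv hφ (hδ j)
  have hlim : Tendsto (fun j => ∫ x in Ioo L R, (step (δ j) (f x) * f1 x ^ 3 * deriv φ x
      + 2 * cutoff (δ j) (f x) * f1 x * deriv f1 x * deriv φ x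
      + cutoff (δ j) (f x) * f1 x ^ 2 * iteratedDeriv 2 φ x)) atTop
      (𝓝 (∫ x in Ioo L R, (f1 x ^ 3 * deriv φ x + 2 * (f x * f1 x * deriv f1 x * deriv φ x)
        + f x * f1 x ^ 2 * iteratedDeriv 2 φ x))) := by
    refine tendsto_integral_of_dominated_convergence (fun x => |f1 x ^ 3 * deriv φ x|
      + 2 * |f x * f1 x * deriv f1 x * deriv φ x| + |f x * f1 x ^ 2 * iteratedDeriv 2 φ x|)
      (fun j => ?_) ((i1.abs.add (i2.abs.const_mul 2)).add i3.abs) (fun j => ?_) ?_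
    · have a1 : AEStronglyMeasurable (fun x => step (δ j) (f x)) (volume.restrict (Ioo L R)) :=
        (continuous_step (δ j)).comp_aestronglyMeasurable h.aesm
      have a2 : AEStronglyMeasurable (fun x => cutoff (δ j) (f x)) (volume.restrict (Ioo L R)) :=
        (continuous_cutoff (δ j)).comp_aestronglyMeasurable h.aesm
      have a3 := h.aesm1
      have a4 : AEStronglyMeasurable (deriv f1) (volume.restrict (Ioo L R)) := aesm2
      exact (((a1.mul (a3.pow 3)).mul hφ1.continuous.aestronglyMeasurable).add
        ((((a2.const_mul 2).mul a3).mul a4).mul hφ1.continuous.aestronglyMeasurable)).add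
        ((a2.mul (a3.pow 2)).mul hφ2c.aestronglyMeasurable)
    · refine (ae_restrict_iff' measurableSet_Ioo).2 (Eventually.of_forall fun x hx => ?_)
      have h0 := h.nonneg x (Ioo_subset_Icc_self hx)
      have k1 := step_nonneg (δ j) (f x)
      have k2 := step_le_one (δ j) (f x)
      have k3 := cutoff_nonneg (δ j) h0
      have k4 := cutoff_le (δ j) h0
      rw [Real.norm_eq_abs]
      refine (abs_add_three _ _ _).trans ?_
      refine add_le_add (add_le_add ?_ ?_) ?_
      · rw [mul_assoc, abs_mul, abs_of_nonneg k1]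
        exact mul_le_of_le_one_left (abs_nonneg _) k2
      · have : 2 * cutoff (δ j) (f x) * f1 x * deriv f1 x * deriv φ x
          = cutoff (δ j) (f x) * (2 * (f1 x * deriv f1 x * deriv φ x)) := by ring
        rw [this, abs_mul, abs_of_nonneg k3, abs_mul 2, abs_two]
        have e2 : |f x * f1 x * deriv f1 x * deriv φ x|
          = f x * |f1 x * deriv f1 x * deriv φ x| := by
          rw [← abs_of_nonneg h0, ← abs_mul, abs_of_nonneg h0]; congr 1; ring
        rw [e2]
        nlinarith [mul_le_mul_of_nonneg_right k4 (abs_nonneg (f1 x * deriv f1 x * deriv φ x))]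
      · rw [mul_assoc, abs_mul, abs_of_nonneg k3, mul_assoc, abs_mul (f x), abs_of_nonneg h0]
        exact mul_le_mul_of_nonneg_right k4 (abs_nonneg _)
    · refine (ae_restrict_iff' measurableSet_Ioo).2 (Eventually.of_forall fun x hx => ?_)
      have h0 := h.nonneg x (Ioo_subset_Icc_self hx)
      have t1 : Tendsto (fun j => cutoff (δ j) (f x)) atTop (𝓝 (f x)) := by
        have : Tendsto (fun j => f x - 2 * δ j) atTop (𝓝 (f x)) := by
          simpa using tendsto_const_nhds.sub (hδ0.const_mul 2)
        exact tendsto_of_tendsto_of_tendsto_of_le_of_le this tendsto_const_nhds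
          (fun j => by
            have := sub_cutoff_le (hδ j) h0
            change f x - 2 * δ j ≤ cutoff (δ j) (f x); linarith)
          (fun j => cutoff_le (δ j) h0)
      have t2 : Tendsto (fun j => step (δ j) (f x) * f1 x ^ 3) atTop (𝓝 (f1 x ^ 3)) := by
        rcases h0.eq_or_lt with h1 | h1
        · rw [h.deriv_eq_zero hx h1.symm]; simp
        · refine tendsto_const_nhds.congr' ?_
          have : ∀ᶠ j in atTop, δ j < f x / 2 := hδ0.eventually_lt_const (half_pos h1)
          filter_upwards [this] with j hj
          rw [step_of_ge (hδ j) (by linarith), one_mul]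
      refine ((t2.mul_const _).add ?_).add ((t1.mul_const _).mul_const _)
      have := (((t1.const_mul 2).mul_const (f1 x)).mul_const (deriv f1 x)).mul_const (deriv φ x)
      convert! this using 2; ring
  have h0 := tendsto_nhds_unique hlim (by simp only [hz]; exact tendsto_const_nhds)
  have i23 := i2.const_mul 2
  rw [integral_add (i1.fun_add i23) i3, integral_add i1 i23, integral_const_mul] at h0
  exact h0

/-- `integral_cube` eliminates the cubic term from `T_eq`. The result has the coefficients `5/3` and
`1/3` of `integral_cutoff_T`, so that the two identities can be subtracted. -/
theorem integral_T (h : Slice L R f f1 f3) {φ : ℝ → ℝ} (hφ : IsTest (Ioo L R) φ) :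
    Integrable (fun x => f x * deriv f1 x ^ 2 * φ x
        + 5 / 3 * (f x * f1 x * deriv f1 x * deriv φ x)
        + 1 / 3 * (f x * f1 x ^ 2 * iteratedDeriv 2 φ x)) (volume.restrict (Ioo L R)) ∧
    ∫ x in Ioo L R, - (f x * f1 x * f3 x) * φ x =
      ∫ x in Ioo L R, (f x * deriv f1 x ^ 2 * φ x
        + 5 / 3 * (f x * f1 x * deriv f1 x * deriv φ x)
        + 1 / 3 * (f x * f1 x ^ 2 * iteratedDeriv 2 φ x)) := by
  have hφ1 : ContDiff ℝ ∞ (deriv φ) := (contDiff_infty_iff_deriv.1 hφ.1).2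
  have hφ2c : Continuous (iteratedDeriv 2 φ) := by
    rw [iteratedDeriv_succ, iteratedDeriv_one]; exact hφ1.continuous_deriv (by simp)
  have c := h.cont
  have c1 := h.cont1
  have cφ2 := hφ2c.continuousOn (s := Icc L R)
  have i1 := h.integrable_sq_mul hφ.1.continuous
  have i2 := (h.integrable_mixed hφ1.continuous).const_mul (5 / 3)
  have i3 : Integrable (fun x => f x * f1 x ^ 2 * iteratedDeriv 2 φ x)
    (volume.restrict (Ioo L R)) := integrable_cont (by fun_prop)
  have i4 := i3.const_mul (1 / 3)
  refine ⟨(i1.add i2).add i4, ?_⟩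
  rw [integral_add (i1.fun_add i2) i4, integral_add i1 i2, integral_const_mul, integral_const_mul,
    h.T_eq φ hφ.1]
  linarith [h.integral_cube hφ]

/-- Here `a = u`, `c = cutoff δ u`, `p, q, r` are `u_x, u_xx, u_xxx`, `s = ψ`, `s' = ψ'`, `D =
(ψ²)''` and `w = (step δ)' u`. The terms carrying `a - c ≤ 2δ` are completed to a square and cost a
multiple of `δ p²`. The term `c p r` is split by Young's inequality; it is present only where `a >
δ`, and there `c² δ ≤ a³`. -/
theorem lower_bound_pointwise {a c δ p s s' D C0 C1 C2 : ℝ} (hδ : 0 < δ) (h0 : 0 ≤ a)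
    (q1 : 0 ≤ c) (q2 : c ≤ a) (q3 : a - c ≤ 2 * δ) (q4 : a ≤ δ → c = 0) (b0 : s ^ 2 ≤ C0 ^ 2)
    (b1 : s' ^ 2 ≤ C1 ^ 2) (b2 : -C2 ≤ D) (hC2 : 0 ≤ C2) (q r w : ℝ) :
    1 / 3 * (w * p ^ 4 * s ^ 2)
      - (C0 ^ 2 + 6 * C1 ^ 2 + C2 + 1) * (δ * p ^ 2 + a ^ 3 * r ^ 2 / δ ^ 2)
      ≤ a * q ^ 2 * s ^ 2 + 5 / 3 * (a * p * q * (2 * s * s')) + 1 / 3 * (a * p ^ 2 * D)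
        - (c * q ^ 2 * s ^ 2 + c * p * r * s ^ 2 + 5 / 3 * c * p * q * (2 * s * s')
          - 1 / 3 * w * p ^ 4 * s ^ 2 + 1 / 3 * c * p ^ 2 * D) := by
  set E := δ * p ^ 2 with hE
  have hE0 : 0 ≤ E := by positivity
  set F := a ^ 3 * r ^ 2 / δ ^ 2 with hF
  have hF0 : 0 ≤ F := by positivity
  -- `25/9` is the square of `5/3`: the mixed term is twice the product of `q s` and `(5/3) p s'`.
  have s1 : -(2 * E * (25 / 9 * C1 ^ 2 + 1 / 3 * C2)) ≤
      (a - c) * (q ^ 2 * s ^ 2 + 10 / 3 * (p * q * s * s') + 1 / 3 * (p ^ 2 * D)) := by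
    have h1 : -(p ^ 2 * (25 / 9 * C1 ^ 2 + 1 / 3 * C2)) ≤
        q ^ 2 * s ^ 2 + 10 / 3 * (p * q * s * s') + 1 / 3 * (p ^ 2 * D) := by
      have h2 := sq_nonneg (q * s + 5 / 3 * p * s')
      have h3 := mul_le_mul_of_nonneg_left b1 (sq_nonneg p)
      have h4 := mul_le_mul_of_nonneg_left b2 (sq_nonneg p)
      linarith
    have hA : 0 ≤ p ^ 2 * (25 / 9 * C1 ^ 2 + 1 / 3 * C2) := by positivity
    have h5 := mul_le_mul_of_nonneg_left h1 (show 0 ≤ a - c by linarith)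
    have h6 := mul_le_mul_of_nonneg_right q3 hA
    rw [hE]
    linarith
  have s2 : c * p * r * s ^ 2 ≤ (E + F) * C0 ^ 2 := by
    have h1 : c * p * r ≤ E + F := by
      rcases le_or_gt a δ with hle | hgt
      · rw [q4 hle]; simpa using add_nonneg hE0 hF0
      · have r1 : c ^ 2 * δ ≤ a ^ 3 := by
          have := mul_le_mul (pow_le_pow_left₀ q1 q2 2) hgt.le hδ.le (sq_nonneg a)
          linarith [show a ^ 2 * a = a ^ 3 by ring]
        have r2 : c ^ 2 * r ^ 2 / δ ≤ F := by
          rw [hF, div_le_div_iff₀ hδ (by positivity)]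
          have := mul_le_mul_of_nonneg_right r1 (mul_nonneg (sq_nonneg r) hδ.le)
          linarith
        have r3 : 0 ≤ (δ * p - c * r / 2) ^ 2 / δ := by positivity
        have r4 : (δ * p - c * r / 2) ^ 2 / δ = E - c * p * r + c ^ 2 * r ^ 2 / δ / 4 := by
          rw [hE]; field_simp; ring
        have r5 : 0 ≤ c ^ 2 * r ^ 2 / δ := by positivity
        linarith
    exact (mul_le_mul_of_nonneg_right h1 (sq_nonneg _)).trans
      (mul_le_mul_of_nonneg_left b0 (add_nonneg hE0 hF0))
  have s3 : 0 ≤ F * (6 * C1 ^ 2 + C2 + 1) := by positivity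
  have s4 : 0 ≤ E * (4 / 9 * C1 ^ 2 + 1 / 3 * C2 + 1) := by positivity
  linarith

/-- The dissipation density tested against `ψ²` is bounded below, up to terms that are small with
`δ` and with the energy dissipation, by a weighted length of the level sets of height `≈ δ`. -/
theorem exists_lower_bound {ψ : ℝ → ℝ} (hψ : IsTest (Ioo L R) ψ) :
    ∃ C, 0 < C ∧ ∀ {f f1 f3 : ℝ → ℝ}, Slice L R f f1 f3 → ∀ δ, 0 < δ →
      IntegrableOn (fun x => f x ^ 3 * f3 x ^ 2) (Ioo L R) →
      (1 / 3) * (∫ x in Ioo L R, deriv (step δ) (f x) * f1 x ^ 4 * ψ x ^ 2)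
        - C * (δ * (∫ x in Ioo L R, f1 x ^ 2) + (∫ x in Ioo L R, f x ^ 3 * f3 x ^ 2) / δ ^ 2)
        ≤ ∫ x in Ioo L R, - (f x * f1 x * f3 x) * ψ x ^ 2 := by
  have hφ : IsTest (Ioo L R) (fun x => ψ x ^ 2) := by
    refine ⟨hψ.1.pow 2, ?_, ?_⟩
    · have : (fun x => ψ x ^ 2) = fun x => ψ x * ψ x := by ext x; ring
      rw [this]; exact hψ.2.1.mul_left
    · refine (closure_mono fun x hx => ?_).trans hψ.2.2
      intro h0; apply hx; simp [h0]
  have hφ1 : ContDiff ℝ ∞ (deriv fun x => ψ x ^ 2) := (contDiff_infty_iff_deriv.1 hφ.1).2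
  have hφ2c : Continuous (iteratedDeriv 2 fun x => ψ x ^ 2) := by
    rw [iteratedDeriv_succ, iteratedDeriv_one]; exact hφ1.continuous_deriv (by simp)
  have hψ1 : Continuous (deriv ψ) := hψ.1.continuous_deriv (by simp)
  have hd : ∀ x, deriv (fun x => ψ x ^ 2) x = 2 * ψ x * deriv ψ x := fun x => by
    have := ((hψ.1.differentiable (by simp) x).hasDerivAt.fun_pow 2).deriv
    simpa using this
  obtain ⟨C0, hC00, hC0⟩ := ContDiff.exists_abs_bound (a := L) (b := R)
    hψ.1.continuous.continuousOn
  obtain ⟨C1, hC10, hC1⟩ := ContDiff.exists_abs_bound (a := L) (b := R) hψ1.continuousOn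
  obtain ⟨C2, hC20, hC2⟩ := ContDiff.exists_abs_bound (a := L) (b := R) hφ2c.continuousOn
  refine ⟨C0 ^ 2 + 6 * C1 ^ 2 + C2 + 1, by positivity, ?_⟩
  intro f f1 f3 h δ hδ hint
  set C := C0 ^ 2 + 6 * C1 ^ 2 + C2 + 1
  obtain ⟨j1, e1⟩ := h.integral_T hφ
  obtain ⟨j2, e2⟩ := h.integral_cutoff_T hφ hδ
  have c := h.cont
  have c1 := h.cont1
  have cs : ContinuousOn (fun x => deriv (step δ) (f x)) (Icc L R) :=
    (continuous_deriv_step δ).comp_continuousOn c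
  have cψ := hψ.1.continuous.continuousOn (s := Icc L R)
  have k1 : Integrable (fun x => deriv (step δ) (f x) * f1 x ^ 4 * ψ x ^ 2)
    (volume.restrict (Ioo L R)) := integrable_cont (by fun_prop)
  have k2 : Integrable (fun x => f1 x ^ 2) (volume.restrict (Ioo L R)) :=
    integrable_cont (by fun_prop)
  have k3 : Integrable (fun x => f x ^ 3 * f3 x ^ 2) (volume.restrict (Ioo L R)) := hint
  -- The cutoff identity has integral zero, so subtracting it does not change the source; it leaves
  -- the quadratic terms with the small factor `f - cutoff δ (f)`.
  have e3 := integral_sub j1 j2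
  rw [← e1, e2, sub_zero] at e3
  rw [← e3]
  rw [← integral_const_mul, ← integral_const_mul, ← integral_div,
    ← integral_add (k2.const_mul δ) (k3.div_const _), ← integral_const_mul,
    ← integral_sub (k1.const_mul _) (((k2.const_mul δ).fun_add (k3.div_const _)).const_mul C)]
  refine integral_mono_ae ((k1.const_mul _).sub
    (((k2.const_mul δ).add (k3.div_const _)).const_mul C)) (j1.sub j2) ?_
  refine (ae_restrict_iff' measurableSet_Ioo).2 (Eventually.of_forall fun x hx => ?_)
  have hx' := Ioo_subset_Icc_self hx
  have h0 := h.nonneg x hx'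
  have q1 := cutoff_nonneg δ h0
  have q2 := cutoff_le δ h0
  have q3 := sub_cutoff_le hδ h0
  simp only [hd]
  have b0 : ψ x ^ 2 ≤ C0 ^ 2 := sq_le_sq' (by linarith [(abs_le.1 (hC0 x hx')).1])
    (abs_le.1 (hC0 x hx')).2
  have b1 : deriv ψ x ^ 2 ≤ C1 ^ 2 := sq_le_sq' (by linarith [(abs_le.1 (hC1 x hx')).1])
    (abs_le.1 (hC1 x hx')).2
  have b2 := (abs_le.1 (hC2 x hx')).1
  exact lower_bound_pointwise hδ h0 q1 q2 q3 (fun hle => cutoff_of_le hδ hle) b0 b1 b2 hC20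
    (deriv f1 x) (f3 x) (deriv (step δ) (f x))

end Slice

/-! ### Taylor expansion and quadratic limits -/

theorem abs_sub_le_of_hasDerivAt {c d e : ℝ} {g g' : ℝ → ℝ} (hg : ContinuousOn g (Icc c d))
    (hd : ∀ x ∈ Ioo c d, HasDerivAt g (g' x) x) (hb : ∀ x ∈ Ioo c d, |g' x| ≤ e) {x y : ℝ}
    (hx : x ∈ Icc c d) (hy : y ∈ Icc c d) : |g x - g y| ≤ e * |x - y| := by
  wlog hxy : x < y generalizing x y
  · rcases eq_or_lt_of_le (not_lt.1 hxy) with h | h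
    · rw [h]; simp
    · rw [abs_sub_comm (g x), abs_sub_comm x]; exact this hy hx h
  obtain ⟨ξ, hξ, he⟩ := exists_hasDerivAt_eq_slope g g' hxy
    (hg.mono (Icc_subset_Icc hx.1 hy.2)) fun z hz => hd z ⟨hx.1.trans_lt hz.1, hz.2.trans_le hy.2⟩
  have h1 := hb ξ ⟨hx.1.trans_lt hξ.1, hξ.2.trans_le hy.2⟩
  have h2 : g y - g x = g' ξ * (y - x) := by
    rw [he, div_mul_cancel₀]; linarith
  rw [abs_sub_comm, h2, abs_mul, abs_sub_comm x]
  exact mul_le_mul_of_nonneg_right h1 (abs_nonneg _)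

theorem taylor_two_bound {c d e m : ℝ} {f f1 f2 : ℝ → ℝ} (hm : m ∈ Icc c d)
    (hf : ContinuousOn f (Icc c d)) (hf1 : ContinuousOn f1 (Icc c d))
    (hd : ∀ x ∈ Ioo c d, HasDerivAt f (f1 x) x) (hd1 : ∀ x ∈ Ioo c d, HasDerivAt f1 (f2 x) x)
    (hb : ∀ x ∈ Ioo c d, |f2 x - f2 m| ≤ e) (he : 0 ≤ e) {x : ℝ} (hx : x ∈ Icc c d) :
    |f1 x - (f1 m + f2 m * (x - m))| ≤ e * (d - c) ∧
      |f x - (f m + f1 m * (x - m) + f2 m / 2 * (x - m) ^ 2)| ≤ e * (d - c) ^ 2 := by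
  have hlen : ∀ x ∈ Icc c d, |x - m| ≤ d - c := fun x hx => by
    rw [abs_le]; constructor <;> linarith [hx.1, hx.2, hm.1, hm.2]
  have h1 : ∀ x ∈ Icc c d, |f1 x - (f1 m + f2 m * (x - m))| ≤ e * (d - c) := by
    intro x hx
    have := abs_sub_le_of_hasDerivAt (g := fun x => f1 x - f2 m * (x - m))
      (g' := fun x => f2 x - f2 m) (e := e) (by fun_prop)
      (fun z hz => by
        convert! (hd1 z hz).sub (((hasDerivAt_id z).sub_const m).const_mul (f2 m)) using 1
        simp) hb hx hm
    have e1 : f1 x - f2 m * (x - m) - (f1 m - f2 m * (m - m))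
      = f1 x - (f1 m + f2 m * (x - m)) := by ring
    rw [e1] at this
    exact this.trans (mul_le_mul_of_nonneg_left (hlen x hx) he)
  refine ⟨h1 x hx, ?_⟩
  have := abs_sub_le_of_hasDerivAt (g := fun x => f x - f1 m * (x - m) - f2 m / 2 * (x - m) ^ 2)
    (g' := fun x => f1 x - (f1 m + f2 m * (x - m))) (e := e * (d - c)) (by fun_prop)
    (fun z hz => by
      have hi := (hasDerivAt_id z).sub_const m
      convert! ((hd z hz).sub (hi.const_mul (f1 m))).sub ((hi.pow 2).const_mul (f2 m / 2)) using 1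
      simp; ring) (fun z hz => h1 z (Ioo_subset_Icc_self hz)) hx hm
  have e1 : f x - f1 m * (x - m) - f2 m / 2 * (x - m) ^ 2
      - (f m - f1 m * (m - m) - f2 m / 2 * (m - m) ^ 2)
      = f x - (f m + f1 m * (x - m) + f2 m / 2 * (x - m) ^ 2) := by ring
  rw [e1] at this
  refine this.trans ?_
  have hdc : 0 ≤ d - c := by linarith [hm.1, hm.2]
  have := mul_le_mul_of_nonneg_left (hlen x hx) (mul_nonneg he hdc)
  calc _ ≤ _ := this
    _ = _ := by ring

namespace Slice

variable {L R : ℝ} {f f1 f3 : ℝ → ℝ}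

/-- Where `f ≥ η`, Young's inequality gives `|f3| ≤ κ + f³ f3² / (η³ κ)`, and the last term has
integral at most `κ`. The oscillation of `u_xx` thus vanishes with the dissipation wherever `u` is
bounded below. -/
theorem abs_deriv_sub_le (h : Slice L R f f1 f3)
    (hint : IntegrableOn (fun x => f x ^ 3 * f3 x ^ 2) (Ioo L R)) {c d η κ : ℝ}
    (hLc : L ≤ c) (hdR : d ≤ R) (hη : 0 < η) (hκ : 0 < κ) (hf : ∀ x ∈ Icc c d, η ≤ f x)
    (hD : ∫ x in Ioo L R, f x ^ 3 * f3 x ^ 2 ≤ η ^ 3 * κ ^ 2) {x y : ℝ} (hx : x ∈ Ioo c d)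
    (hy : y ∈ Ioo c d) : |deriv f1 x - deriv f1 y| ≤ (d - c + 1) * κ := by
  wlog hxy : y ≤ x generalizing x y
  · rw [abs_sub_comm]; exact this hy hx (le_of_not_ge hxy)
  have hsub : Icc y x ⊆ Ioo c d := fun z hz => ⟨hy.1.trans_le hz.1, hz.2.trans_lt hx.2⟩
  have hsub' : Icc y x ⊆ Ioo L R := fun z hz =>
    ⟨hLc.trans_lt (hsub hz).1, (hsub hz).2.trans_le hdR⟩
  obtain ⟨hi, he⟩ := h.prim y x hxy fun z hz =>
    ⟨hsub' hz, hη.trans_le (hf z (Ioo_subset_Icc_self (hsub hz)))⟩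
  rw [← he]
  have hnn : ∀ z ∈ Ioo L R, 0 ≤ f z ^ 3 * f3 z ^ 2 := fun z hz =>
    mul_nonneg (pow_nonneg (h.nonneg z (Ioo_subset_Icc_self hz)) 3) (sq_nonneg _)
  have hi2 : IntervalIntegrable (fun z => f z ^ 3 * f3 z ^ 2) volume y x := by
    rw [intervalIntegrable_iff_integrableOn_Ioc_of_le hxy]
    exact hint.mono_set (Ioc_subset_Icc_self.trans hsub')
  have hb : ∀ z ∈ Icc y x, |f3 z| ≤ κ + f z ^ 3 * f3 z ^ 2 * (1 / (η ^ 3 * κ)) := by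
    intro z hz
    have h1 : η ^ 3 ≤ f z ^ 3 :=
      pow_le_pow_left₀ hη.le (hf z (Ioo_subset_Icc_self (hsub hz))) 3
    have h2 : f3 z ^ 2 / κ ≤ f z ^ 3 * f3 z ^ 2 * (1 / (η ^ 3 * κ)) := by
      rw [mul_one_div, div_le_div_iff₀ hκ (by positivity)]
      have := mul_le_mul_of_nonneg_right h1 (mul_nonneg (sq_nonneg (f3 z)) hκ.le)
      linarith
    have h3 : |f3 z| ≤ κ + f3 z ^ 2 / κ := by
      have h4 : 0 ≤ (κ - |f3 z| / 2) ^ 2 / κ := by positivity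
      have h5 : (κ - |f3 z| / 2) ^ 2 / κ = κ - |f3 z| + f3 z ^ 2 / κ / 4 := by
        rw [← sq_abs (f3 z)]; field_simp; ring
      have h6 : 0 ≤ f3 z ^ 2 / κ := by positivity
      linarith
    linarith
  have i1 : IntervalIntegrable (fun z => κ + f z ^ 3 * f3 z ^ 2 * (1 / (η ^ 3 * κ))) volume y x :=
    intervalIntegrable_const.add (hi2.mul_const _)
  have s1 : |∫ z in y..x, f3 z| ≤ ∫ z in y..x, (κ + f z ^ 3 * f3 z ^ 2 * (1 / (η ^ 3 * κ))) :=
    (intervalIntegral.abs_integral_le_integral_abs hxy).trans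
      (intervalIntegral.integral_mono_on hxy hi.abs i1 hb)
  have s2 : ∫ z in y..x, f z ^ 3 * f3 z ^ 2 ≤ η ^ 3 * κ ^ 2 := by
    rw [intervalIntegral.integral_of_le hxy]
    refine le_trans (setIntegral_mono_set hint ?_ ?_) hD
    · exact (ae_restrict_iff' measurableSet_Ioo).2 (Eventually.of_forall hnn)
    · exact (Ioc_subset_Icc_self.trans hsub').eventuallyLE
  rw [intervalIntegral.integral_add intervalIntegrable_const (hi2.mul_const _),
    intervalIntegral.integral_mul_const, intervalIntegral.integral_const, smul_eq_mul] at s1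
  have s3 : (∫ z in y..x, f z ^ 3 * f3 z ^ 2) * (1 / (η ^ 3 * κ)) ≤ κ := by
    rw [mul_one_div, div_le_iff₀ (by positivity)]
    calc _ ≤ _ := s2
      _ = _ := by ring
  have s4 : (x - y) * κ ≤ (d - c) * κ :=
    mul_le_mul_of_nonneg_right (by linarith [hx.2, hy.1]) hκ.le
  linarith

end Slice

/-- On intervals where the uniform limit is positive, vanishing dissipation forces the limit to be
quadratic, and the first derivatives converge. -/
theorem exists_quadratic_limit {L R : ℝ} {f f1 f3 : ℕ → ℝ → ℝ} {v : ℝ → ℝ}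
    (h : ∀ k, Slice L R (f k) (f1 k) (f3 k))
    (hint : ∀ k, IntegrableOn (fun x => f k x ^ 3 * f3 k x ^ 2) (Ioo L R))
    (hD : Tendsto (fun k => ∫ x in Ioo L R, f k x ^ 3 * f3 k x ^ 2) atTop (𝓝 0))
    (hv : TendstoUniformlyOn f v atTop (Icc L R)) {c d : ℝ} (hLc : L ≤ c) (hcd : c < d)
    (hdR : d ≤ R) (hpos : ∀ x ∈ Icc c d, 0 < v x) :
    ∃ A B C : ℝ, (∀ x ∈ Icc c d, v x = A + B * x + C * x ^ 2) ∧
      TendstoUniformlyOn f1 (fun x => B + 2 * C * x) atTop (Icc c d) := by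
  have hcdLR : Icc c d ⊆ Icc L R := Icc_subset_Icc hLc hdR
  have hvc : ContinuousOn v (Icc L R) := hv.continuousOn (Frequently.of_forall fun k => (h k).cont)
  obtain ⟨x0, hx0, hmin⟩ := isCompact_Icc.exists_isMinOn (nonempty_Icc.2 hcd.le) (hvc.mono hcdLR)
  set η := v x0 / 2
  have hη : 0 < η := half_pos (hpos x0 hx0)
  have hfη : ∀ᶠ k in atTop, ∀ x ∈ Icc c d, η ≤ f k x := by
    filter_upwards [Metric.tendstoUniformlyOn_iff.1 hv η hη] with k hk x hx
    have h1 := hk x (hcdLR hx)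
    have h2 : v x0 ≤ v x := hmin hx
    rw [Real.dist_eq, abs_lt] at h1
    have : v x0 = 2 * η := by simp only [η]; ring
    linarith [h1.2]
  set m := (c + d) / 2 with hmdef
  have hm : m ∈ Ioo c d := ⟨by linarith, by linarith⟩
  have hmI := Ioo_subset_Icc_self hm
  set D : ℕ → ℝ := fun k => ∫ x in Ioo L R, f k x ^ 3 * f3 k x ^ 2
  -- The summand `1 / (k + 1)` only keeps `κ k` positive when the dissipation is zero.
  set κ : ℕ → ℝ := fun k => Real.sqrt (|D k| / η ^ 3) + 1 / ((k : ℝ) + 1)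
  have hκ : ∀ k, 0 < κ k := fun k => by positivity
  have hκ0 : Tendsto κ atTop (𝓝 0) := by
    have h1 : Tendsto (fun k => Real.sqrt (|D k| / η ^ 3)) atTop (𝓝 0) := by
      have := (hD.abs.div_const (η ^ 3)).sqrt
      simpa using this
    have := h1.add (tendsto_one_div_add_atTop_nhds_zero_nat (𝕜 := ℝ))
    rwa [add_zero] at this
  have hDκ : ∀ k, D k ≤ η ^ 3 * κ k ^ 2 := by
    intro k
    have h1 : Real.sqrt (|D k| / η ^ 3) ≤ κ k := by
      simp only [κ]; linarith [show 0 < 1 / ((k : ℝ) + 1) by positivity]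
    have h2 := pow_le_pow_left₀ (Real.sqrt_nonneg _) h1 2
    rw [Real.sq_sqrt (by positivity), div_le_iff₀ (by positivity)] at h2
    linarith [le_abs_self (D k)]
  set e : ℕ → ℝ := fun k => (d - c + 1) * κ k
  have he0 : Tendsto e atTop (𝓝 0) := by simpa using hκ0.const_mul (d - c + 1)
  have hen : ∀ k, 0 ≤ e k := fun k => mul_nonneg (by linarith) (hκ k).le
  have hT : ∀ᶠ k in atTop, ∀ x ∈ Icc c d,
      |f1 k x - (f1 k m + deriv (f1 k) m * (x - m))| ≤ e k * (d - c) ∧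
      |f k x - (f k m + f1 k m * (x - m) + deriv (f1 k) m / 2 * (x - m) ^ 2)|
        ≤ e k * (d - c) ^ 2 := by
    filter_upwards [hfη] with k hk x hx
    have hoo : Ioo c d ⊆ Ioo L R := Ioo_subset_Ioo hLc hdR
    exact taylor_two_bound (f2 := deriv (f1 k)) hmI ((h k).cont.mono hcdLR)
      ((h k).cont1.mono hcdLR)
      (fun z hz => (h k).hasDerivAt z (hoo hz))
      (fun z hz => (h k).hasDerivAt1 z (hoo hz) (hη.trans_le (hk z (Ioo_subset_Icc_self hz))))
      (fun z hz => (h k).abs_deriv_sub_le (hint k) hLc hdR hη (hκ k) hk (hDκ k) hz hm)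
      (hen k) hx
  have hpt : ∀ x ∈ Icc c d, Tendsto (fun k => f k x) atTop (𝓝 (v x)) := fun x hx =>
    hv.tendsto_at (hcdLR hx)
  have her : ∀ x ∈ Icc c d, Tendsto (fun k => f k x - (f k m + f1 k m * (x - m)
      + deriv (f1 k) m / 2 * (x - m) ^ 2)) atTop (𝓝 0) := fun x hx => by
    have : Tendsto (fun k => e k * (d - c) ^ 2) atTop (𝓝 0) := by
      simpa using he0.mul_const ((d - c) ^ 2)
    exact squeeze_zero_norm' (by filter_upwards [hT] with k hk using (hk x hx).2) this
  have hc := left_mem_Icc.2 hcd.le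
  have hd := right_mem_Icc.2 hcd.le
  have hdc : d - c ≠ 0 := by linarith
  -- For a quadratic polynomial the first difference over `[c, d]` and the second difference at the
  -- midpoint `m` give the derivatives at `m`. The derivatives of `f k` at `m` hence converge to
  -- numbers read off from `v`, with no compactness argument.
  set A1 := (v d - v c) / (d - c)
  set A2 := (v d + v c - 2 * v m) / ((d - c) / 2) ^ 2
  have l1 : Tendsto (fun k => f1 k m) atTop (𝓝 A1) := by
    have := (((hpt d hd).sub (hpt c hc)).sub ((her d hd).sub (her c hc))).div_const (d - c)
    rw [sub_zero, sub_zero] at this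
    refine this.congr fun k => ?_
    rw [div_eq_iff hdc]; simp only [hmdef]; ring
  have l2 : Tendsto (fun k => deriv (f1 k) m) atTop (𝓝 A2) := by
    have := ((((hpt d hd).add (hpt c hc)).sub ((hpt m hmI).const_mul 2)).sub
      ((her d hd).add (her c hc))).div_const (((d - c) / 2) ^ 2)
    rw [add_zero, sub_zero] at this
    refine this.congr fun k => ?_
    rw [div_eq_iff (by positivity)]; simp only [hmdef]; ring
  refine ⟨v m - A1 * m + A2 / 2 * m ^ 2, A1 - A2 * m, A2 / 2, fun x hx => ?_, ?_⟩
  · have h1 := (her x hx).add (((hpt m hmI).add (l1.mul_const (x - m))).add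
      ((l2.div_const 2).mul_const ((x - m) ^ 2)))
    have h2 := tendsto_nhds_unique ((hpt x hx).congr fun k => (sub_add_cancel _ _).symm) h1
    rw [h2]; ring
  · rw [Metric.tendstoUniformlyOn_iff]
    intro r hr
    have h1 : Tendsto (fun k => e k * (d - c) + (|f1 k m - A1| + |deriv (f1 k) m - A2| * (d - c)))
        atTop (𝓝 0) := by
      have a1 := (l1.sub_const A1).abs
      have a2 := ((l2.sub_const A2).abs).mul_const (d - c)
      simpa using (he0.mul_const (d - c)).add (a1.add a2)
    filter_upwards [hT, h1.eventually_lt_const hr] with k hk hk2 x hx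
    refine lt_of_le_of_lt ?_ hk2
    rw [dist_comm, Real.dist_eq]
    have e1 : f1 k x - (A1 - A2 * m + 2 * (A2 / 2) * x)
      = (f1 k x - (f1 k m + deriv (f1 k) m * (x - m)))
        + ((f1 k m - A1) + (deriv (f1 k) m - A2) * (x - m)) := by ring
    rw [e1]
    refine (abs_add_le _ _).trans (add_le_add (hk x hx).1 ((abs_add_le _ _).trans
      (add_le_add le_rfl ?_)))
    rw [abs_mul]
    refine mul_le_mul_of_nonneg_left ?_ (abs_nonneg _)
    rw [abs_le]; constructor <;> linarith [hx.1, hx.2, hm.1, hm.2]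

/-! ### Piecewise quadratic functions -/

theorem quadratic_coeff_unique {A B C A' B' C' c d : ℝ} (hcd : c < d)
    (h : ∀ x ∈ Icc c d, A + B * x + C * x ^ 2 = A' + B' * x + C' * x ^ 2) :
    A = A' ∧ B = B' ∧ C = C' := by
  have h1 := h c (left_mem_Icc.2 hcd.le)
  have h2 := h d (right_mem_Icc.2 hcd.le)
  have h3 := h ((c + d) / 2) ⟨by linarith, by linarith⟩
  have e1 : (B - B') + (C - C') * (c + d) = 0 := by
    have : (d - c) * ((B - B') + (C - C') * (c + d)) = 0 := by linarith
    exact (mul_eq_zero.1 this).resolve_left (by linarith)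
  have e2 : C = C' := by
    have : (C - C') * (d - c) ^ 2 = 0 := by linarith
    have := (mul_eq_zero.1 this).resolve_right (pow_ne_zero 2 (by linarith))
    linarith
  subst e2
  have e3 : B = B' := by linarith
  subst e3
  exact ⟨by linarith, rfl, rfl⟩

/-- `v` is quadratic on the compact intervals where it is positive, with the Neumann condition at
the end points `L` and `R`. -/
def QuadraticWherePos (L R : ℝ) (v : ℝ → ℝ) : Prop :=
  ∀ c d, L ≤ c → c < d → d ≤ R → (∀ x ∈ Icc c d, 0 < v x) →
    ∃ A B C : ℝ, (∀ x ∈ Icc c d, v x = A + B * x + C * x ^ 2) ∧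
      (c = L → B + 2 * C * L = 0) ∧ (d = R → B + 2 * C * R = 0)

/-- The local formulas share the middle third of the component, hence their coefficients; continuity
extends the common formula to the closed interval. -/
theorem QuadraticWherePos.exists_on_component {L R : ℝ} {v : ℝ → ℝ}
    (hv : ContinuousOn v (Icc L R)) (hq : QuadraticWherePos L R v) {a b : ℝ} (hLa : L ≤ a)
    (hab : a < b) (hbR : b ≤ R) (hpos : ∀ x ∈ Ioo a b, 0 < v x) :
    ∃ A B C : ℝ, (∀ x ∈ Icc a b, v x = A + B * x + C * x ^ 2) ∧
      (b = R → 0 < v b → B + 2 * C * R = 0) := by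
  set c0 := a + (b - a) / 3 with hc0
  set d0 := b - (b - a) / 3 with hd0
  have hcd0 : c0 < d0 := by simp only [hc0, hd0]; linarith
  have hac0 : a < c0 := by simp only [hc0]; linarith
  have hdb0 : d0 < b := by simp only [hd0]; linarith
  obtain ⟨A, B, C, h0, -, -⟩ := hq c0 d0 (by linarith) hcd0 (by linarith) fun x hx =>
    hpos x ⟨hac0.trans_le hx.1, hx.2.trans_lt hdb0⟩
  have hsame : ∀ c d, a < c → c ≤ c0 → d0 ≤ d → d ≤ R → (∀ x ∈ Icc c d, 0 < v x) →
      (∀ x ∈ Icc c d, v x = A + B * x + C * x ^ 2) ∧ (d = R → B + 2 * C * R = 0) := by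
    intro c d h1 h2 h3 h4 h5
    obtain ⟨A', B', C', h6, -, h7⟩ := hq c d (by linarith) (by linarith) h4 h5
    obtain ⟨rfl, rfl, rfl⟩ := quadratic_coeff_unique hcd0 fun x hx =>
      (h0 x hx).symm.trans (h6 x ⟨h2.trans hx.1, hx.2.trans h3⟩)
    exact ⟨h6, h7⟩
  have hoo : ∀ x ∈ Ioo a b, v x = A + B * x + C * x ^ 2 := by
    intro x hx
    refine (hsame (min c0 x) (max d0 x) (lt_min hac0 hx.1) (min_le_left _ _) (le_max_left _ _)
      ((max_le hdb0.le hx.2.le).trans hbR) fun z hz => hpos z ⟨?_, ?_⟩).1 x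
      ⟨min_le_right _ _, le_max_right _ _⟩
    · exact (lt_min hac0 hx.1).trans_le hz.1
    · exact hz.2.trans_lt (max_lt hdb0 hx.2)
  refine ⟨A, B, C, ?_, fun hb hvb => ?_⟩
  · have hcl : EqOn v (fun x => A + B * x + C * x ^ 2) (closure (Ioo a b)) := by
      refine EqOn.of_subset_closure (s := Ioo a b) hoo ?_ (by fun_prop) subset_closure le_rfl
      rw [closure_Ioo hab.ne]
      exact hv.mono (Icc_subset_Icc hLa hbR)
    rw [closure_Ioo hab.ne] at hcl
    exact hcl
  · refine (hsame c0 b hac0 le_rfl hdb0.le hbR fun x hx => ?_).2 hb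
    rcases eq_or_lt_of_le hx.2 with h | h
    · rw [h]; exact hvb
    · exact hpos x ⟨hac0.trans_le hx.1, h⟩

/-- On the component that starts at its left zero `a`, `v = (x - a) (s + C (x - a))`. With `s = 0`
this would be `C (x - a)²`, which neither returns to zero at `b` nor has zero slope at `b = R` with
`v b > 0`; hence `s > 0`. The bounds `θ` and `h0` do not depend on `η`: only the starting point `c`
approaches `a` as `η` decreases. -/
theorem QuadraticWherePos.slope_right {L R : ℝ} {v : ℝ → ℝ} (hv : ContinuousOn v (Icc L R))
    (hv0 : ∀ x ∈ Icc L R, 0 ≤ v x) (hq : QuadraticWherePos L R v) {x0 y : ℝ} (hx0 : x0 ∈ Ioo L R)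
    (hy : y ∈ Ioo L R) (hxy : x0 < y) (hvx : v x0 = 0) (hvy : 0 < v y) :
    ∃ θ h0 : ℝ, 0 < θ ∧ 0 < h0 ∧ ∀ η, 0 < η → ∃ c d A B C : ℝ, x0 ≤ c ∧ c < d ∧ d ≤ y ∧
      (∀ x ∈ Icc c d, 0 < v x ∧ v x = A + B * x + C * x ^ 2 ∧ θ ≤ |B + 2 * C * x|) ∧
      v c ≤ η ∧ h0 ≤ v d := by
  have hc1 : ContinuousOn v (Icc x0 y) := hv.mono (Icc_subset_Icc hx0.1.le hy.2.le)
  -- the last zero before `y` and the first zero after `y`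
  have hZ : IsCompact (Icc x0 y ∩ v ⁻¹' {0}) := isCompact_Icc.of_isClosed_subset
    (hc1.preimage_isClosed_of_isClosed isClosed_Icc isClosed_singleton) inter_subset_left
  obtain ⟨a, ⟨haI, ha0⟩, hamax⟩ := hZ.exists_isGreatest ⟨x0, left_mem_Icc.2 hxy.le, hvx⟩
  have ha0 : v a = 0 := ha0
  have hay : a < y := lt_of_le_of_ne haI.2 fun h => by rw [h] at ha0; linarith
  have hpos1 : ∀ x ∈ Ioc a y, 0 < v x := by
    intro x hx
    have hxI : x ∈ Icc x0 y := ⟨haI.1.trans hx.1.le, hx.2⟩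
    refine lt_of_le_of_ne (hv0 x ⟨hx0.1.le.trans hxI.1, hxI.2.trans hy.2.le⟩) fun h => ?_
    exact absurd (hamax ⟨hxI, h.symm⟩) (not_le.2 hx.1)
  obtain ⟨b, hyb, hbR, hpos2, hb⟩ : ∃ b, y < b ∧ b ≤ R ∧ (∀ x ∈ Ico y b, 0 < v x) ∧
      (v b = 0 ∨ (b = R ∧ 0 < v b)) := by
    have hc2 : ContinuousOn v (Icc y R) := hv.mono (Icc_subset_Icc hy.1.le le_rfl)
    have hZ2 : IsCompact (Icc y R ∩ v ⁻¹' {0}) := isCompact_Icc.of_isClosed_subset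
      (hc2.preimage_isClosed_of_isClosed isClosed_Icc isClosed_singleton) inter_subset_left
    rcases (Icc y R ∩ v ⁻¹' {0}).eq_empty_or_nonempty with he | hne
    · have hp : ∀ x ∈ Icc y R, 0 < v x := fun x hx =>
        lt_of_le_of_ne (hv0 x ⟨hy.1.le.trans hx.1, hx.2⟩) fun h =>
          (he ▸ notMem_empty x : x ∉ Icc y R ∩ v ⁻¹' {0}) ⟨hx, h.symm⟩
      exact ⟨R, hy.2, le_rfl, fun x hx => hp x ⟨hx.1, hx.2.le⟩, Or.inr ⟨rfl, hp R ⟨hy.2.le, le_rfl⟩⟩⟩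
    · obtain ⟨b, ⟨hbI, hb0⟩, hbmin⟩ := hZ2.exists_isLeast hne
      have hb0 : v b = 0 := hb0
      refine ⟨b, lt_of_le_of_ne hbI.1 fun h => by rw [← h] at hb0; linarith, hbI.2,
        fun x hx => ?_, Or.inl hb0⟩
      have hxI : x ∈ Icc y R := ⟨hx.1, hx.2.le.trans hbI.2⟩
      refine lt_of_le_of_ne (hv0 x ⟨hy.1.le.trans hx.1, hxI.2⟩) fun h => ?_
      exact absurd (hbmin ⟨hxI, h.symm⟩) (not_le.2 hx.2)
  have hpos : ∀ x ∈ Ioo a b, 0 < v x := fun x hx => by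
    rcases le_or_gt x y with h | h
    · exact hpos1 x ⟨hx.1, h⟩
    · exact hpos2 x ⟨h.le, hx.2⟩
  have hab : a < b := hay.trans hyb
  have hLa : L ≤ a := hx0.1.le.trans haI.1
  obtain ⟨A, B, C, hrep, hneu⟩ := hq.exists_on_component hv hLa hab hbR hpos
  have hA : A + B * a + C * a ^ 2 = 0 := by rw [← hrep a (left_mem_Icc.2 hab.le), ha0]
  set s := B + 2 * C * a with hs
  have hv' : ∀ x ∈ Icc a b, v x = (x - a) * (s + C * (x - a)) := fun x hx => by
    rw [hrep x hx, hs]; linarith [hA]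
  have hbI : b ∈ Icc a b := right_mem_Icc.2 hab.le
  -- If `v b = 0`, positivity at the midpoint forces `s > 0`. If `b = R` and `v b > 0`, the Neumann
  -- condition gives `s = -2 C (b - a)`, and positivity of `v b` gives the sign.
  have hs0 : 0 < s := by
    rcases hb with hb0 | ⟨hbR', hvb⟩
    · rw [hv' b hbI] at hb0
      have h1 : s + C * (b - a) = 0 := (mul_eq_zero.1 hb0).resolve_left (by linarith)
      have h2 := hpos ((a + b) / 2) ⟨by linarith, by linarith⟩
      rw [hv' _ ⟨by linarith, by linarith⟩] at h2
      have h3 : 0 < s + C * ((a + b) / 2 - a) := by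
        refine (pos_iff_pos_of_mul_pos h2).1 (by linarith)
      linarith
    · have h1 := hneu hbR' hvb
      rw [← hbR'] at h1
      rw [hv' b hbI] at hvb
      have h3 : 0 < s + C * (b - a) := (pos_iff_pos_of_mul_pos hvb).1 (by linarith)
      have h4 : s = -2 * (C * (b - a)) := by simp only [hs]; linarith
      linarith
  -- a small interval to the right of `a`
  set r := min (y - a) (s / (4 * (|C| + 1))) with hr
  have hC1 : 0 < |C| + 1 := by positivity
  have hr0 : 0 < r := lt_min (by linarith) (by positivity)
  have hrC : |C| * r ≤ s / 4 := by
    have h1 : r ≤ s / (4 * (|C| + 1)) := min_le_right _ _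
    have h2 : (|C| + 1) * r ≤ s / 4 := by
      calc (|C| + 1) * r ≤ (|C| + 1) * (s / (4 * (|C| + 1))) := by gcongr
        _ = s / 4 := by field_simp
    linarith
  have hest : ∀ x ∈ Icc a (a + r), |C * (x - a)| ≤ s / 4 := fun x hx => by
    rw [abs_mul, abs_of_nonneg (by linarith [hx.1] : 0 ≤ x - a)]
    exact (mul_le_mul_of_nonneg_left (by linarith [hx.2]) (abs_nonneg C)).trans hrC
  have hry : a + r ≤ y := by linarith [min_le_left (y - a) (s / (4 * (|C| + 1)))]
  refine ⟨s / 2, v (a + r), by positivity, hpos1 _ ⟨by linarith, hry⟩, fun η hη => ?_⟩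
  -- `v (a + t)` is at most `(5/4) s t`, so `t ≤ η / (2 s)` brings it below `η`.
  set t := min (r / 2) (η / (2 * s)) with ht
  have ht0 : 0 < t := lt_min (by positivity) (by positivity)
  have htr : t ≤ r / 2 := min_le_left _ _
  refine ⟨a + t, a + r, A, B, C, by linarith [haI.1], by linarith, hry, fun x hx => ⟨?_, ?_, ?_⟩,
    ?_, le_rfl⟩
  · exact hpos1 x ⟨by linarith [hx.1], hx.2.trans hry⟩
  · exact hrep x ⟨by linarith [hx.1], by linarith [hx.2]⟩
  · have h1 := abs_le.1 (hest x ⟨by linarith [hx.1], hx.2⟩)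
    have : s / 2 ≤ B + 2 * C * x := by
      have : B + 2 * C * x = s + 2 * (C * (x - a)) := by simp only [hs]; ring
      linarith [h1.1]
    exact this.trans (le_abs_self _)
  · have h1 := abs_le.1 (hest (a + t) ⟨by linarith, by linarith⟩)
    rw [hv' (a + t) ⟨by linarith, by linarith⟩]
    have e : a + t - a = t := by ring
    rw [e] at h1 ⊢
    have h2 : t ≤ η / (2 * s) := min_le_right _ _
    rw [le_div_iff₀ (by positivity)] at h2
    have h3 := mul_le_mul_of_nonneg_left h1.2 ht0.le
    linarith [mul_pos ht0 hs0]

theorem QuadraticWherePos.slope {L R : ℝ} {v : ℝ → ℝ} (hv : ContinuousOn v (Icc L R))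
    (hv0 : ∀ x ∈ Icc L R, 0 ≤ v x) (hq : QuadraticWherePos L R v) {x0 y : ℝ} (hx0 : x0 ∈ Ioo L R)
    (hy : y ∈ Ioo L R) (hvx : v x0 = 0) (hvy : 0 < v y) :
    ∃ θ h0 : ℝ, 0 < θ ∧ 0 < h0 ∧ ∀ η, 0 < η → ∃ c d A B C : ℝ, c < d ∧ Icc c d ⊆ uIcc x0 y ∧
      (∀ x ∈ Icc c d, 0 < v x ∧ v x = A + B * x + C * x ^ 2 ∧ θ ≤ |B + 2 * C * x|) ∧
      ((v c ≤ η ∧ h0 ≤ v d) ∨ (v d ≤ η ∧ h0 ≤ v c)) := by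
  rcases lt_trichotomy x0 y with hxy | hxy | hxy
  · obtain ⟨θ, h0, hθ, hh0, H⟩ := hq.slope_right hv hv0 hx0 hy hxy hvx hvy
    refine ⟨θ, h0, hθ, hh0, fun η hη => ?_⟩
    obtain ⟨c, d, A, B, C, h1, h2, h3, h4, h5, h6⟩ := H η hη
    refine ⟨c, d, A, B, C, h2, ?_, h4, Or.inl ⟨h5, h6⟩⟩
    rw [uIcc_of_le hxy.le]; exact Icc_subset_Icc h1 h3
  · rw [hxy] at hvx; linarith
  -- The case `y < x0` is the preceding one for the reflected function.
  · have hv' : ContinuousOn (fun x => v (-x)) (Icc (-R) (-L)) := by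
      refine hv.comp continuous_neg.continuousOn fun x hx => ⟨?_, ?_⟩ <;> linarith [hx.1, hx.2]
    have hq' : QuadraticWherePos (-R) (-L) (fun x => v (-x)) := by
      intro c d h1 h2 h3 h4
      obtain ⟨A, B, C, g1, g2, g3⟩ := hq (-d) (-c) (by linarith) (by linarith) (by linarith)
        (fun x hx => by
          have := h4 (-x) ⟨by linarith [hx.2], by linarith [hx.1]⟩
          simpa using this)
      refine ⟨A, -B, C, fun x hx => ?_, fun hc => ?_, fun hd => ?_⟩
      · simp only
        rw [g1 (-x) ⟨by linarith [hx.2], by linarith [hx.1]⟩]; ring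
      · have := g3 (by linarith); linarith
      · have := g2 (by linarith); linarith
    obtain ⟨θ, h0, hθ, hh0, H⟩ := hq'.slope_right hv'
      (fun x hx => hv0 (-x) ⟨by linarith [hx.2], by linarith [hx.1]⟩)
      (x0 := -x0) (y := -y) ⟨by linarith [hx0.2], by linarith [hx0.1]⟩
      ⟨by linarith [hy.2], by linarith [hy.1]⟩ (by linarith) (by simpa using hvx)
      (by simpa using hvy)
    refine ⟨θ, h0, hθ, hh0, fun η hη => ?_⟩
    obtain ⟨c, d, A, B, C, h1, h2, h3, h4, h5, h6⟩ := H η hη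
    refine ⟨-d, -c, A, -B, C, by linarith, ?_, fun x hx => ?_, Or.inr ⟨h5, h6⟩⟩
    · rw [uIcc_of_ge hxy.le]; exact Icc_subset_Icc (by linarith) (by linarith)
    · obtain ⟨k1, k2, k3⟩ := h4 (-x) ⟨by linarith [hx.2], by linarith [hx.1]⟩
      simp only [neg_neg] at k1 k2
      refine ⟨k1, by rw [k2]; ring, ?_⟩
      rw [← abs_neg]
      convert! k3 using 2; ring

/-! ### Contact points and dissipation -/

/-- The derivatives converge uniformly up to the end points of an interval on which the limit is
positive, so `u_x = 0` at `L` or `R` is inherited there. -/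
theorem quadraticWherePos_of_limit {L R : ℝ} {f f1 f3 : ℕ → ℝ → ℝ} {v : ℝ → ℝ}
    (h : ∀ k, Slice L R (f k) (f1 k) (f3 k))
    (hint : ∀ k, IntegrableOn (fun x => f k x ^ 3 * f3 k x ^ 2) (Ioo L R))
    (hD : Tendsto (fun k => ∫ x in Ioo L R, f k x ^ 3 * f3 k x ^ 2) atTop (𝓝 0))
    (hv : TendstoUniformlyOn f v atTop (Icc L R)) : QuadraticWherePos L R v := by
  intro c d hLc hcd hdR hpos
  obtain ⟨A, B, C, h1, h2⟩ := exists_quadratic_limit h hint hD hv hLc hcd hdR hpos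
  refine ⟨A, B, C, h1, fun hc => ?_, fun hd => ?_⟩
  · have := h2.tendsto_at (left_mem_Icc.2 hcd.le)
    rw [hc] at this
    simp only [(h _).left] at this
    exact (tendsto_nhds_unique this tendsto_const_nhds)
  · have := h2.tendsto_at (right_mem_Icc.2 hcd.le)
    rw [hd] at this
    simp only [(h _).right] at this
    exact (tendsto_nhds_unique this tendsto_const_nhds)

/-- A coarea estimate: `step δ ∘ f` changes by one between `c` and `d`, so the integral of `(step
δ)'(f) |f1|` is at least one, and the remaining factor `|f1|³` is at least `θ³`. -/
theorem Slice.le_integral_step {L R : ℝ} {f f1 f3 ψ : ℝ → ℝ} (h : Slice L R f f1 f3)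
    (hψ : Continuous ψ) {c d δ θ : ℝ} (hδ : 0 < δ) (hθ : 0 ≤ θ) (hLc : L < c) (hcd : c < d)
    (hdR : d < R) (hψ1 : ∀ x ∈ Icc c d, ψ x = 1) (hf1 : ∀ x ∈ Icc c d, θ ≤ |f1 x|)
    (hends : (f c ≤ δ ∧ 2 * δ ≤ f d) ∨ (f d ≤ δ ∧ 2 * δ ≤ f c)) :
    θ ^ 3 ≤ ∫ x in Ioo L R, deriv (step δ) (f x) * f1 x ^ 4 * ψ x ^ 2 := by
  have hsub : Icc c d ⊆ Ioo L R := fun x hx => ⟨hLc.trans_le hx.1, hx.2.trans_lt hdR⟩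
  have c0 := h.cont
  have c1 := h.cont1
  have cs : ContinuousOn (fun x => deriv (step δ) (f x)) (Icc L R) :=
    (continuous_deriv_step δ).comp_continuousOn c0
  have hi : ContinuousOn (fun x => deriv (step δ) (f x) * f1 x ^ 4 * ψ x ^ 2) (Icc L R) := by
    have := hψ.continuousOn (s := Icc L R)
    fun_prop
  have hnn : ∀ x, 0 ≤ deriv (step δ) (f x) * f1 x ^ 4 * ψ x ^ 2 := fun x =>
    mul_nonneg (mul_nonneg (deriv_step_nonneg hδ _) (by positivity)) (sq_nonneg _)
  have hcdLR : Icc c d ⊆ Icc L R := hsub.trans Ioo_subset_Icc_self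
  have s1 : ∫ x in c..d, deriv (step δ) (f x) * f1 x ^ 4 * ψ x ^ 2
      ≤ ∫ x in Ioo L R, deriv (step δ) (f x) * f1 x ^ 4 * ψ x ^ 2 := by
    rw [intervalIntegral.integral_of_le hcd.le]
    refine setIntegral_mono_set (hi.integrableOn_Icc.mono_set Ioo_subset_Icc_self)
      (Eventually.of_forall hnn) ?_
    exact (Ioc_subset_Icc_self.trans hsub).eventuallyLE
  have hg : ContinuousOn (fun x => deriv (step δ) (f x) * f1 x) (Icc c d) :=
    (cs.mul c1).mono hcdLR
  have hgi : IntervalIntegrable (fun x => deriv (step δ) (f x) * f1 x) volume c d := by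
    refine ContinuousOn.intervalIntegrable ?_
    rwa [uIcc_of_le hcd.le]
  have s2 : ∫ x in c..d, deriv (step δ) (f x) * f1 x = step δ (f d) - step δ (f c) := by
    refine intervalIntegral.integral_eq_sub_of_hasDerivAt (f := fun x => step δ (f x))
      (fun x hx => ?_) hgi
    rw [uIcc_of_le hcd.le] at hx
    exact (hasDerivAt_step δ (f x)).comp x (h.hasDerivAt x (hsub hx))
  have s3 : 1 ≤ ∫ x in c..d, |deriv (step δ) (f x) * f1 x| := by
    refine le_trans ?_ (intervalIntegral.abs_integral_le_integral_abs hcd.le)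
    rw [s2]
    rcases hends with ⟨h1, h2⟩ | ⟨h1, h2⟩
    · rw [step_of_le hδ h1, step_of_ge hδ h2]; norm_num
    · rw [step_of_le hδ h1, step_of_ge hδ h2]; norm_num
  have s4 : ∫ x in c..d, θ ^ 3 * |deriv (step δ) (f x) * f1 x|
      ≤ ∫ x in c..d, deriv (step δ) (f x) * f1 x ^ 4 * ψ x ^ 2 := by
    refine intervalIntegral.integral_mono_on hcd.le (hgi.abs.const_mul _) ?_ fun x hx => ?_
    · refine ContinuousOn.intervalIntegrable ?_
      rw [uIcc_of_le hcd.le]; exact hi.mono hcdLR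
    · rw [hψ1 x hx, one_pow, mul_one, abs_mul, abs_of_nonneg (deriv_step_nonneg hδ _)]
      have e : f1 x ^ 4 = |f1 x| ^ 3 * |f1 x| := by
        rw [← pow_succ, ← abs_pow]
        exact (abs_of_nonneg (by positivity)).symm
      rw [e]
      have h1 : θ ^ 3 ≤ |f1 x| ^ 3 := pow_le_pow_left₀ hθ (hf1 x hx) 3
      have h2 : 0 ≤ deriv (step δ) (f x) * |f1 x| :=
        mul_nonneg (deriv_step_nonneg hδ _) (abs_nonneg _)
      have := mul_le_mul_of_nonneg_right h1 h2
      linarith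
  rw [intervalIntegral.integral_const_mul] at s4
  have := mul_le_mul_of_nonneg_left s3 (pow_nonneg hθ 3)
  linarith

/-- A contact point of the limit inside the region `{ψ = 1}` keeps the dissipation away from `0`. -/
theorem not_tendsto_zero_of_contact {L R : ℝ} {f f1 f3 : ℕ → ℝ → ℝ} {v ψ : ℝ → ℝ} {E : ℝ}
    (h : ∀ k, Slice L R (f k) (f1 k) (f3 k))
    (hint : ∀ k, IntegrableOn (fun x => f k x ^ 3 * f3 k x ^ 2) (Ioo L R))
    (hD : Tendsto (fun k => ∫ x in Ioo L R, f k x ^ 3 * f3 k x ^ 2) atTop (𝓝 0))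
    (hE : ∀ k, ∫ x in Ioo L R, f1 k x ^ 2 ≤ E)
    (hv : TendstoUniformlyOn f v atTop (Icc L R)) (hψ : IsTest (Ioo L R) ψ)
    {x0 y : ℝ} (hx0 : x0 ∈ Ioo L R) (hy : y ∈ Ioo L R) (hvx : v x0 = 0) (hvy : 0 < v y)
    (hψ1 : ∀ x ∈ uIcc x0 y, ψ x = 1)
    (hg : Tendsto (fun k => ∫ x in Ioo L R, - (f k x * f1 k x * f3 k x) * ψ x ^ 2) atTop (𝓝 0)) :
    False := by
  have hvc : ContinuousOn v (Icc L R) := hv.continuousOn (Frequently.of_forall fun k => (h k).cont)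
  have hv0 : ∀ x ∈ Icc L R, 0 ≤ v x := fun x hx =>
    ge_of_tendsto' (hv.tendsto_at hx) fun k => (h k).nonneg x hx
  have hq := quadraticWherePos_of_limit h hint hD hv
  obtain ⟨θ, h0, hθ, hh0, H⟩ := hq.slope hvc hv0 hx0 hy hvx hvy
  obtain ⟨K, hK, HK⟩ := Slice.exists_lower_bound hψ
  have hE0 : 0 ≤ E := (integral_nonneg fun x => sq_nonneg _).trans (hE 0)
  -- First `k → ∞` at fixed `δ`, which removes the term with `δ ^ 2` in the denominator. The
  -- resulting inequality fails for small `δ`, since `θ` is independent of `δ`.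
  have key : ∀ δ, 0 < δ → 3 * δ ≤ h0 → (1 / 3) * (θ / 2) ^ 3 ≤ K * (δ * E) := by
    intro δ hδ hδh
    -- Once `f k` is within `δ / 2` of `v`, the end values `v ≤ δ / 2` and `v ≥ 3 δ` give `f k ≤ δ`
    -- and `f k ≥ 2 δ`, the levels separated by `step δ`.
    obtain ⟨c, d, A, B, C, hcd, hsub, hrep, hends⟩ := H (δ / 2) (half_pos hδ)
    have hI : Icc c d ⊆ Ioo L R := hsub.trans (ordConnected_Ioo.uIcc_subset hx0 hy)
    have hcI := hI (left_mem_Icc.2 hcd.le)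
    have hdI := hI (right_mem_Icc.2 hcd.le)
    obtain ⟨A', B', C', hr', hu'⟩ := exists_quadratic_limit h hint hD hv hcI.1.le hcd hdI.2.le
      fun x hx => (hrep x hx).1
    obtain ⟨rfl, rfl, rfl⟩ := quadratic_coeff_unique hcd fun x hx =>
      ((hrep x hx).2.1).symm.trans (hr' x hx)
    have hev : ∀ᶠ k in atTop, (1 / 3) * (θ / 2) ^ 3
        - K * (δ * E + (∫ x in Ioo L R, f k x ^ 3 * f3 k x ^ 2) / δ ^ 2)
        ≤ ∫ x in Ioo L R, - (f k x * f1 k x * f3 k x) * ψ x ^ 2 := by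
      filter_upwards [Metric.tendstoUniformlyOn_iff.1 hu' (θ / 2) (half_pos hθ),
        Metric.tendstoUniformlyOn_iff.1 hv (δ / 2) (half_pos hδ)] with k hk1 hk2
      have hLB := HK (h k) δ hδ (hint k)
      have hst := (h k).le_integral_step hψ.1.continuous hδ (half_pos hθ).le hcI.1 hcd hdI.2
        (fun x hx => hψ1 x (hsub hx))
        (fun x hx => by
          have h1 := hk1 x hx
          rw [Real.dist_eq] at h1
          have h2 := (hrep x hx).2.2
          have h3 := abs_sub_abs_le_abs_sub (B + 2 * C * x) (f1 k x)
          linarith)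
        (by
          have h1 := hk2 c (Ioo_subset_Icc_self hcI)
          have h2 := hk2 d (Ioo_subset_Icc_self hdI)
          rw [Real.dist_eq, abs_lt] at h1 h2
          rcases hends with ⟨e1, e2⟩ | ⟨e1, e2⟩
          · left; constructor <;> linarith [h1.1, h2.2]
          · right; constructor <;> linarith [h1.2, h2.1])
      have h5 : K * (δ * (∫ x in Ioo L R, f1 k x ^ 2)
          + (∫ x in Ioo L R, f k x ^ 3 * f3 k x ^ 2) / δ ^ 2)
          ≤ K * (δ * E + (∫ x in Ioo L R, f k x ^ 3 * f3 k x ^ 2) / δ ^ 2) := by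
        have := hE k
        gcongr
      linarith
    have hlim : Tendsto (fun k => (1 / 3) * (θ / 2) ^ 3
        - K * (δ * E + (∫ x in Ioo L R, f k x ^ 3 * f3 k x ^ 2) / δ ^ 2)) atTop
        (𝓝 ((1 / 3) * (θ / 2) ^ 3 - K * (δ * E))) := by
      have := ((hD.div_const (δ ^ 2)).const_add (δ * E)).const_mul K
      rw [zero_div, add_zero] at this
      exact this.const_sub _
    linarith [le_of_tendsto_of_tendsto hlim hg hev]
  have hc : 0 < (1 / 3) * (θ / 2) ^ 3 := by positivity
  set δ := min (h0 / 3) ((1 / 3) * (θ / 2) ^ 3 / (2 * K * (E + 1)))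
  have hδ : 0 < δ := lt_min (by positivity) (by positivity)
  have h1 := key δ hδ (by linarith [min_le_left (h0 / 3) ((1 / 3) * (θ / 2) ^ 3 / (2 * K * (E + 1)))])
  have h2 : δ ≤ (1 / 3) * (θ / 2) ^ 3 / (2 * K * (E + 1)) := min_le_right _ _
  rw [le_div_iff₀ (by positivity)] at h2
  have h3 : 0 < K * δ := by positivity
  linarith

/-! ### The entropy function `B` -/

/-- The kernel `1 / (v^{n-1} + v²)`. -/
noncomputable def kern (n v : ℝ) : ℝ := 1 / (v ^ (n - 1) + v ^ 2)

/-- The derivative of `B`. -/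
noncomputable def B' (n r : ℝ) : ℝ := ∫ v in Ioi r, kern n v

section

variable {n : ℝ}

theorem kern_pos {v : ℝ} (hv : 0 < v) : 0 < kern n v := by
  have := Real.rpow_pos_of_pos hv (n - 1)
  unfold kern; positivity

/-- As `a` lies between the two exponents, `v ^ a` is at most `v ^ (n - 1)` for `v ≤ 1` and at most
`v ^ 2` for `v ≥ 1`. -/
theorem kern_le_rpow {a v : ℝ} (ha : n - 1 ≤ a) (ha2 : a ≤ 2)
    (hv : 0 < v) : kern n v ≤ v ^ (-a) := by
  have h1 := Real.rpow_pos_of_pos hv (n - 1)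
  have h2 := Real.rpow_pos_of_pos hv a
  rw [Real.rpow_neg hv.le, kern, one_div]
  refine inv_anti₀ h2 ?_
  rcases le_or_gt v 1 with h | h
  · have := Real.rpow_le_rpow_of_exponent_ge hv h ha
    nlinarith [sq_nonneg v]
  · have := Real.rpow_le_rpow_of_exponent_le h.le ha2
    rw [Real.rpow_two] at this
    linarith

theorem continuousOn_kern : ContinuousOn (kern n) (Ioi 0) := by
  have h : ContinuousOn (fun v : ℝ => v ^ (n - 1)) (Ioi 0) := fun v hv =>
    (Real.continuousAt_rpow_const v _ (Or.inl (ne_of_gt hv))).continuousWithinAt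
  refine continuousOn_const.div (h.add (by fun_prop)) fun v hv => ?_
  have := Real.rpow_pos_of_pos (show 0 < v from hv) (n - 1)
  have hv : 0 < v := hv
  positivity

theorem integrableOn_kern (hn : n ∈ Ioo (0 : ℝ) 3) {r : ℝ} (hr : 0 < r) :
    IntegrableOn (kern n) (Ioi r) := by
  refine Integrable.mono' (integrableOn_Ioi_rpow_of_lt (show (-2 : ℝ) < -1 by norm_num) hr)
    ((continuousOn_kern.mono (Ioi_subset_Ioi hr.le)).aestronglyMeasurable measurableSet_Ioi) ?_
  refine (ae_restrict_iff' measurableSet_Ioi).2 (Eventually.of_forall fun v hv => ?_)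
  have hv' : 0 < v := hr.trans hv
  rw [Real.norm_eq_abs, abs_of_pos (kern_pos hv')]
  exact kern_le_rpow (by linarith [hn.2]) le_rfl hv'

theorem B'_nonneg {r : ℝ} (hr : 0 ≤ r) : 0 ≤ B' n r :=
  setIntegral_nonneg measurableSet_Ioi fun _ hv => (kern_pos (hr.trans_lt hv)).le

theorem B'_le_rpow (hn : n ∈ Ioo (0 : ℝ) 3) {a r : ℝ} (ha : n - 1 ≤ a) (ha1 : 1 < a) (ha2 : a ≤ 2)
    (hr : 0 < r) : B' n r ≤ r ^ (1 - a) / (a - 1) := by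
  have h1 : B' n r ≤ ∫ v in Ioi r, v ^ (-a) :=
    setIntegral_mono_on (integrableOn_kern hn hr)
      (integrableOn_Ioi_rpow_of_lt (by linarith) hr) measurableSet_Ioi
      fun v hv => kern_le_rpow ha ha2 (hr.trans hv)
  rw [integral_Ioi_rpow_of_lt (by linarith) hr] at h1
  have e : -r ^ (-a + 1) / (-a + 1) = r ^ (1 - a) / (a - 1) := by
    rw [show -a + 1 = -(a - 1) by ring, neg_div_neg_eq, show 1 - a = -(a - 1) by ring]
  rwa [e] at h1

theorem B'_le_inv (hn : n ∈ Ioo (0 : ℝ) 3) {r : ℝ} (hr : 0 < r) : B' n r ≤ 1 / r := by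
  have := B'_le_rpow hn (a := 2) (by linarith [hn.2]) (by norm_num) le_rfl hr
  rw [show (1 : ℝ) - 2 = -1 by norm_num, Real.rpow_neg_one] at this
  rw [one_div]; linarith

/-- The exponent `1 + n / 3` exceeds one and lies in `[n - 1, 2]` for every `n` in `(0,3)`, so no
distinction of cases in `n` is needed; the resulting singularity at zero is integrable because `n /
3 < 1`. -/
theorem B'_le (hn : n ∈ Ioo (0 : ℝ) 3) {r : ℝ} (hr : 0 < r) :
    B' n r ≤ 3 / n * r ^ (-(n / 3)) := by
  have hn0 := hn.1
  have hn3 := hn.2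
  have := B'_le_rpow hn (a := 1 + n / 3) (by linarith) (by linarith) (by linarith) hr
  rw [show 1 - (1 + n / 3) = -(n / 3) by ring, show 1 + n / 3 - 1 = n / 3 by ring] at this
  refine this.trans (le_of_eq ?_)
  field_simp

theorem primOn_B' (hn : n ∈ Ioo (0 : ℝ) 3) : PrimOn (Ioi 0) (B' n) (fun v => -kern n v) := by
  intro x y hxy hs
  have hx : 0 < x := hs (left_mem_Icc.2 hxy)
  have hi := integrableOn_kern hn hx
  have hi1 : IntegrableOn (kern n) (Ioc x y) := hi.mono_set Ioc_subset_Ioi_self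
  have hi2 : IntegrableOn (kern n) (Ioi y) := hi.mono_set (Ioi_subset_Ioi hxy)
  refine ⟨((intervalIntegrable_iff_integrableOn_Ioc_of_le hxy).2 hi1).neg, ?_⟩
  have h1 : B' n x = (∫ v in Ioc x y, kern n v) + B' n y := by
    unfold B'
    rw [← setIntegral_union (Ioc_disjoint_Ioi le_rfl) measurableSet_Ioi hi1 hi2,
      Ioc_union_Ioi_eq_Ioi hxy]
  rw [intervalIntegral.integral_neg, intervalIntegral.integral_of_le hxy, h1]; ring

theorem continuousOn_B' (hn : n ∈ Ioo (0 : ℝ) 3) : ContinuousOn (B' n) (Ioi 0) :=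
  (primOn_B' hn).continuousOn isOpen_Ioi

theorem intervalIntegrable_B'_zero (hn : n ∈ Ioo (0 : ℝ) 3) {z : ℝ} (hz : 0 ≤ z) :
    IntervalIntegrable (B' n) volume 0 z := by
  have h1 : IntervalIntegrable (fun r : ℝ => 3 / n * r ^ (-(n / 3))) volume 0 z :=
    (intervalIntegral.intervalIntegrable_rpow' (by linarith [hn.2])).const_mul _
  rw [intervalIntegrable_iff_integrableOn_Ioc_of_le hz] at h1 ⊢
  refine Integrable.mono' h1
    (((continuousOn_B' hn).mono Ioc_subset_Ioi_self).aestronglyMeasurable measurableSet_Ioc) ?_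
  refine (ae_restrict_iff' measurableSet_Ioc).2 (Eventually.of_forall fun r hr => ?_)
  rw [Real.norm_eq_abs, abs_of_nonneg (B'_nonneg hr.1.le)]
  exact B'_le hn hr.1

theorem intervalIntegrable_B' (hn : n ∈ Ioo (0 : ℝ) 3) {x y : ℝ} (hx : 0 ≤ x) (hy : 0 ≤ y) :
    IntervalIntegrable (B' n) volume x y :=
  (intervalIntegrable_B'_zero hn hx).symm.trans (intervalIntegrable_B'_zero hn hy)

theorem primOn_B (hn : n ∈ Ioo (0 : ℝ) 3) : PrimOn (Ici 0) (B n) (B' n) := by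
  intro x y hxy hs
  have hx : 0 ≤ x := hs (left_mem_Icc.2 hxy)
  have hy : 0 ≤ y := hx.trans hxy
  exact ⟨intervalIntegrable_B' hn hx hy, (intervalIntegral.integral_interval_sub_left
    (intervalIntegrable_B'_zero hn hy) (intervalIntegrable_B'_zero hn hx)).symm⟩

theorem hasDerivAt_B (hn : n ∈ Ioo (0 : ℝ) 3) {z : ℝ} (hz : 0 < z) :
    HasDerivAt (B n) (B' n z) z :=
  ((primOn_B hn).mono Ioi_subset_Ici_self).hasDerivAt isOpen_Ioi (continuousOn_B' hn) hz

theorem monotoneOn_B (hn : n ∈ Ioo (0 : ℝ) 3) : MonotoneOn (B n) (Ici 0) := by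
  intro x hx y hy hxy
  have h1 := (primOn_B hn x y hxy fun z hz => (show 0 ≤ x from hx).trans hz.1).2
  have h2 : 0 ≤ ∫ r in x..y, B' n r :=
    intervalIntegral.integral_nonneg hxy fun r hr => B'_nonneg ((show 0 ≤ x from hx).trans hr.1)
  linarith

theorem B_nonneg {z : ℝ} (hz : 0 ≤ z) : 0 ≤ B n z :=
  intervalIntegral.integral_nonneg hz fun _ hr => B'_nonneg (n := n) hr.1

theorem continuousOn_B (hn : n ∈ Ioo (0 : ℝ) 3) : ContinuousOn (B n) (Ici 0) := by
  intro z hz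
  have hz : 0 ≤ z := hz
  have hc := intervalIntegral.continuousOn_primitive_interval'
    (intervalIntegrable_B'_zero hn (show 0 ≤ z + 1 by linarith)) left_mem_uIcc
  rw [uIcc_of_le (by linarith)] at hc
  have h1 : ContinuousWithinAt (B n) (Icc 0 (z + 1)) z := hc z ⟨hz, by linarith⟩
  refine h1.mono_of_mem_nhdsWithin ?_
  filter_upwards [self_mem_nhdsWithin, mem_nhdsWithin_of_mem_nhds (Iio_mem_nhds
    (show z < z + 1 by linarith))] with y hy1 hy2 using ⟨hy1, le_of_lt hy2⟩

theorem B_le_log (hn : n ∈ Ioo (0 : ℝ) 3) {z : ℝ} (hz : 1 ≤ z) : B n z ≤ B n 1 + Real.log z := by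
  have h1 := (primOn_B hn 1 z hz fun x hx => zero_le_one.trans hx.1)
  have hinv : IntervalIntegrable (fun r : ℝ => 1 / r) volume 1 z := by
    refine intervalIntegral.intervalIntegrable_one_div (fun x hx => ?_) continuousOn_id
    rw [uIcc_of_le hz] at hx
    exact (zero_lt_one.trans_le hx.1).ne'
  have h2 : ∫ r in (1 : ℝ)..z, B' n r ≤ ∫ r in (1 : ℝ)..z, 1 / r :=
    intervalIntegral.integral_mono_on hz h1.1 hinv fun x hx =>
      B'_le_inv hn (zero_lt_one.trans_le hx.1)
  rw [integral_one_div_of_pos zero_lt_one (zero_lt_one.trans_le hz), div_one] at h2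
  linarith [h1.2]

/-- Since `n < 3`, the term `v²` dominates the kernel's denominator for large `v`, so the kernel is
eventually at least `η / v²` and `B'` at least `η / r`. -/
theorem exists_log_le_B (hn : n ∈ Ioo (0 : ℝ) 3) {η : ℝ} (hη : η ∈ Ioo (0 : ℝ) 1) :
    ∃ V, 1 ≤ V ∧ ∀ z, V ≤ z → η * (Real.log z - Real.log V) ≤ B n z := by
  have hlim : Tendsto (fun v : ℝ => v ^ (n - 3)) atTop (𝓝 0) := by
    have := tendsto_rpow_neg_atTop (show 0 < 3 - n by linarith [hn.2])
    simpa using this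
  have hpos : 0 < (1 - η) / η := div_pos (by linarith [hη.2]) hη.1
  obtain ⟨V0, hV0⟩ := eventually_atTop.1 (hlim.eventually_lt_const hpos)
  set V := max V0 1
  have hV1 : 1 ≤ V := le_max_right _ _
  refine ⟨V, hV1, fun z hz => ?_⟩
  have hk : ∀ v, V ≤ v → η * v ^ (-2 : ℝ) ≤ kern n v := by
    intro v hv
    have hv0 : 0 < v := by linarith
    have h1 := (hV0 v ((le_max_left _ _).trans hv)).le
    have h2 := Real.rpow_pos_of_pos hv0 (n - 1)
    have e : v ^ (n - 1) = v ^ (n - 3) * v ^ 2 := by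
      rw [← Real.rpow_two, ← Real.rpow_add hv0]; congr 1; ring
    rw [le_div_iff₀ hη.1] at h1
    rw [Real.rpow_neg hv0.le, Real.rpow_two, kern, ← div_eq_mul_inv,
      div_le_div_iff₀ (by positivity) (by positivity), e]
    have := mul_le_mul_of_nonneg_right h1 (sq_nonneg v)
    linarith
  have hb : ∀ r, V ≤ r → η * (1 / r) ≤ B' n r := by
    intro r hr
    have hr0 : 0 < r := by linarith
    have h1 := setIntegral_mono_on ((integrableOn_Ioi_rpow_of_lt
      (show (-2 : ℝ) < -1 by norm_num) hr0).const_mul η) (integrableOn_kern hn hr0)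
      measurableSet_Ioi fun v hv => hk v (hr.trans (le_of_lt hv))
    rw [integral_const_mul, integral_Ioi_rpow_of_lt (by norm_num) hr0] at h1
    have e : -r ^ (-2 + 1 : ℝ) / (-2 + 1) = 1 / r := by
      rw [show (-2 + 1 : ℝ) = -1 by norm_num, Real.rpow_neg_one, neg_div_neg_eq]; simp
    rw [e] at h1
    exact h1
  have hV0' : 0 < V := by linarith
  have h1 := primOn_B hn V z hz fun x hx => hV0'.le.trans hx.1
  have hinv : IntervalIntegrable (fun r : ℝ => 1 / r) volume V z := by
    refine intervalIntegral.intervalIntegrable_one_div (fun x hx => ?_) continuousOn_id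
    rw [uIcc_of_le hz] at hx
    exact (hV0'.trans_le hx.1).ne'
  have h2 := intervalIntegral.integral_mono_on hz (hinv.const_mul η) h1.1 fun x hx => hb x hx.1
  rw [intervalIntegral.integral_const_mul, integral_one_div_of_pos hV0' (hV0'.trans_le hz),
    Real.log_div (by linarith) (by linarith)] at h2
  linarith [h1.2, B_nonneg (n := n) hV0'.le]

theorem tendsto_B_div_log (hn : n ∈ Ioo (0 : ℝ) 3) :
    Tendsto (fun z => B n z / Real.log z) atTop (𝓝 1) := by
  have hlog := Real.tendsto_log_atTop
  have hsmall : ∀ c : ℝ, Tendsto (fun z => c / Real.log z) atTop (𝓝 0) := fun c =>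
    hlog.const_div_atTop c
  have hlp : ∀ᶠ z : ℝ in atTop, 0 < Real.log z := hlog.eventually_gt_atTop 0
  rw [tendsto_order]
  constructor
  · intro a ha
    obtain ⟨η, hη1, hη2⟩ := exists_between (max_lt ha zero_lt_one)
    have hη0 : 0 < η := (le_max_right _ _).trans_lt hη1
    obtain ⟨V, hV, H⟩ := exists_log_le_B hn (η := η) ⟨hη0, hη2⟩
    have : Tendsto (fun z => η - η * Real.log V / Real.log z) atTop (𝓝 η) := by
      simpa using (hsmall (η * Real.log V)).const_sub η
    filter_upwards [this.eventually_const_lt ((le_max_left a 0).trans_lt hη1),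
      eventually_ge_atTop V, hlp] with z h1 h2 h3
    refine h1.trans_le ?_
    rw [le_div_iff₀ h3, sub_mul, div_mul_cancel₀ _ h3.ne']
    linarith [H z h2]
  · intro a ha
    have : Tendsto (fun z => 1 + B n 1 / Real.log z) atTop (𝓝 1) := by
      simpa using (hsmall (B n 1)).const_add 1
    filter_upwards [this.eventually_lt_const ha, eventually_ge_atTop 1, hlp] with z h1 h2 h3
    refine lt_of_le_of_lt ?_ h1
    rw [div_le_iff₀ h3, add_mul, div_mul_cancel₀ _ h3.ne']
    linarith [B_le_log hn h2]

theorem abs_log_pos {ε : ℝ} (hε : ε ∈ Ioo (0 : ℝ) 1) : 0 < |Real.log ε| :=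
  abs_pos.2 (Real.log_neg hε.1 hε.2).ne

/-- `B z` is asymptotic to `log z`, and `log (s / ε) / |log ε| → 1`: every positive height is
recorded as density one, whatever its size. -/
theorem tendsto_Beps (hn : n ∈ Ioo (0 : ℝ) 3) {ε : ℕ → ℝ} (hε : ∀ k, ε k ∈ Ioo (0 : ℝ) 1)
    (hlim : Tendsto ε atTop (𝓝 0)) {s : ℝ} (hs : 0 < s) :
    Tendsto (fun k => Beps n (ε k) s) atTop (𝓝 1) := by
  have h0 : Tendsto ε atTop (𝓝[>] 0) :=
    tendsto_nhdsWithin_iff.2 ⟨hlim, Eventually.of_forall fun k => (hε k).1⟩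
  have h1 : Tendsto (fun k => s / ε k) atTop atTop := by
    simp only [div_eq_mul_inv]
    exact (h0.inv_tendsto_nhdsGT_zero).const_mul_atTop hs
  have h2 := (tendsto_B_div_log hn).comp h1
  have hL : Tendsto (fun k => |Real.log (ε k)|) atTop atTop :=
    tendsto_abs_atBot_atTop.comp (Real.tendsto_log_nhdsGT_zero.comp h0)
  have h3 : Tendsto (fun k => Real.log s / |Real.log (ε k)| + 1) atTop (𝓝 1) := by
    simpa using (hL.const_div_atTop (Real.log s)).add_const 1
  have h4 := h2.mul h3
  rw [one_mul] at h4
  have hlp : ∀ᶠ k in atTop, 0 < Real.log (s / ε k) :=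
    (Real.tendsto_log_atTop.comp h1).eventually_gt_atTop 0
  refine h4.congr' ?_
  filter_upwards [hlp] with k hk
  have hp := abs_log_pos (hε k)
  have e : Real.log s / |Real.log (ε k)| + 1 = Real.log (s / ε k) / |Real.log (ε k)| := by
    rw [eq_div_iff hp.ne', add_mul, div_mul_cancel₀ _ hp.ne', Real.log_div hs.ne' (hε k).1.ne',
      abs_of_neg (Real.log_neg (hε k).1 (hε k).2)]
    ring
  rw [e, Function.comp_apply, Beps]
  field_simp

theorem Beps_nonneg {ε s : ℝ} (hε : ε ∈ Ioo (0 : ℝ) 1) (hs : 0 ≤ s) : 0 ≤ Beps n ε s :=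
  div_nonneg (B_nonneg (div_nonneg hs hε.1.le)) (abs_nonneg _)

theorem monotoneOn_Beps (hn : n ∈ Ioo (0 : ℝ) 3) {ε : ℝ} (hε : ε ∈ Ioo (0 : ℝ) 1) :
    MonotoneOn (Beps n ε) (Ici 0) := by
  intro x hx y hy hxy
  have hε0 := hε.1
  refine div_le_div_of_nonneg_right (monotoneOn_B hn (div_nonneg hx hε0.le)
    (div_nonneg hy hε0.le) (by gcongr)) (abs_nonneg _)

theorem continuousOn_Beps (hn : n ∈ Ioo (0 : ℝ) 3) {ε : ℝ} (hε : ε ∈ Ioo (0 : ℝ) 1) :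
    ContinuousOn (Beps n ε) (Ici 0) :=
  ((continuousOn_B hn).comp (continuousOn_id.div_const ε)
    fun _ hx => div_nonneg hx hε.1.le).div_const _

theorem deriv_Beps (hn : n ∈ Ioo (0 : ℝ) 3) {ε s : ℝ} (hε : ε ∈ Ioo (0 : ℝ) 1) (hs : 0 < s) :
    deriv (Beps n ε) s = B' n (s / ε) / (ε * |Real.log ε|) := by
  have h := ((hasDerivAt_B hn (div_pos hs hε.1)).comp s
    ((hasDerivAt_id s).div_const ε)).div_const |Real.log ε|
  have e : deriv (Beps n ε) s = _ := h.deriv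
  rw [e]
  have := abs_log_pos hε
  have := hε.1
  field_simp

/-- With `s = ε z` the left-hand side is `ε B'(z)² (z^n + z³)`; `B'_le` bounds the first part by a
multiple of `z^(n/3) ≤ 1 + z` and `B'_le_inv` bounds the second by `z`. Through Young's inequality
this controls the flux `R` by a small constant plus a multiple of the dissipation density. -/
theorem flux_coeff_sq_le (hn : n ∈ Ioo (0 : ℝ) 3) {ε s : ℝ} (hε : ε ∈ Ioo (0 : ℝ) 1)
    (hs : 0 ≤ s) :
    (|Real.log ε| * deriv (Beps n ε) s) ^ 2 * mobility n ε s ≤ (9 / n ^ 2 + 1) * (1 + s) := by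
  have hn0 := hn.1
  have hε0 := hε.1
  rcases hs.eq_or_lt with rfl | hs
  · have : mobility n ε 0 = 0 := by simp [mobility, Real.zero_rpow hn0.ne']
    rw [this, mul_zero]; positivity
  have hlog := abs_log_pos hε
  rw [deriv_Beps hn hε hs]
  obtain ⟨z, hz, rfl⟩ : ∃ z, 0 < z ∧ s = ε * z := ⟨s / ε, div_pos hs hε0, by field_simp⟩
  have e1 : ε * z / ε = z := by field_simp
  have hzn := Real.rpow_pos_of_pos hz n
  have e2 : mobility n ε (ε * z) = ε ^ 3 * (z ^ n + z ^ 3) := by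
    rw [mobility, Real.mul_rpow hε0.le hz.le, ← mul_assoc, ← Real.rpow_add hε0]
    rw [show 3 - n + n = ((3 : ℕ) : ℝ) by norm_num, Real.rpow_natCast]; ring
  rw [e1, e2]
  have hb0 : 0 ≤ B' n z := B'_nonneg hz.le
  have h1 : B' n z ^ 2 * z ^ n ≤ 9 / n ^ 2 * z ^ (n / 3) := by
    have h2 := pow_le_pow_left₀ hb0 (B'_le hn hz) 2
    have h3 := mul_le_mul_of_nonneg_right h2 hzn.le
    refine h3.trans (le_of_eq ?_)
    have e3 : (z ^ (-(n / 3))) ^ 2 * z ^ n = z ^ (n / 3) := by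
      rw [← Real.rpow_natCast, ← Real.rpow_mul hz.le, ← Real.rpow_add hz]
      congr 1; push_cast; ring
    rw [mul_pow, mul_assoc, e3]; ring
  have h2 : z ^ (n / 3) ≤ 1 + z := by
    rcases le_or_gt z 1 with h | h
    · linarith [Real.rpow_le_one hz.le h (show 0 ≤ n / 3 by linarith)]
    · have := Real.rpow_le_rpow_of_exponent_le h.le (show n / 3 ≤ 1 by linarith [hn.2])
      rw [Real.rpow_one] at this; linarith
  have h3 : B' n z ^ 2 * z ^ 3 ≤ z := by
    have h4 := pow_le_pow_left₀ hb0 (B'_le_inv hn hz) 2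
    have := mul_le_mul_of_nonneg_right h4 (pow_pos hz 3).le
    refine this.trans (le_of_eq ?_)
    field_simp
  have e4 : (|Real.log ε| * (B' n z / (ε * |Real.log ε|))) ^ 2 * (ε ^ 3 * (z ^ n + z ^ 3))
      = ε * (B' n z ^ 2 * z ^ n + B' n z ^ 2 * z ^ 3) := by
    field_simp
  rw [e4]
  have h5 : 9 / n ^ 2 * z ^ (n / 3) ≤ 9 / n ^ 2 * (1 + z) := by gcongr
  have hA : 0 < 9 / n ^ 2 := by positivity
  calc ε * (B' n z ^ 2 * z ^ n + B' n z ^ 2 * z ^ 3)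
      ≤ ε * ((9 / n ^ 2 + 1) * (1 + z)) := by gcongr; linarith
    _ = (9 / n ^ 2 + 1) * (ε + ε * z) := by ring
    _ ≤ (9 / n ^ 2 + 1) * (1 + ε * z) := by
        have := hε.2.le
        gcongr

end

/-! ### Solutions at almost every time -/

theorem PrimOn.Icc_of_Ioo {a b : ℝ} {F f : ℝ → ℝ} (h : PrimOn (Ioo a b) F f)
    (hF : ContinuousOn F (Icc a b)) (hf : IntegrableOn f (Ioo a b)) : PrimOn (Icc a b) F f := by
  intro x y hxy hs
  have hab : a ≤ b := (hs (left_mem_Icc.2 hxy)).1.trans (hs (left_mem_Icc.2 hxy)).2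
  rcases eq_or_lt_of_le hab with he | hab
  · have hx := hs (left_mem_Icc.2 hxy)
    have hy := hs (right_mem_Icc.2 hxy)
    have : x = y := le_antisymm hxy (by linarith [hy.2, hx.1])
    rw [this]; simp
  have hi : IntervalIntegrable f volume a b := by
    rw [intervalIntegrable_iff_integrableOn_Ioc_of_le hab.le]
    exact hf.congr_set_ae Ioo_ae_eq_Ioc.symm
  have hi' : ∀ z ∈ Icc a b, ∀ w ∈ Icc a b, IntervalIntegrable f volume z w := fun z hz w hw =>
    hi.mono_set (by rw [uIcc_of_le hab.le]; exact ordConnected_Icc.uIcc_subset hz hw)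
  set m := (a + b) / 2
  have hm : m ∈ Ioo a b := ⟨by simp only [m]; linarith, by simp only [m]; linarith⟩
  have hmI := Ioo_subset_Icc_self hm
  have hG : ContinuousOn (fun z => F m + ∫ t in m..z, f t) (Icc a b) := by
    have := intervalIntegral.continuousOn_primitive_interval' hi
      (show m ∈ uIcc a b by rwa [uIcc_of_le hab.le])
    rw [uIcc_of_le hab.le] at this
    exact continuousOn_const.add this
  have heq : EqOn F (fun z => F m + ∫ t in m..z, f t) (Icc a b) := by
    refine EqOn.of_subset_closure (s := Ioo a b) (fun z hz => ?_) hF hG Ioo_subset_Icc_self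
      (by rw [closure_Ioo hab.ne])
    rcases le_total m z with hmz | hmz
    · have := (h m z hmz fun w hw => ⟨hm.1.trans_le hw.1, hw.2.trans_lt hz.2⟩).2
      simp only [this]; ring
    · have := (h z m hmz fun w hw => ⟨hz.1.trans_le hw.1, hw.2.trans_lt hm.2⟩).2
      rw [intervalIntegral.integral_symm, this]; ring
  have hx := hs (left_mem_Icc.2 hxy)
  have hy := hs (right_mem_Icc.2 hxy)
  refine ⟨hi' x hx y hy, ?_⟩
  rw [heq hx, heq hy, ← intervalIntegral.integral_interval_sub_left (hi' m hmI y hy)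
    (hi' m hmI x hx)]
  ring

/-- Needed at time zero: `u1 0` is some weak derivative of the common initial value, so the initial
energy does not depend on `ε`. -/
theorem HasWeakDeriv.ae_unique {U : Set ℝ} (hU : IsOpen U) {f f' g g' : ℝ → ℝ}
    (h : HasWeakDeriv 1 U f g) (h' : HasWeakDeriv 1 U f' g') (he : EqOn f f' U) :
    ∀ᵐ x, x ∈ U → g x = g' x := by
  have hloc : LocallyIntegrableOn (fun x => g x - g' x) U := h.2.1.sub h'.2.1
  have := hU.ae_eq_zero_of_integral_contDiff_smul_eq_zero hloc (fun φ h1 h2 h3 => ?_)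
  · filter_upwards [this] with x hx hxU using by linarith [hx hxU]
  have hφ : IsTest U φ := ⟨h1, h2, h3⟩
  have e1 := h.2.2 φ hφ
  have e2 := h'.2.2 φ hφ
  rw [setIntegral_congr_fun hU.measurableSet (fun x hx => by
    simp only; rw [he hx] : EqOn (fun x => f x * iteratedDeriv 1 φ x)
      (fun x => f' x * iteratedDeriv 1 φ x) U), e2] at e1
  have z0 : ∀ x ∉ U, φ x = 0 := fun x hx => image_eq_zero_of_notMem_tsupport fun h => hx (h3 h)
  have i1 := integrable_mul_of_tsupport_subset h.2.1 h1.continuous h2 h3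
  have i2 := integrable_mul_of_tsupport_subset h'.2.1 h1.continuous h2 h3
  rw [setIntegral_eq_integral_of_forall_compl_eq_zero (fun x hx => by rw [z0 x hx, mul_zero]),
    setIntegral_eq_integral_of_forall_compl_eq_zero (fun x hx => by rw [z0 x hx, mul_zero])] at e1
  have e3 : ∫ x, φ x • (g x - g' x) = (∫ x, g x * φ x) - ∫ x, g' x * φ x := by
    rw [← integral_sub i1 i2]; congr 1; ext x; simp only [smul_eq_mul]; ring
  rw [e3]; linarith

theorem restrict_prod_eq (A B : Set ℝ) :
    (volume : Measure (ℝ × ℝ)).restrict (A ×ˢ B)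
      = (volume.restrict A).prod (volume.restrict B) := by
  rw [Measure.volume_eq_prod, Measure.prod_restrict]

theorem continuous_mobility {n ε : ℝ} (hn : n ∈ Ioo (0 : ℝ) 3) : Continuous (mobility n ε) := by
  have := Real.continuous_rpow_const hn.1.le
  unfold mobility
  fun_prop

theorem pow_three_le_mobility {n ε s : ℝ} (hε : ε ∈ Ioo (0 : ℝ) 1) (hs : 0 ≤ s) :
    s ^ 3 ≤ mobility n ε s := by
  have h1 := Real.rpow_nonneg hε.1.le (3 - n)
  have h2 := Real.rpow_nonneg hs n
  have := mul_nonneg h1 h2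
  unfold mobility; linarith

/-- The energy dissipation at time `t`, without the factor `|ln ε|`. -/
noncomputable def diss (L R n ε : ℝ) (u u3 : ℝ → ℝ → ℝ) (t : ℝ) : ℝ≥0∞ :=
  ∫⁻ x in Ioo L R, ENNReal.ofReal (mobility n ε (u t x) * u3 t x ^ 2)

namespace IsSolutionWith

variable {L R n ε : ℝ} {u₀ : ℝ → ℝ} {u u1 u2 u3 : ℝ → ℝ → ℝ}

theorem continuousOn_slice (h : IsSolutionWith L R n ε u₀ u u1 u2 u3) {t : ℝ} (ht : 0 ≤ t) :
    ContinuousOn (u t) (Icc L R) :=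
  h.cont.comp (f := fun x => (t, x)) (by fun_prop) fun _ hx => ⟨ht, hx⟩

theorem aesm (h : IsSolutionWith L R n ε u₀ u u1 u2 u3) :
    AEStronglyMeasurable (Function.uncurry u)
      ((volume.restrict (Ioi 0)).prod (volume.restrict (Ioo L R))) := by
  rw [← restrict_prod_eq]
  exact (h.cont.mono (prod_mono Ioi_subset_Ici_self Ioo_subset_Icc_self)).aestronglyMeasurable
    (measurableSet_Ioi.prod measurableSet_Ioo)

theorem aesm1 (h : IsSolutionWith L R n ε u₀ u u1 u2 u3) :
    AEStronglyMeasurable (Function.uncurry u1)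
      ((volume.restrict (Ioi 0)).prod (volume.restrict (Ioo L R))) := by
  rw [← restrict_prod_eq]; exact h.meas1

theorem aesm2 (h : IsSolutionWith L R n ε u₀ u u1 u2 u3) :
    AEStronglyMeasurable (Function.uncurry u2)
      ((volume.restrict (Ioi 0)).prod (volume.restrict (Ioo L R))) := by
  rw [← restrict_prod_eq]; exact h.meas2

theorem aesm3 (h : IsSolutionWith L R n ε u₀ u u1 u2 u3) :
    AEStronglyMeasurable (Function.uncurry u3)
      ((volume.restrict (Ioi 0)).prod (volume.restrict (Ioo L R))) := by
  rw [← restrict_prod_eq]; exact h.meas3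

theorem aemeasurable_diss (hn : n ∈ Ioo (0 : ℝ) 3) (h : IsSolutionWith L R n ε u₀ u u1 u2 u3) :
    AEMeasurable (diss L R n ε u u3) (volume.restrict (Ioi 0)) := by
  have : AEMeasurable (fun q : ℝ × ℝ => ENNReal.ofReal (mobility n ε (u q.1 q.2) * u3 q.1 q.2 ^ 2))
      ((volume.restrict (Ioi 0)).prod (volume.restrict (Ioo L R))) :=
    (((continuous_mobility hn).comp_aestronglyMeasurable h.aesm).mul
      (h.aesm3.pow 2)).aemeasurable.ennreal_ofReal
  exact this.lintegral_prod_right'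

/-- Only the second term of the energy inequality is kept. The factor `|ln ε|` is what drives the
dissipation to zero. -/
theorem lintegral_diss_le (h : IsSolutionWith L R n ε u₀ u u1 u2 u3) {S : ℝ} (hS : 0 < S) :
    ENNReal.ofReal |Real.log ε| * (∫⁻ t in Ioo 0 S, diss L R n ε u u3 t)
      ≤ ∫⁻ x in Ioo L R, ENNReal.ofReal ((1 / 2) * u1 0 x ^ 2) := by
  have h1 := le_add_self.trans (h.energy S hS)
  refine le_trans (le_of_eq ?_) h1
  rw [← lintegral_const_mul' _ _ ENNReal.ofReal_ne_top]
  refine lintegral_congr fun t => ?_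
  rw [diss, ← lintegral_const_mul' _ _ ENNReal.ofReal_ne_top]
  refine lintegral_congr fun x => ?_
  rw [← ENNReal.ofReal_mul (abs_nonneg _), mul_assoc]

theorem lintegral_initial (hg : ∃ g, HasH1Deriv L R u₀ g)
    (h : IsSolutionWith L R n ε u₀ u u1 u2 u3) :
    ∫⁻ x in Ioo L R, ENNReal.ofReal ((1 / 2) * u1 0 x ^ 2)
      = ∫⁻ x in Ioo L R, ENNReal.ofReal ((1 / 2) * hg.choose x ^ 2) := by
  refine lintegral_congr_ae ((ae_restrict_iff' measurableSet_Ioo).2 ?_)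
  filter_upwards [HasWeakDeriv.ae_unique isOpen_Ioo (h.deriv1 0 le_rfl).2.2 hg.choose_spec.2.2
    fun x hx => h.initial x (Ioo_subset_Icc_self hx)] with x hx hxm
  rw [hx hxm]

theorem primOn (h : IsSolutionWith L R n ε u₀ u u1 u2 u3) {t : ℝ} (ht : 0 ≤ t) :
    PrimOn (Icc L R) (u t) (u1 t) := by
  have hc := h.continuousOn_slice ht
  have hd := h.deriv1 t ht
  refine PrimOn.Icc_of_Ioo (hd.2.2.primOn (hc.mono Ioo_subset_Icc_self)) hc ?_
  exact hd.2.1.integrable (by norm_num)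

theorem integral_sq_le (h : IsSolutionWith L R n ε u₀ u u1 u2 u3) {E : ℝ} (hE0 : 0 ≤ E)
    (hE : ∫⁻ x in Ioo L R, ENNReal.ofReal ((1 / 2) * u1 0 x ^ 2) ≤ ENNReal.ofReal (E / 2))
    {t : ℝ} (ht : 0 < t) : IntegrableOn (fun x => u1 t x ^ 2) (Ioo L R) ∧
      ∫ x in Ioo L R, u1 t x ^ 2 ≤ E := by
  have hm := (h.deriv1 t ht.le).2.1
  have hi : IntegrableOn (fun x => u1 t x ^ 2) (Ioo L R) :=
    (memLp_two_iff_integrable_sq hm.1).1 hm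
  refine ⟨hi, ?_⟩
  have h1 := (le_self_add.trans (h.energy t ht)).trans hE
  rw [← ofReal_integral_eq_lintegral_ofReal (hi.const_mul _)
    (Eventually.of_forall fun x => by positivity), ENNReal.ofReal_le_ofReal_iff (by positivity),
    integral_const_mul] at h1
  linarith

/-- Young's inequality for `|u_x|` takes the place of the Cauchy–Schwarz inequality. Optimising in
`κ` would give Hölder exponent `1/2`; for equicontinuity the present form suffices. -/
theorem holder (h : IsSolutionWith L R n ε u₀ u u1 u2 u3) {E : ℝ}
    {t : ℝ} (ht : 0 ≤ t) (hi : IntegrableOn (fun x => u1 t x ^ 2) (Ioo L R))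
    (hE : ∫ x in Ioo L R, u1 t x ^ 2 ≤ E) {κ : ℝ} (hκ : 0 < κ) {x y : ℝ} (hx : x ∈ Icc L R)
    (hy : y ∈ Icc L R) : |u t x - u t y| ≤ κ * |x - y| + E / κ := by
  wlog hxy : y ≤ x generalizing x y
  · rw [abs_sub_comm (u t x), abs_sub_comm x]; exact this hy hx (le_of_not_ge hxy)
  obtain ⟨h1, h2⟩ := h.primOn ht y x hxy (Icc_subset_Icc hy.1 hx.2)
  have hi' : IntegrableOn (fun x => u1 t x ^ 2) (Ioc L R) :=
    hi.congr_set_ae Ioo_ae_eq_Ioc.symm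
  have hi2 : IntervalIntegrable (fun x => u1 t x ^ 2) volume y x := by
    rw [intervalIntegrable_iff_integrableOn_Ioc_of_le hxy]
    exact hi'.mono_set (Ioc_subset_Ioc hy.1 hx.2)
  rw [← h2]
  have h3 : |∫ z in y..x, u1 t z| ≤ ∫ z in y..x, (κ + u1 t z ^ 2 / κ) := by
    refine (intervalIntegral.abs_integral_le_integral_abs hxy).trans
      (intervalIntegral.integral_mono_on hxy h1.abs
        (intervalIntegrable_const.add (hi2.div_const κ)) fun z _ => ?_)
    have h4 : 0 ≤ (κ - |u1 t z| / 2) ^ 2 / κ := by positivity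
    have h5 : (κ - |u1 t z| / 2) ^ 2 / κ = κ - |u1 t z| + u1 t z ^ 2 / κ / 4 := by
      rw [← sq_abs (u1 t z)]; field_simp; ring
    have h6 : 0 ≤ u1 t z ^ 2 / κ := by positivity
    linarith
  rw [intervalIntegral.integral_add intervalIntegrable_const (hi2.div_const κ),
    intervalIntegral.integral_const, intervalIntegral.integral_div, smul_eq_mul] at h3
  refine h3.trans ?_
  rw [abs_of_nonneg (by linarith : 0 ≤ x - y), mul_comm κ]
  gcongr
  rw [intervalIntegral.integral_of_le hxy]
  refine le_trans ?_ hE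
  rw [setIntegral_congr_set (Ioo_ae_eq_Ioc (a := L) (b := R))]
  refine setIntegral_mono_set hi' (Eventually.of_forall fun z => sq_nonneg _)
    (Ioc_subset_Ioc hy.1 hx.2).eventuallyLE

/-- The oscillation bound with `κ = 1` is integrated over the second point, and the mass is one. -/
theorem le_sup_bound (hLR : L < R) (h : IsSolutionWith L R n ε u₀ u u1 u2 u3) {E : ℝ}
    {t : ℝ} (ht : 0 ≤ t) (hi : IntegrableOn (fun x => u1 t x ^ 2) (Ioo L R))
    (hE : ∫ x in Ioo L R, u1 t x ^ 2 ≤ E) (hm : ∫ x in Ioo L R, u₀ x = 1)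
    {x : ℝ} (hx : x ∈ Icc L R) : u t x ≤ 1 / (R - L) + ((R - L) + E) := by
  have hRL : 0 < R - L := by linarith
  have hi0 : IntegrableOn (u t) (Ioo L R) :=
    (h.continuousOn_slice ht).integrableOn_Icc.mono_set Ioo_subset_Icc_self
  have h1 : ∫ y in Ioo L R, u t x ≤ ∫ y in Ioo L R, (u t y + ((R - L) + E)) := by
    refine setIntegral_mono_on (integrable_const _) (hi0.add (integrable_const _))
      measurableSet_Ioo fun y hy => ?_
    have hy' := Ioo_subset_Icc_self hy
    have h2 := h.holder ht hi hE zero_lt_one hx hy'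
    have h3 : |x - y| ≤ R - L := by rw [abs_le]; constructor <;> linarith [hx.1, hx.2, hy.1, hy.2]
    have h4 := le_abs_self (u t x - u t y)
    linarith
  rw [integral_add hi0 (integrable_const _), h.mass t ht, hm] at h1
  simp only [integral_const, measureReal_restrict_apply_univ, Real.volume_real_Ioo_of_le hLR.le,
    smul_eq_mul] at h1
  have : (R - L) * u t x ≤ (R - L) * (1 / (R - L) + ((R - L) + E)) := by
    rw [mul_add, mul_one_div_cancel hRL.ne']; exact h1
  exact le_of_mul_le_mul_left this hRL

theorem ae_slice (hε : ε ∈ Ioo (0 : ℝ) 1)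
    (hn : n ∈ Ioo (0 : ℝ) 3) (hg : MemH1 L R u₀) (h : IsSolutionWith L R n ε u₀ u u1 u2 u3) :
    ∀ᵐ t : ℝ, 0 < t → Slice L R (u t) (u1 t) (u3 t) ∧ diss L R n ε u u3 t < ⊤ := by
  have hm3 : ∀ᵐ t : ℝ, 0 < t →
      AEStronglyMeasurable (fun x => u t x * u3 t x) (volume.restrict (Ioo L R)) := by
    have := (h.aesm.mul h.aesm3).prodMk_left
    exact (ae_restrict_iff' measurableSet_Ioi).1 this
  have hm2 : ∀ᵐ t : ℝ, 0 < t →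
      AEStronglyMeasurable (fun x => u t x * u2 t x ^ 2) (volume.restrict (Ioo L R)) := by
    have := (h.aesm.mul (h.aesm2.pow 2)).prodMk_left
    exact (ae_restrict_iff' measurableSet_Ioi).1 this
  -- The bounds in time hold on bounded intervals only, so the half-line is exhausted by integer
  -- horizons.
  have ae_nat : ∀ {P : ℝ → Prop}, (∀ S : ℕ, ∀ᵐ t ∂(volume.restrict (Ioo (0 : ℝ) (S + 1))), P t) →
      ∀ᵐ t : ℝ, 0 < t → P t := by
    intro P hP
    have : ∀ᵐ t : ℝ, ∀ S : ℕ, t ∈ Ioo (0 : ℝ) (S + 1) → P t :=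
      ae_all_iff.2 fun S => (ae_restrict_iff' measurableSet_Ioo).1 (hP S)
    filter_upwards [this] with t ht h0
    obtain ⟨S, hS⟩ := exists_nat_gt t
    exact ht S ⟨h0, by linarith⟩
  have hmono : ∀ S : ℝ, volume.restrict (Ioo (0 : ℝ) S) ≤ volume.restrict (Ioi 0) := fun S =>
    Measure.restrict_mono_set _ Ioo_subset_Ioi_self
  have hent : ∀ᵐ t : ℝ, 0 < t → ∫⁻ x in Ioo L R, ENNReal.ofReal (u t x * u2 t x ^ 2) < ⊤ := by
    refine ae_nat fun S => ?_
    have hmeas : AEMeasurable (fun q : ℝ × ℝ => ENNReal.ofReal (u q.1 q.2 * u2 q.1 q.2 ^ 2))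
        ((volume.restrict (Ioi 0)).prod (volume.restrict (Ioo L R))) :=
      (h.aesm.mul (h.aesm2.pow 2)).aemeasurable.ennreal_ofReal
    refine ae_lt_top' (hmeas.lintegral_prod_right'.mono_measure (hmono _)) (ne_of_lt ?_)
    exact (le_self_add.trans (h.entropy (S + 1) (by positivity))).trans_lt ENNReal.ofReal_lt_top
  have hdiss : ∀ᵐ t : ℝ, 0 < t → diss L R n ε u u3 t < ⊤ := by
    refine ae_nat fun S => ?_
    refine ae_lt_top' ((h.aemeasurable_diss hn).mono_measure (hmono _)) fun htop => ?_
    have h1 := h.lintegral_diss_le (S := S + 1) (by positivity)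
    rw [htop, ENNReal.mul_top (by
      rw [ne_eq, ENNReal.ofReal_eq_zero, not_le]; exact abs_log_pos hε),
      h.lintegral_initial hg] at h1
    have h2 := (memLp_two_iff_integrable_sq hg.choose_spec.2.1.1).1 hg.choose_spec.2.1
    have h3 := (h2.const_mul (1 / 2)).lintegral_lt_top
    exact absurd (top_le_iff.1 h1) h3.ne
  filter_upwards [hm3, hm2, hent, hdiss, h.deriv2, h.deriv3, h.neumann, h.T_eq] with t h3 h2 he hdi
    hd2 hd3 hneu hT ht
  refine ⟨?_, hdi ht⟩
  have hcont := h.continuousOn_slice ht.le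
  have hd1 := (h.deriv1 t ht.le).2.2
  obtain ⟨hc1, hL, hR⟩ := hneu ht
  have hU : IsOpen {x ∈ Ioo L R | 0 < u t x} :=
    (hcont.mono Ioo_subset_Icc_self).isOpen_inter_preimage isOpen_Ioo isOpen_Ioi
  have hUs : {x ∈ Ioo L R | 0 < u t x} ⊆ Ioo L R := fun x hx => hx.1
  have hw2 : HasWeakDeriv 1 {x ∈ Ioo L R | 0 < u t x} (u1 t) (u2 t) :=
    (hasWeakDeriv_one_mono hUs hd1).of_succ (k := 1) (hd2 ht)
  have hw3 : HasWeakDeriv 1 {x ∈ Ioo L R | 0 < u t x} (u2 t) (u3 t) :=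
    (hd2 ht).of_succ (k := 2) (hd3 ht)
  obtain ⟨r1, r2, r3⟩ := HasWeakDeriv.deriv_regularity hU
    (hc1.mono (hUs.trans Ioo_subset_Icc_self)) hw2 hw3
  have hnn := h.nonneg t ht.le
  have hae : ∀ᵐ x, x ∈ Ioo L R → u t x * u2 t x ^ 2 = u t x * deriv (u1 t) x ^ 2 := by
    filter_upwards [r3] with x hx hxI
    rcases (hnn x (Ioo_subset_Icc_self hxI)).eq_or_lt with h0 | h0
    · rw [← h0]; simp
    · rw [hx ⟨hxI, h0⟩]
  have hae' := (ae_restrict_iff' (μ := volume) (measurableSet_Ioo (a := L) (b := R))).2 hae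
  have hint : IntegrableOn (fun x => u t x * u2 t x ^ 2) (Ioo L R) := by
    refine ⟨h2 ht, ?_⟩
    rw [hasFiniteIntegral_iff_ofReal]
    · exact he ht
    · exact (ae_restrict_iff' measurableSet_Ioo).2 (Eventually.of_forall fun x hx =>
        mul_nonneg (hnn x (Ioo_subset_Icc_self hx)) (sq_nonneg _))
  exact {
    cont := hcont
    nonneg := hnn
    hasDerivAt := fun x hx => (hd1.primOn (hcont.mono Ioo_subset_Icc_self)).hasDerivAt isOpen_Ioo
      (hc1.mono Ioo_subset_Icc_self) hx
    cont1 := hc1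
    left := hL
    right := hR
    hasDerivAt1 := fun x hx h0 => r1 x ⟨hx, h0⟩
    prim := r2
    meas3 := h3 ht
    int2 := hint.congr hae'
    T_eq := fun φ hφ => by
      rw [hT ht φ hφ]
      congr 2
      refine integral_congr_ae ?_
      filter_upwards [hae'] with x hx
      rw [hx] }

theorem integrable_dissipation (hε : ε ∈ Ioo (0 : ℝ) 1)
    {t : ℝ} (hs : Slice L R (u t) (u1 t) (u3 t)) (hd : diss L R n ε u u3 t < ⊤) :
    IntegrableOn (fun x => u t x ^ 3 * u3 t x ^ 2) (Ioo L R) ∧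
      ENNReal.ofReal (∫ x in Ioo L R, u t x ^ 3 * u3 t x ^ 2) ≤ diss L R n ε u u3 t := by
  have hnn : 0 ≤ᵐ[volume.restrict (Ioo L R)] fun x => u t x ^ 3 * u3 t x ^ 2 :=
    (ae_restrict_iff' measurableSet_Ioo).2 (Eventually.of_forall fun x hx =>
      mul_nonneg (pow_nonneg (hs.nonneg x (Ioo_subset_Icc_self hx)) 3) (sq_nonneg _))
  have hle : ∫⁻ x in Ioo L R, ENNReal.ofReal (u t x ^ 3 * u3 t x ^ 2) ≤ diss L R n ε u u3 t := by
    refine setLIntegral_mono' measurableSet_Ioo fun x hx => ENNReal.ofReal_le_ofReal ?_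
    exact mul_le_mul_of_nonneg_right
      (pow_three_le_mobility hε (hs.nonneg x (Ioo_subset_Icc_self hx))) (sq_nonneg _)
  have hi : IntegrableOn (fun x => u t x ^ 3 * u3 t x ^ 2) (Ioo L R) := by
    refine ⟨?_, ?_⟩
    · have e : (fun x => u t x ^ 3 * u3 t x ^ 2) = fun x => u t x * (u t x * u3 t x) ^ 2 := by
        ext x; ring
      rw [e]
      exact hs.aesm.mul (hs.meas3.pow 2)
    · rw [hasFiniteIntegral_iff_ofReal hnn]
      exact hle.trans_lt hd
  refine ⟨hi, ?_⟩
  rwa [ofReal_integral_eq_lintegral_ofReal hi hnn]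

end IsSolutionWith

/-! ### Limits of nonnegative integrals -/

/-- First `j` is fixed so that `b j` is small, then `k → ∞`. In the applications `1 / (j + 1)` is
the cutoff height or the Young parameter, traded against a large multiple of the dissipation. -/
theorem ennreal_tendsto_zero_of_forall_le {a d b c : ℕ → ℝ≥0∞} (hd : Tendsto d atTop (𝓝 0))
    (hb : Tendsto b atTop (𝓝 0)) (hc : ∀ j, c j ≠ ⊤) (h : ∀ j k, a k ≤ b j + c j * d k) :
    Tendsto a atTop (𝓝 0) := by
  rw [ENNReal.tendsto_nhds_zero]
  intro η hη
  have hη2 : 0 < η / 2 := ENNReal.half_pos hη.ne'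
  obtain ⟨j, hj⟩ := (ENNReal.tendsto_nhds_zero.1 hb (η / 2) hη2).exists
  have h1 : Tendsto (fun k => c j * d k) atTop (𝓝 0) := by
    simpa using ENNReal.Tendsto.const_mul hd (Or.inr (hc j))
  filter_upwards [ENNReal.tendsto_nhds_zero.1 h1 (η / 2) hη2] with k hk
  calc a k ≤ b j + c j * d k := h j k
    _ ≤ η / 2 + η / 2 := add_le_add hj hk
    _ = η := ENNReal.add_halves η

theorem tendsto_ofReal_mul_one_div (a : ℝ) :
    Tendsto (fun j : ℕ => ENNReal.ofReal (a * (1 / ((j : ℝ) + 1)))) atTop (𝓝 0) := by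
  have h := (tendsto_one_div_add_atTop_nhds_zero_nat (𝕜 := ℝ)).const_mul a
  rw [mul_zero] at h
  simpa using ENNReal.tendsto_ofReal h

/-- Countably many sequences that tend to `0` in `L¹` have a common subsequence along which all of
them tend to `0` almost everywhere. -/
theorem exists_subseq_tendsto_ae {ι α : Type*} [Countable ι] [MeasurableSpace α]
    {μ : ι → Measure α} {F : ι → ℕ → α → ℝ≥0∞} (hF : ∀ i k, AEMeasurable (F i k) (μ i))
    (h : ∀ i, Tendsto (fun k => ∫⁻ a, F i k a ∂(μ i)) atTop (𝓝 0)) :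
    ∃ σ : ℕ → ℕ, StrictMono σ ∧
      ∀ i, ∀ᵐ a ∂(μ i), Tendsto (fun k => F i (σ k) a) atTop (𝓝 0) := by
  obtain ⟨enc, henc⟩ := exists_injective_nat ι
  have hp : ∀ j : ℕ, ∀ᶠ k in atTop, ∀ i, enc i ≤ j → ∫⁻ a, F i k a ∂(μ i) ≤ (1 / 2) ^ j := by
    intro j
    have hfin : {i | enc i ≤ j}.Finite :=
      Set.Finite.preimage henc.injOn (Set.finite_Iic j)
    have hpos : (0 : ℝ≥0∞) < (1 / 2) ^ j := ENNReal.pow_pos (by simp) j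
    exact (hfin.eventually_all (p := fun i k => ∫⁻ a, F i k a ∂(μ i) ≤ (1 / 2) ^ j)).2
      fun i _ => ENNReal.tendsto_nhds_zero.1 (h i) _ hpos
  obtain ⟨σ, hσ, H⟩ := extraction_forall_of_eventually hp
  refine ⟨σ, hσ, fun i => ?_⟩
  -- The `i`-th sequence is controlled from index `enc i` on; after this shift its integrals are
  -- dominated by a geometric series.
  have hsum : ∫⁻ a, ∑' j, F i (σ (j + enc i)) a ∂(μ i) ≠ ⊤ := by
    rw [lintegral_tsum fun j => hF i _]
    refine ne_top_of_le_ne_top ?_ (ENNReal.tsum_le_tsum fun j =>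
      (H (j + enc i) i (Nat.le_add_left _ _)).trans
        (pow_le_pow_of_le_one (by simp) (by simp) (Nat.le_add_right j (enc i))))
    simp only [one_div]
    rw [ENNReal.tsum_geometric, ENNReal.one_sub_inv_two, inv_inv]
    exact ENNReal.ofNat_ne_top
  have hae := ae_lt_top' (AEMeasurable.tsum fun j => hF i (σ (j + enc i))) hsum
  filter_upwards [hae] with a ha
  have := ENNReal.tendsto_atTop_zero_of_tsum_ne_top ha.ne
  exact (tendsto_add_atTop_iff_nat (enc i)).1 this

/-! ### Vanishing of almost nonnegative sources -/

/-- `χ` is the primitive of a bump around `t0` minus a bump located between `β` and `S`. The descent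
enters as `-b` with `b ≥ 0`, which is favourable when `χ'` is tested against a nonnegative function,
so only the ascent near `t0` matters. -/
theorem exists_time_test {S t0 α β r : ℝ} (ht0 : t0 ∈ Ioo 0 S) (hβS : β < S)
    (hαβ : α < β) (η : ContDiffBump (0 : ℝ)) (hr : η.rOut = r) (hr0 : r < t0) (hrα : t0 + r < α) :
    ∃ (χ b : ℝ → ℝ), IsTest (Ioo 0 S) χ ∧ (∀ t, 0 ≤ χ t ∧ χ t ≤ 1) ∧ (∀ t ∈ Ioo α β, χ t = 1) ∧
      (∀ t, 0 ≤ b t) ∧ ∀ t, deriv χ t = η.normed volume (t0 - t) - b t := by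
  set s := (β + S) / 2 with hs
  have hq : 0 < (S - β) / 4 := by linarith
  let B : ContDiffBump s := ⟨(S - β) / 8, (S - β) / 4, by linarith, by linarith⟩
  have hη0 : ∀ t, 0 ≤ η.normed volume (t0 - t) := fun t => η.nonneg_normed _
  have hB0 : ∀ t, 0 ≤ B.normed volume t := fun t => B.nonneg_normed _
  have hrpos : 0 < r := hr ▸ η.rOut_pos
  have ηz : ∀ t, t ∉ Icc (t0 - r) (t0 + r) → η.normed volume (t0 - t) = 0 := by
    intro t ht
    have : t0 - t ∉ Function.support (η.normed volume) := by
      rw [η.support_normed_eq, Metric.mem_ball, hr, Real.dist_eq, sub_zero]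
      intro h
      rw [abs_lt] at h
      exact ht ⟨by linarith [h.2], by linarith [h.1]⟩
    exact Function.notMem_support.1 this
  have Bz : ∀ t, t ∉ Icc (s - (S - β) / 4) (s + (S - β) / 4) → B.normed volume t = 0 := by
    intro t ht
    have : t ∉ Function.support (B.normed volume) := by
      rw [B.support_normed_eq, Metric.mem_ball, Real.dist_eq]
      intro h
      have h : |t - s| < (S - β) / 4 := h
      rw [abs_lt] at h
      exact ht ⟨by linarith [h.1], by linarith [h.2]⟩
    exact Function.notMem_support.1 this
  have ηc : ContDiff ℝ ∞ (fun t => η.normed volume (t0 - t)) :=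
    η.contDiff_normed.comp (contDiff_const.sub contDiff_id)
  have Bc : ContDiff ℝ ∞ (B.normed volume) := B.contDiff_normed
  have ηi : ∫ t, η.normed volume (t0 - t) = 1 := by
    rw [integral_sub_left_eq_self (fun t => η.normed volume t)]; exact η.integral_normed
  have Bi : ∫ t, B.normed volume t = 1 := B.integral_normed
  have hkey : ∀ (k : ℝ → ℝ) (p q : ℝ), (∀ t, 0 ≤ k t) → Continuous k → 0 < p →
      (∀ t, t ∉ Icc p q → k t = 0) → ∫ t, k t = 1 →
      (∀ t, 0 ≤ ∫ z in (0 : ℝ)..t, k z ∧ ∫ z in (0 : ℝ)..t, k z ≤ 1) ∧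
      (∀ t, t ≤ p → ∫ z in (0 : ℝ)..t, k z = 0) ∧ (∀ t, q ≤ t → 0 ≤ t → ∫ z in (0 : ℝ)..t, k z = 1) := by
    intro k p q hk hkc hp hz hi
    have hki : Integrable k := by
      refine hkc.integrable_of_hasCompactSupport (HasCompactSupport.of_support_subset_isCompact
        (isCompact_Icc (a := p) (b := q)) fun t ht => ?_)
      by_contra h; exact ht (hz t h)
    have h1 : ∀ t, t ≤ p → ∫ z in (0 : ℝ)..t, k z = 0 := by
      intro t ht
      rcases eq_or_lt_of_le ht with rfl | ht
      · rw [intervalIntegral.integral_of_le hp.le, ← setIntegral_congr_set (Ioo_ae_eq_Ioc),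
          setIntegral_congr_fun (g := fun _ => 0) measurableSet_Ioo fun z hz' =>
            hz z fun h => absurd h.1 (not_le.2 hz'.2)]
        simp
      · rw [intervalIntegral.integral_congr (g := fun _ => 0)]
        · simp
        · intro z hz'
          refine hz z fun h => ?_
          rw [mem_uIcc] at hz'
          rcases hz' with h' | h' <;> linarith [h.1]
    have h2 : ∀ t, q ≤ t → 0 ≤ t → ∫ z in (0 : ℝ)..t, k z = 1 := by
      intro t ht ht0
      rw [intervalIntegral.integral_of_le ht0, setIntegral_eq_integral_of_forall_compl_eq_zero, hi]
      intro z hz'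
      exact hz z fun h => hz' ⟨hp.trans_le h.1, h.2.trans ht⟩
    refine ⟨fun t => ?_, h1, h2⟩
    rcases le_total t p with h | h
    · rw [h1 t h]; simp
    · have ht : 0 ≤ t := hp.le.trans h
      refine ⟨intervalIntegral.integral_nonneg ht fun z _ => hk z, ?_⟩
      rw [intervalIntegral.integral_of_le ht, ← hi]
      exact setIntegral_le_integral hki (Eventually.of_forall hk)
  obtain ⟨a1, a2, a3⟩ := hkey _ (t0 - r) (t0 + r) hη0 ηc.continuous (by linarith) ηz ηi
  obtain ⟨b1, b2, b3⟩ := hkey _ (s - (S - β) / 4) (s + (S - β) / 4) hB0 Bc.continuous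
    (by linarith [ht0.1]) Bz Bi
  have hθ : IsTest (Ioo 0 S) (fun t => η.normed volume (t0 - t) - B.normed volume t) := by
    have hsub : tsupport (fun t => η.normed volume (t0 - t) - B.normed volume t)
        ⊆ Icc (t0 - r) (s + (S - β) / 4) := by
      refine closure_minimal (fun t ht => ?_) isClosed_Icc
      by_contra h
      apply ht
      change η.normed volume (t0 - t) - B.normed volume t = 0
      rw [ηz t fun h' => h ⟨h'.1, by linarith [h'.2]⟩,
        Bz t fun h' => h ⟨by linarith [h'.1], h'.2⟩, sub_zero]
    exact ⟨ηc.sub Bc, isCompact_Icc.of_isClosed_subset (isClosed_tsupport _) hsub,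
      hsub.trans fun t ht => ⟨by linarith [ht.1], by linarith [ht.2]⟩⟩
  have ii : ∀ x y : ℝ, IntervalIntegrable (fun t => η.normed volume (t0 - t)) volume x y :=
    fun x y => ηc.continuous.intervalIntegrable x y
  have ij : ∀ x y : ℝ, IntervalIntegrable (B.normed volume) volume x y :=
    fun x y => Bc.continuous.intervalIntegrable x y
  have hint : ∀ (k : ℝ → ℝ), Continuous k → (∃ p q, ∀ t, t ∉ Icc p q → k t = 0) → Integrable k := by
    rintro k hk ⟨p, q, hz⟩
    refine hk.integrable_of_hasCompactSupport (HasCompactSupport.of_support_subset_isCompact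
        (isCompact_Icc (a := p) (b := q)) fun t ht => ?_)
    by_contra h; exact ht (hz t h)
  have h0 : ∫ t, (η.normed volume (t0 - t) - B.normed volume t) = 0 := by
    rw [integral_sub (hint _ ηc.continuous ⟨_, _, ηz⟩) (hint _ Bc.continuous ⟨_, _, Bz⟩), ηi, Bi,
      sub_self]
  obtain ⟨hχ, hχd⟩ := hθ.exists_primitive h0
  have hform : ∀ t, ∫ z in (0 : ℝ)..t, (η.normed volume (t0 - z) - B.normed volume z)
      = (∫ z in (0 : ℝ)..t, η.normed volume (t0 - z)) - ∫ z in (0 : ℝ)..t, B.normed volume z :=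
    fun t => intervalIntegral.integral_sub (ii 0 t) (ij 0 t)
  refine ⟨_, B.normed volume, hχ, fun t => ?_, fun t ht => ?_, hB0, fun t => by rw [hχd]⟩
  · rw [hform]
    refine ⟨?_, by linarith [(a1 t).2, (b1 t).1]⟩
    rcases le_total t (s - (S - β) / 4) with h | h
    · rw [b2 t h, sub_zero]; exact (a1 t).1
    · rw [a3 t (by linarith) (by linarith [ht0.1])]; linarith [(b1 t).2]
  · rw [hform, a3 t (by linarith [ht.1]) (by linarith [ht.1, ht0.1]), b2 t (by linarith [ht.2]),
      sub_zero]

/-- If `g k` is asymptotically nonnegative and `g k → -ν'` in the sense of distributions on `(0,S)`,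
where `ν ≥ 0`, then `g k → 0` in `L¹` after almost every zero of `ν`. -/
theorem ae_tendsto_zero_after_zero {S : ℝ} {g : ℕ → ℝ → ℝ} {ν : ℝ → ℝ}
    (hg : ∀ k, IntegrableOn (g k) (Ioo 0 S))
    (hneg : Tendsto (fun k => ∫⁻ t in Ioo 0 S, ENNReal.ofReal (-g k t)) atTop (𝓝 0))
    (hν : IntegrableOn ν (Ioo 0 S)) (hν0 : ∀ᵐ t, t ∈ Ioo 0 S → 0 ≤ ν t)
    (hlim : ∀ χ : ℝ → ℝ, IsTest (Ioo 0 S) χ →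
      Tendsto (fun k => ∫ t in Ioo 0 S, χ t * g k t) atTop (𝓝 (∫ t in Ioo 0 S, deriv χ t * ν t))) :
    ∀ᵐ t0, t0 ∈ Ioo 0 S → ν t0 = 0 → ∀ α β, t0 < α → α < β → β < S →
      Tendsto (fun k => ∫⁻ t in Ioo α β, ENNReal.ofReal |g k t|) atTop (𝓝 0) := by
  set ν' : ℝ → ℝ := (Ioo 0 S).indicator ν
  have hν' : Integrable ν' := (integrable_indicator_iff measurableSet_Ioo).2 hν
  let η : ℕ → ContDiffBump (0 : ℝ) := fun i =>
    ⟨1 / ((i : ℝ) + 1) / 2, 1 / ((i : ℝ) + 1), by positivity, by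
      have : 0 < 1 / ((i : ℝ) + 1) := by positivity
      linarith⟩
  have hη0 : Tendsto (fun i => (η i).rOut) atTop (𝓝 0) :=
    tendsto_one_div_add_atTop_nhds_zero_nat
  -- Mollifications converge almost everywhere, so at almost every zero of `ν` the means of `ν`
  -- against shrinking bumps tend to zero.
  have hconv := ContDiffBump.ae_convolution_tendsto_right_of_locallyIntegrable (μ := volume)
    (φ := η) (K := 2) hη0 (Eventually.of_forall fun i => by
      change 1 / ((i : ℝ) + 1) ≤ 2 * (1 / ((i : ℝ) + 1) / 2); linarith) hν'.locallyIntegrable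
  filter_upwards [hconv] with t0 hc ht0 hz α β hα hαβ hβS
  have hz' : ν' t0 = 0 := by simp only [ν']; rw [indicator_of_mem ht0, hz]
  rw [hz'] at hc
  have hce : ∀ i, (MeasureTheory.convolution ((η i).normed volume) ν'
      (ContinuousLinearMap.lsmul ℝ ℝ) volume) t0
      = ∫ t in Ioo 0 S, (η i).normed volume (t0 - t) * ν t := by
    intro i
    rw [convolution_eq_swap, ← integral_indicator measurableSet_Ioo]
    congr 1; ext t
    by_cases ht : t ∈ Ioo 0 S
    · simp [ν', ht]
    · simp [ν', ht]
  simp only [hce] at hc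
  rw [ENNReal.tendsto_nhds_zero]
  intro e he
  obtain ⟨e', he'0, he'e⟩ : ∃ e' : ℝ, 0 < e' ∧ ENNReal.ofReal e' ≤ e := by
    rcases eq_or_ne e ⊤ with rfl | h
    · exact ⟨1, one_pos, le_top⟩
    · exact ⟨e.toReal, ENNReal.toReal_pos he.ne' h, by rw [ENNReal.ofReal_toReal h]⟩
  obtain ⟨i, hi1, hi2, hi3⟩ := ((hc.eventually_lt_const (half_pos he'0)).and
    ((hη0.eventually_lt_const ht0.1).and
      (hη0.eventually_lt_const (show 0 < α - t0 by linarith)))).exists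
  obtain ⟨χ, b, hχ, hχ01, hχ1, hb0, hχd⟩ := exists_time_test ht0 hβS hαβ (η i) rfl hi2
    (by linarith)
  have hχc : Continuous χ := hχ.1.continuous
  have hχd' : Continuous (deriv χ) := hχ.1.continuous_deriv (by simp)
  have hbound : ∀ {k : ℝ → ℝ} {h : ℝ → ℝ}, Continuous k → IntegrableOn h (Ioo 0 S) →
      IntegrableOn (fun t => k t * h t) (Ioo 0 S) := by
    intro k h hk hh
    obtain ⟨C, -, hC⟩ := ContDiff.exists_abs_bound (a := 0) (b := S) hk.continuousOn
    refine Integrable.bdd_mul (c := C) hh hk.aestronglyMeasurable ?_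
    exact (ae_restrict_iff' measurableSet_Ioo).2 (Eventually.of_forall fun x hx =>
      hC x (Ioo_subset_Icc_self hx))
  -- Since `ν ≥ 0`, the descending part of `χ` may be dropped, and what remains is the mollification
  -- of `ν` at `t0`.
  have hle : ∫ t in Ioo 0 S, deriv χ t * ν t < e' / 2 := by
    refine lt_of_le_of_lt ?_ hi1
    have hηc : Continuous (fun t => (η i).normed volume (t0 - t)) :=
      (η i).continuous_normed.comp (by fun_prop)
    refine integral_mono_ae (hbound hχd' hν) (hbound hηc hν) ?_
    refine (ae_restrict_iff' measurableSet_Ioo).2 ?_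
    filter_upwards [hν0] with t ht htS
    rw [hχd]
    exact mul_le_mul_of_nonneg_right (by linarith [hb0 t]) (ht htS)
  have hnr : Tendsto (fun k => ∫ t in Ioo 0 S, max (-g k t) 0) atTop (𝓝 0) := by
    have h1 := (ENNReal.tendsto_toReal ENNReal.zero_ne_top).comp hneg
    refine h1.congr fun k => ?_
    have hm : AEStronglyMeasurable (fun t => max (-g k t) 0) (volume.restrict (Ioo 0 S)) :=
      (hg k).neg.aestronglyMeasurable.sup aestronglyMeasurable_const
    rw [Function.comp_apply, integral_eq_lintegral_of_nonneg_ae (f := fun t => max (-g k t) 0)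
      (Eventually.of_forall fun t => le_max_right _ _) hm]
    congr 1
    refine lintegral_congr fun t => ?_
    rcases le_total 0 (-g k t) with h | h
    · rw [max_eq_left h]
    · rw [max_eq_right h, ENNReal.ofReal_of_nonpos h, ENNReal.ofReal_zero]
  filter_upwards [(hlim χ hχ).eventually_lt_const hle,
    hnr.eventually_lt_const (show 0 < e' / 4 by linarith)] with k hk1 hk2
  have hsub : Ioo α β ⊆ Ioo 0 S := Ioo_subset_Ioo (by linarith [ht0.1]) hβS.le
  have i1 := hbound hχc (hg k)
  have i2 : IntegrableOn (fun t => max (-g k t) 0) (Ioo 0 S) := (hg k).neg.sup (integrable_zero _ _ _)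
  have i3 : IntegrableOn (fun t => χ t * g k t + 2 * max (-g k t) 0) (Ioo 0 S) :=
    i1.add (i2.const_mul 2)
  -- This function is nonnegative because `0 ≤ χ ≤ 1`, and it dominates `|g k|` where `χ = 1`; the
  -- negative part of `g k` is negligible in the limit.
  have hnn : ∀ t, 0 ≤ χ t * g k t + 2 * max (-g k t) 0 := fun t => by
    rcases le_total 0 (g k t) with h | h
    · have := mul_nonneg (hχ01 t).1 h
      have := le_max_right (-g k t) 0
      linarith
    · rw [max_eq_left (by linarith)]
      nlinarith [(hχ01 t).1, (hχ01 t).2]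
  refine le_trans ?_ he'e
  calc ∫⁻ t in Ioo α β, ENNReal.ofReal |g k t|
      ≤ ∫⁻ t in Ioo α β, ENNReal.ofReal (χ t * g k t + 2 * max (-g k t) 0) := by
        refine setLIntegral_mono' measurableSet_Ioo fun t ht => ENNReal.ofReal_le_ofReal ?_
        rw [hχ1 t ht, one_mul]
        rcases le_total 0 (g k t) with h | h
        · rw [abs_of_nonneg h]; linarith [le_max_right (-g k t) 0]
        · rw [abs_of_nonpos h]; linarith [le_max_left (-g k t) 0]
    _ ≤ ∫⁻ t in Ioo 0 S, ENNReal.ofReal (χ t * g k t + 2 * max (-g k t) 0) :=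
        lintegral_mono_set hsub
    _ = ENNReal.ofReal (∫ t in Ioo 0 S, (χ t * g k t + 2 * max (-g k t) 0)) :=
        (ofReal_integral_eq_lintegral_ofReal i3 (Eventually.of_forall hnn)).symm
    _ ≤ ENNReal.ofReal e' := by
        refine ENNReal.ofReal_le_ofReal ?_
        rw [integral_add i1 (i2.const_mul 2), integral_const_mul]
        linarith

/-! ### Duality with `W^{-1,1}` -/

/-- Divided by a common bound for itself and its derivative, a test function is admissible in the
dual norm. -/
theorem ofReal_abs_integral_le_normWneg {L R : ℝ} {φ : ℝ → ℝ} (hφ : IsTest (Ioo L R) φ) :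
    ∃ C : ℝ, 0 < C ∧ ∀ f : ℝ → ℝ,
      ENNReal.ofReal |∫ x in Ioo L R, f x * φ x| ≤ ENNReal.ofReal C * normWneg L R f := by
  obtain ⟨C1, hC1⟩ := hφ.2.1.exists_bound_of_continuous hφ.1.continuous
  obtain ⟨C2, hC2⟩ := hφ.2.1.deriv.exists_bound_of_continuous
    (hφ.1.continuous_deriv (by simp))
  set C := max (max C1 C2) 1 with hC
  have hC0 : 0 < C := lt_of_lt_of_le one_pos (le_max_right _ _)
  refine ⟨C, hC0, fun f => ?_⟩
  have hle : ∀ {y K : ℝ}, |y| ≤ K → K ≤ C → |C⁻¹ * y| ≤ 1 := by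
    intro y K h1 h2
    rw [abs_mul, abs_of_pos (inv_pos.2 hC0), inv_mul_le_iff₀ hC0, mul_one]
    exact h1.trans h2
  have ht : IsTest (Ioo L R) (fun x => C⁻¹ * φ x) :=
    ⟨contDiff_const.mul hφ.1, hφ.2.1.mul_left, (tsupport_mul_subset_right).trans hφ.2.2⟩
  have hd : ∀ x, deriv (fun x => C⁻¹ * φ x) x = C⁻¹ * deriv φ x := fun x => by
    rw [deriv_const_mul_field]
  have hsup : ENNReal.ofReal |∫ x in Ioo L R, f x * (C⁻¹ * φ x)| ≤ normWneg L R f :=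
    le_iSup_of_le _ (le_iSup_of_le ht (le_iSup_of_le
      (fun x => hle (hC1 x) ((le_max_left _ _).trans (le_max_left _ _)))
      (le_iSup_of_le (fun x => by
        rw [hd]; exact hle (hC2 x) ((le_max_right _ _).trans (le_max_left _ _))) le_rfl)))
  calc ENNReal.ofReal |∫ x in Ioo L R, f x * φ x|
      = ENNReal.ofReal C * ENNReal.ofReal |∫ x in Ioo L R, f x * (C⁻¹ * φ x)| := by
        rw [← ENNReal.ofReal_mul hC0.le, ← abs_of_pos hC0, ← abs_mul, abs_of_pos hC0,
          ← integral_const_mul]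
        congr 2
        refine integral_congr_ae (Eventually.of_forall fun x => ?_)
        field_simp
    _ ≤ _ := by gcongr

theorem ennreal_le_add_rpow {p : ℝ} (hp : 1 ≤ p) (N : ℝ≥0∞) {η : ℝ≥0∞} (h0 : η ≠ 0)
    (ht : η ≠ ⊤) : N ≤ η + η * (η⁻¹) ^ p * N ^ p := by
  rcases le_total N η with h | h
  · exact h.trans le_self_add
  · refine le_trans ?_ le_add_self
    have h1 : 1 ≤ η⁻¹ * N := by
      rw [← ENNReal.inv_mul_cancel h0 ht]; gcongr
    have h2 := ENNReal.rpow_le_rpow_of_exponent_le h1 hp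
    rw [ENNReal.rpow_one, ENNReal.mul_rpow_of_nonneg _ _ (zero_le_one.trans hp)] at h2
    calc N = η * (η⁻¹ * N) := by rw [← mul_assoc, ENNReal.mul_inv_cancel h0 ht, one_mul]
      _ ≤ η * ((η⁻¹) ^ p * N ^ p) := by gcongr
      _ = _ := by rw [mul_assoc]

/-- The inequality `N ≤ η + η^(1-p) N^p` replaces that of Hölder and needs no measurability of `N
k`; in the application `N k` is a supremum over an uncountable family of test functions. -/
theorem tendsto_lintegral_of_rpow {α : Type*} [MeasurableSpace α] {μ : Measure α}
    [IsFiniteMeasure μ] {p : ℝ} (hp : 1 ≤ p) {N : ℕ → α → ℝ≥0∞}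
    (h : Tendsto (fun k => ∫⁻ a, N k a ^ p ∂μ) atTop (𝓝 0)) :
    Tendsto (fun k => ∫⁻ a, N k a ∂μ) atTop (𝓝 0) := by
  have hη0 : ∀ j : ℕ, ENNReal.ofReal (1 / ((j : ℝ) + 1)) ≠ 0 := fun j => by
    rw [ne_eq, ENNReal.ofReal_eq_zero, not_le]; positivity
  refine ennreal_tendsto_zero_of_forall_le h
    (b := fun j => ENNReal.ofReal ((μ univ).toReal * (1 / ((j : ℝ) + 1))))
    (c := fun j => ENNReal.ofReal (1 / ((j : ℝ) + 1)) * (ENNReal.ofReal (1 / ((j : ℝ) + 1)))⁻¹ ^ p)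
    (tendsto_ofReal_mul_one_div _) (fun j => ?_) fun j k => ?_
  · refine ENNReal.mul_ne_top ENNReal.ofReal_ne_top (ENNReal.rpow_ne_top_of_nonneg
      (zero_le_one.trans hp) (ENNReal.inv_ne_top.2 (hη0 j)))
  · refine (lintegral_mono fun a => ennreal_le_add_rpow hp (N k a) (hη0 j)
      ENNReal.ofReal_ne_top).trans ?_
    rw [lintegral_add_left measurable_const, lintegral_const, lintegral_const_mul',
      ENNReal.ofReal_mul ENNReal.toReal_nonneg, ENNReal.ofReal_toReal (measure_ne_top _ _),
      mul_comm (μ univ)]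
    exact ENNReal.mul_ne_top ENNReal.ofReal_ne_top (ENNReal.rpow_ne_top_of_nonneg
      (zero_le_one.trans hp) (ENNReal.inv_ne_top.2 (hη0 j)))

/-! ### The source term and the mean values of the density -/

/-- The source `T` of the equation for `ρ`, tested against `φ`. -/
noncomputable def source (L R : ℝ) (u u1 u3 : ℝ → ℝ → ℝ) (φ : ℝ → ℝ) (t : ℝ) : ℝ :=
  ∫ x in Ioo L R, -(u t x * u1 t x * u3 t x) * φ x

namespace IsSolutionWith

variable {L R n ε : ℝ} {u₀ : ℝ → ℝ} {u u1 u2 u3 : ℝ → ℝ → ℝ}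

/-- `u u_xxx` and `u_x` are both square integrable on bounded time intervals, the latter by the
energy bound. -/
theorem integrableOn_source (h : IsSolutionWith L R n ε u₀ u u1 u2 u3) {E : ℝ}
    (hE : ∀ t, 0 < t → IntegrableOn (fun x => u1 t x ^ 2) (Ioo L R) ∧
      ∫ x in Ioo L R, u1 t x ^ 2 ≤ E) {S : ℝ} (hS : 0 < S) {φ : ℝ → ℝ} (hφ : Continuous φ) :
    IntegrableOn (source L R u u1 u3 φ) (Ioo 0 S) := by
  have hm := h.memLp S hS
  rw [restrict_prod_eq] at hm
  have hle : (volume.restrict (Ioo 0 S)).prod (volume.restrict (Ioo L R))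
      ≤ (volume.restrict (Ioi 0)).prod (volume.restrict (Ioo L R)) := by
    rw [← restrict_prod_eq, ← restrict_prod_eq]
    exact Measure.restrict_mono_set _ (prod_mono Ioo_subset_Ioi_self subset_rfl)
  have ha1 := h.aesm1.mono_measure hle
  have hm1 : MemLp (fun q : ℝ × ℝ => u1 q.1 q.2) 2
      ((volume.restrict (Ioo 0 S)).prod (volume.restrict (Ioo L R))) := by
    refine (memLp_two_iff_integrable_sq ha1).2 ⟨ha1.pow 2, ?_⟩
    have hsm : AEMeasurable (fun q => ENNReal.ofReal (Function.uncurry u1 q ^ 2))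
        ((volume.restrict (Ioo 0 S)).prod (volume.restrict (Ioo L R))) :=
      (ha1.pow 2).aemeasurable.ennreal_ofReal
    rw [hasFiniteIntegral_iff_ofReal (Eventually.of_forall fun q => sq_nonneg _),
      lintegral_prod _ hsm]
    refine lt_of_le_of_lt (setLIntegral_mono' (g := fun _ => ENNReal.ofReal E)
      measurableSet_Ioo fun t ht => ?_) ?_
    · obtain ⟨h1, h2⟩ := hE t ht.1
      have := ofReal_integral_eq_lintegral_ofReal h1 (Eventually.of_forall fun x => sq_nonneg _)
      exact (le_of_eq this.symm).trans (ENNReal.ofReal_le_ofReal h2)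
    · rw [setLIntegral_const]
      exact ENNReal.mul_lt_top ENNReal.ofReal_lt_top (by simp)
  have hp := (hm.integrable_mul hm1)
  obtain ⟨C, -, hC⟩ := ContDiff.exists_abs_bound (a := L) (b := R) hφ.continuousOn
  have hφm : AEStronglyMeasurable (fun q : ℝ × ℝ => φ q.2)
      ((volume.restrict (Ioo 0 S)).prod (volume.restrict (Ioo L R))) :=
    (hφ.comp continuous_snd).aestronglyMeasurable
  have hb : ∀ᵐ q ∂((volume.restrict (Ioo 0 S)).prod (volume.restrict (Ioo L R))),
      ‖φ q.2‖ ≤ C := by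
    rw [← restrict_prod_eq]
    exact (ae_restrict_iff' (measurableSet_Ioo.prod measurableSet_Ioo)).2
      (Eventually.of_forall fun q hq => hC q.2 (Ioo_subset_Icc_self hq.2))
  have hp2 := (hp.neg.bdd_mul hφm hb).integral_prod_left
  refine hp2.congr (Eventually.of_forall fun t => ?_)
  refine integral_congr_ae (Eventually.of_forall fun x => ?_)
  simp only [Pi.neg_apply, Pi.mul_apply]
  ring

/-- The level-set term of the lower bound is nonnegative and is dropped. What remains shows that the
negative part of the source vanishes when first `ε → 0` and then `δ → 0`. -/
theorem lintegral_neg_source_le (hε : ε ∈ Ioo (0 : ℝ) 1) {E : ℝ} (hE0 : 0 ≤ E)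
    (hE : ∀ t, 0 < t → ∫ x in Ioo L R, u1 t x ^ 2 ≤ E)
    (hs : ∀ᵐ t : ℝ, 0 < t → Slice L R (u t) (u1 t) (u3 t) ∧ diss L R n ε u u3 t < ⊤)
    {ψ : ℝ → ℝ} {C : ℝ} (hC0 : 0 < C)
    (hC : ∀ {f f1 f3 : ℝ → ℝ}, Slice L R f f1 f3 → ∀ δ, 0 < δ →
      IntegrableOn (fun x => f x ^ 3 * f3 x ^ 2) (Ioo L R) →
      (1 / 3) * (∫ x in Ioo L R, deriv (step δ) (f x) * f1 x ^ 4 * ψ x ^ 2)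
        - C * (δ * (∫ x in Ioo L R, f1 x ^ 2) + (∫ x in Ioo L R, f x ^ 3 * f3 x ^ 2) / δ ^ 2)
      ≤ ∫ x in Ioo L R, -(f x * f1 x * f3 x) * ψ x ^ 2) {S δ : ℝ} (hδ : 0 < δ) :
    ∫⁻ t in Ioo 0 S, ENNReal.ofReal (-source L R u u1 u3 (fun x => ψ x ^ 2) t)
      ≤ ENNReal.ofReal (C * E * S * δ)
        + ENNReal.ofReal (C / δ ^ 2) * ∫⁻ t in Ioo 0 S, diss L R n ε u u3 t := by
  have hCE : 0 ≤ C * E * δ := by positivity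
  have hpt : ∀ᵐ t ∂(volume.restrict (Ioo 0 S)),
      ENNReal.ofReal (-source L R u u1 u3 (fun x => ψ x ^ 2) t)
        ≤ ENNReal.ofReal (C * E * δ) + ENNReal.ofReal (C / δ ^ 2) * diss L R n ε u u3 t := by
    refine (ae_restrict_iff' measurableSet_Ioo).2 ?_
    filter_upwards [hs] with t hst ht
    obtain ⟨hsl, hd⟩ := hst ht.1
    obtain ⟨hi, hdi⟩ := integrable_dissipation hε hsl hd
    have h1 := hC hsl δ hδ hi
    have h2 : 0 ≤ ∫ x in Ioo L R, deriv (step δ) (u t x) * u1 t x ^ 4 * ψ x ^ 2 :=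
      integral_nonneg fun x =>
        mul_nonneg (mul_nonneg (deriv_step_nonneg hδ _) (by positivity)) (sq_nonneg _)
    have h3 : -source L R u u1 u3 (fun x => ψ x ^ 2) t
        ≤ C * E * δ + C / δ ^ 2 * ∫ x in Ioo L R, u t x ^ 3 * u3 t x ^ 2 := by
      have h4 := mul_le_mul_of_nonneg_left (hE t ht.1) (mul_nonneg hC0.le hδ.le)
      have e : C * (δ * (∫ x in Ioo L R, u1 t x ^ 2)
          + (∫ x in Ioo L R, u t x ^ 3 * u3 t x ^ 2) / δ ^ 2)
          = C * δ * (∫ x in Ioo L R, u1 t x ^ 2)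
            + C / δ ^ 2 * ∫ x in Ioo L R, u t x ^ 3 * u3 t x ^ 2 := by ring
      rw [e] at h1
      unfold source
      linarith
    refine (ENNReal.ofReal_le_ofReal h3).trans (ENNReal.ofReal_add_le.trans ?_)
    rw [ENNReal.ofReal_mul (by positivity : 0 ≤ C / δ ^ 2)]
    gcongr
  refine (lintegral_mono_ae hpt).trans ?_
  rw [lintegral_add_left measurable_const, lintegral_const_mul' _ _ ENNReal.ofReal_ne_top,
    lintegral_const, Measure.restrict_apply_univ, Real.volume_Ioo, sub_zero,
    ← ENNReal.ofReal_mul hCE]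
  exact add_le_add (ENNReal.ofReal_le_ofReal (le_of_eq (by ring))) le_rfl

theorem integrable_Beps_mul (hn : n ∈ Ioo (0 : ℝ) 3) (hε : ε ∈ Ioo (0 : ℝ) 1)
    (h : IsSolutionWith L R n ε u₀ u u1 u2 u3) {M : ℝ}
    (hM : ∀ t, 0 < t → ∀ x ∈ Icc L R, u t x ≤ M) {S : ℝ} {φ : ℝ → ℝ} (hφ : Continuous φ) :
    Integrable (fun q : ℝ × ℝ => Beps n ε (u q.1 q.2) * φ q.2)
      ((volume.restrict (Ioo 0 S)).prod (volume.restrict (Ioo L R))) := by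
  obtain ⟨C, hC0, hC⟩ := ContDiff.exists_abs_bound (a := L) (b := R) hφ.continuousOn
  rw [← restrict_prod_eq]
  have hc : ContinuousOn (fun q : ℝ × ℝ => Beps n ε (u q.1 q.2) * φ q.2)
      (Ioo 0 S ×ˢ Ioo L R) :=
    ((continuousOn_Beps hn hε).comp (h.cont.mono (prod_mono
      (fun t ht => ht.1.le) Ioo_subset_Icc_self))
      fun q hq => h.nonneg _ hq.1.1.le _ (Ioo_subset_Icc_self hq.2)).mul
      (hφ.comp continuous_snd).continuousOn
  have hmeas : MeasurableSet (Ioo 0 S ×ˢ Ioo L R) := measurableSet_Ioo.prod measurableSet_Ioo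
  have : IsFiniteMeasure (volume.restrict (Ioo 0 S ×ˢ Ioo L R)) := by
    rw [restrict_prod_eq]; infer_instance
  refine Integrable.of_bound (hc.aestronglyMeasurable hmeas) (Beps n ε M * C) ?_
  refine (ae_restrict_iff' hmeas).2 (Eventually.of_forall fun q hq => ?_)
  have hx := Ioo_subset_Icc_self hq.2
  have h0 := h.nonneg _ hq.1.1.le _ hx
  have hM' := hM _ hq.1.1 _ hx
  rw [Real.norm_eq_abs, abs_mul, abs_of_nonneg (Beps_nonneg hε h0)]
  exact mul_le_mul (monotoneOn_Beps hn hε h0 (h0.trans hM') hM') (hC _ hx) (abs_nonneg _)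
    (Beps_nonneg hε (h0.trans hM'))

/-- The time-dependent mean values of `B^ε(u)` satisfy `m' = g` up to an error controlled by the
dissipation. -/
theorem enorm_source_add_le (hn : n ∈ Ioo (0 : ℝ) 3) (hε : ε ∈ Ioo (0 : ℝ) 1)
    (h : IsSolutionWith L R n ε u₀ u u1 u2 u3) {M : ℝ}
    (hM : ∀ t, 0 < t → ∀ x ∈ Icc L R, u t x ≤ M) {S : ℝ} {χ φ : ℝ → ℝ} (hχ : IsTest (Ioo 0 S) χ)
    (hφ : IsTest (Ioo L R) φ) {C : ℝ} (hC0 : 0 ≤ C) (hC : ∀ t x, |χ t * deriv φ x| ≤ C) {κ : ℝ}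
    (hκ : 0 < κ) :
    ‖(∫ t in Ioo 0 S, χ t * source L R u u1 u3 φ t)
        + ∫ t in Ioo 0 S, deriv χ t * ∫ x in Ioo L R, Beps n ε (u t x) * φ x‖ₑ
      ≤ ENNReal.ofReal (C * ((9 / n ^ 2 + 1) * (1 + M)) * (R - L) * S * κ)
        + ENNReal.ofReal (C / κ) * ∫⁻ t in Ioo 0 S, diss L R n ε u u3 t := by
  set K := (9 / n ^ 2 + 1) * (1 + M) with hK
  have hΦ : IsTest (Ioi 0 ×ˢ Ioo L R) (fun q : ℝ × ℝ => χ q.1 * φ q.2) := by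
    have hsub : tsupport (fun q : ℝ × ℝ => χ q.1 * φ q.2) ⊆ tsupport χ ×ˢ tsupport φ := by
      refine closure_minimal (fun q hq => ?_)
        ((isClosed_tsupport _).prod (isClosed_tsupport _))
      exact ⟨subset_tsupport _ (left_ne_zero_of_mul hq), subset_tsupport _ (right_ne_zero_of_mul hq)⟩
    refine ⟨(hχ.1.comp contDiff_fst).mul (hφ.1.comp contDiff_snd), ?_,
      hsub.trans (prod_mono (hχ.2.2.trans Ioo_subset_Ioi_self) hφ.2.2)⟩
    exact (hχ.2.1.isCompact.prod hφ.2.1.isCompact).of_isClosed_subset (isClosed_tsupport _) hsub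
  have hχ0 : ∀ t, t ∉ Ioo 0 S → χ t = 0 := fun t ht =>
    image_eq_zero_of_notMem_tsupport fun h => ht (hχ.2.2 h)
  have hχ0' : ∀ t, t ∉ Ioo 0 S → deriv χ t = 0 := fun t ht =>
    image_eq_zero_of_notMem_tsupport fun h => ht (hχ.2.2 (tsupport_deriv_subset h))
  have hred : ∀ F : ℝ → ℝ, (∀ t, t ∉ Ioo 0 S → F t = 0) →
      ∫ t in Ioi (0 : ℝ), F t = ∫ t in Ioo 0 S, F t := fun F hF => by
    rw [setIntegral_eq_integral_of_forall_compl_eq_zero (s := Ioi 0)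
        fun t ht => hF t fun h' => ht h'.1,
      setIntegral_eq_integral_of_forall_compl_eq_zero hF]
  have e := h.rho_eq _ hΦ
  have d1 : ∀ t x, deriv (fun s => χ s * φ x) t = deriv χ t * φ x := fun t x => by
    rw [deriv_mul_const_field]
  have d2 : ∀ t x, deriv (fun y => χ t * φ y) x = χ t * deriv φ x := fun t x => by
    rw [deriv_const_mul_field]
  simp only [d1, d2] at e
  rw [hred _ fun t ht => by simp [hχ0' t ht], hred _ fun t ht => by simp [hχ0 t ht],
    hred _ fun t ht => by simp [hχ0 t ht]] at e
  have e1 : ∫ t in Ioo 0 S, χ t * source L R u u1 u3 φ t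
      = ∫ t in Ioo 0 S, ∫ x in Ioo L R, -(u t x * u1 t x * u3 t x) * (χ t * φ x) := by
    congr 1; ext t
    rw [source, ← integral_const_mul]
    congr 1; ext x; ring
  have e2 : ∫ t in Ioo 0 S, deriv χ t * ∫ x in Ioo L R, Beps n ε (u t x) * φ x
      = ∫ t in Ioo 0 S, ∫ x in Ioo L R, Beps n ε (u t x) * (deriv χ t * φ x) := by
    congr 1; ext t
    rw [← integral_const_mul]
    congr 1; ext x; ring
  rw [e1, e2]
  rw [show ∀ a b c : ℝ, -a = b - c → b + a = c from fun a b c habc => by linarith]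
  rotate_left 2
  · exact e
  -- After insertion of the equation for `ρ` only the flux term is left. Young's inequality with
  -- weight `κ`, together with `flux_coeff_sq_le`, bounds it by a multiple of `κ` plus the
  -- dissipation density over `κ`.
  have hpt : ∀ t ∈ Ioo 0 S, ∀ x ∈ Ioo L R,
      ‖-(|Real.log ε| * deriv (Beps n ε) (u t x) * mobility n ε (u t x) * u3 t x)
        * (χ t * deriv φ x)‖ₑ
      ≤ ENNReal.ofReal (C * K * κ)
        + ENNReal.ofReal (C / κ) * ENNReal.ofReal (mobility n ε (u t x) * u3 t x ^ 2) := by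
    intro t ht x hx
    have hx' := Ioo_subset_Icc_self hx
    have h0 := h.nonneg t ht.1.le x hx'
    have hmob : 0 ≤ mobility n ε (u t x) := (pow_nonneg h0 3).trans (pow_three_le_mobility hε h0)
    have hf := flux_coeff_sq_le hn hε h0
    set a := |Real.log ε| * deriv (Beps n ε) (u t x)
    set m := mobility n ε (u t x)
    have hfK : a ^ 2 * m ≤ K := hf.trans (by
      rw [hK]; gcongr; exact hM t ht.1 x hx')
    have hsq : |a * m * u3 t x| ≤ K * κ + m * u3 t x ^ 2 / κ := by
      rw [abs_mul, abs_mul, abs_of_nonneg hmob]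
      have h1 : 0 ≤ m / κ * (κ * |a| - |u3 t x|) ^ 2 := by positivity
      have h2 : m / κ * (κ * |a| - |u3 t x|) ^ 2
          = κ * (a ^ 2 * m) - 2 * (|a| * m * |u3 t x|) + m * u3 t x ^ 2 / κ := by
        rw [← sq_abs a, ← sq_abs (u3 t x)]; field_simp; ring
      have h3 : κ * (a ^ 2 * m) ≤ K * κ := by rw [mul_comm]; gcongr
      have h4 : 0 ≤ |a| * m * |u3 t x| := by positivity
      linarith
    rw [← ENNReal.ofReal_mul (by positivity), ← ENNReal.ofReal_add _ (by positivity),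
      ← ofReal_norm]
    · refine ENNReal.ofReal_le_ofReal ?_
      rw [norm_mul, norm_neg, Real.norm_eq_abs, Real.norm_eq_abs]
      calc |a * m * u3 t x| * |χ t * deriv φ x| ≤ (K * κ + m * u3 t x ^ 2 / κ) * C := by
            exact mul_le_mul hsq (hC t x) (abs_nonneg _) ((abs_nonneg _).trans hsq)
        _ = _ := by ring
    · have : 0 ≤ K := (mul_nonneg (sq_nonneg a) hmob).trans hfK
      positivity
  by_cases hS : S ≤ 0
  · rw [Ioo_eq_empty (not_lt.2 hS)]; simp
  push Not at hS
  by_cases hLR : R ≤ L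
  · simp [Ioo_eq_empty (not_lt.2 hLR)]
  push Not at hLR
  have hK0 : 0 ≤ C * K * κ := by
    have hx : (L + R) / 2 ∈ Icc L R := ⟨by linarith, by linarith⟩
    have := (h.nonneg 1 zero_le_one _ hx).trans (hM 1 one_pos _ hx)
    positivity
  calc ‖∫ t in Ioo 0 S, ∫ x in Ioo L R,
        -(|Real.log ε| * deriv (Beps n ε) (u t x) * mobility n ε (u t x) * u3 t x)
          * (χ t * deriv φ x)‖ₑ
      ≤ ∫⁻ t in Ioo 0 S, (ENNReal.ofReal (C * K * κ * (R - L))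
          + ENNReal.ofReal (C / κ) * diss L R n ε u u3 t) := by
        refine (enorm_integral_le_lintegral_enorm _).trans
          (setLIntegral_mono' measurableSet_Ioo fun t ht => ?_)
        refine (enorm_integral_le_lintegral_enorm _).trans
          ((setLIntegral_mono' measurableSet_Ioo (hpt t ht)).trans (le_of_eq ?_))
        rw [lintegral_add_left measurable_const, lintegral_const_mul' _ _ ENNReal.ofReal_ne_top,
          lintegral_const, Measure.restrict_apply_univ, Real.volume_Ioo, ← ENNReal.ofReal_mul hK0]
        rfl
    _ = _ := by
        rw [lintegral_add_left measurable_const, lintegral_const_mul' _ _ ENNReal.ofReal_ne_top,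
          lintegral_const, Measure.restrict_apply_univ, Real.volume_Ioo, sub_zero,
          ← ENNReal.ofReal_mul (mul_nonneg hK0 (by linarith))]
        congr 2
        ring

end IsSolutionWith

/-- The mean value `∫ f(t,x) φ(x) dx`. -/
noncomputable def mean (L R : ℝ) (f : ℝ → ℝ → ℝ) (φ : ℝ → ℝ) (t : ℝ) : ℝ :=
  ∫ x in Ioo L R, f t x * φ x

theorem integrableOn_mean {L R S : ℝ} {ρ : ℝ → ℝ → ℝ}
    (hρ : IntegrableOn (Function.uncurry ρ) (Ioo 0 S ×ˢ Ioo L R)) {φ : ℝ → ℝ} (hφ : Continuous φ) :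
    IntegrableOn (mean L R ρ φ) (Ioo 0 S) := by
  have hρ' : Integrable (Function.uncurry ρ)
      ((volume.restrict (Ioo 0 S)).prod (volume.restrict (Ioo L R))) := by
    rw [← restrict_prod_eq]; exact hρ
  obtain ⟨C, -, hC⟩ := ContDiff.exists_abs_bound (a := L) (b := R) hφ.continuousOn
  have hφm : AEStronglyMeasurable (fun q : ℝ × ℝ => φ q.2)
      ((volume.restrict (Ioo 0 S)).prod (volume.restrict (Ioo L R))) :=
    (hφ.comp continuous_snd).aestronglyMeasurable
  have hb : ∀ᵐ q ∂((volume.restrict (Ioo 0 S)).prod (volume.restrict (Ioo L R))),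
      ‖φ q.2‖ ≤ C := by
    rw [← restrict_prod_eq]
    exact (ae_restrict_iff' (measurableSet_Ioo.prod measurableSet_Ioo)).2
      (Eventually.of_forall fun q hq => hC q.2 (Ioo_subset_Icc_self hq.2))
  refine (hρ'.bdd_mul hφm hb).integral_prod_left.congr (Eventually.of_forall fun t => ?_)
  refine integral_congr_ae (Eventually.of_forall fun x => ?_)
  simp only [Function.uncurry]
  ring

/-- A sequence of solutions with parameters `ε k → 0`, with uniform energy bound `E`, sup bound `M`
and dissipation bound `K`. -/
structure SolutionSeq (L R n : ℝ) (u₀ : ℝ → ℝ) (ε : ℕ → ℝ) (U U1 U2 U3 : ℕ → ℝ → ℝ → ℝ)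
    (E M : ℝ) (K : ℝ≥0∞) : Prop where
  lt : L < R
  exponent : n ∈ Ioo (0 : ℝ) 3
  eps : ∀ k, ε k ∈ Ioo (0 : ℝ) 1
  lim : Tendsto ε atTop (𝓝 0)
  sol : ∀ k, IsSolutionWith L R n (ε k) u₀ (U k) (U1 k) (U2 k) (U3 k)
  mass : ∫ x in Ioo L R, u₀ x = 1
  E_nonneg : 0 ≤ E
  M_pos : 0 < M
  energy : ∀ k t, 0 < t → IntegrableOn (fun x => U1 k t x ^ 2) (Ioo L R) ∧
    ∫ x in Ioo L R, U1 k t x ^ 2 ≤ E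
  le_sup : ∀ k t, 0 < t → ∀ x ∈ Icc L R, U k t x ≤ M
  K_ne_top : K ≠ ⊤
  diss_le : ∀ k S, 0 < S → ENNReal.ofReal |Real.log (ε k)| *
    (∫⁻ t in Ioo 0 S, diss L R n (ε k) (U k) (U3 k) t) ≤ K
  slice : ∀ᵐ t : ℝ, 0 < t → ∀ k, Slice L R (U k t) (U1 k t) (U3 k t) ∧
    diss L R n (ε k) (U k) (U3 k) t < ⊤

namespace SolutionSeq

variable {L R n E M : ℝ} {u₀ : ℝ → ℝ} {ε : ℕ → ℝ} {U U1 U2 U3 : ℕ → ℝ → ℝ → ℝ} {K : ℝ≥0∞}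

theorem tendsto_diss (h : SolutionSeq L R n u₀ ε U U1 U2 U3 E M K) {S : ℝ} (hS : 0 < S) :
    Tendsto (fun k => ∫⁻ t in Ioo 0 S, diss L R n (ε k) (U k) (U3 k) t) atTop (𝓝 0) := by
  have h0 : Tendsto ε atTop (𝓝[>] 0) :=
    tendsto_nhdsWithin_iff.2 ⟨h.lim, Eventually.of_forall fun k => (h.eps k).1⟩
  have h1 : Tendsto (fun k => ENNReal.ofReal |Real.log (ε k)|) atTop (𝓝 ⊤) :=
    ENNReal.tendsto_ofReal_atTop.comp
      (tendsto_abs_atBot_atTop.comp (Real.tendsto_log_nhdsGT_zero.comp h0))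
  have h2 : Tendsto (fun k => K / ENNReal.ofReal |Real.log (ε k)|) atTop (𝓝 0) := by
    have := ENNReal.Tendsto.const_div (a := K) h1 (Or.inr h.K_ne_top)
    rwa [ENNReal.div_top] at this
  refine tendsto_of_tendsto_of_tendsto_of_le_of_le tendsto_const_nhds h2 (fun _ => zero_le)
    fun k => ?_
  rw [ENNReal.le_div_iff_mul_le (Or.inl _) (Or.inl ENNReal.ofReal_ne_top), mul_comm]
  · exact h.diss_le k S hS
  · rw [ne_eq, ENNReal.ofReal_eq_zero, not_le]; exact abs_log_pos (h.eps k)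

theorem integrableOn_mean_Beps (h : SolutionSeq L R n u₀ ε U U1 U2 U3 E M K) (k : ℕ) (S : ℝ)
    {φ : ℝ → ℝ} (hφ : Continuous φ) :
    IntegrableOn (mean L R (fun t x => Beps n (ε k) (U k t x)) φ) (Ioo 0 S) :=
  ((h.sol k).integrable_Beps_mul h.exponent (h.eps k) (h.le_sup k) (S := S) hφ).integral_prod_left

theorem tendsto_mean (h : SolutionSeq L R n u₀ ε U U1 U2 U3 E M K) {p S : ℝ} (hp : 1 ≤ p)
    {ρ : ℝ → ℝ → ℝ} (hρ : IntegrableOn (Function.uncurry ρ) (Ioo 0 S ×ˢ Ioo L R))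
    (hlim : Tendsto (fun k => ∫⁻ t in Ioo 0 S,
      normWneg L R (fun x => Beps n (ε k) (U k t x) - ρ t x) ^ p) atTop (𝓝 0))
    {φ : ℝ → ℝ} (hφ : IsTest (Ioo L R) φ) :
    Tendsto (fun k => ∫⁻ t in Ioo 0 S,
      ENNReal.ofReal |mean L R (fun t x => Beps n (ε k) (U k t x)) φ t - mean L R ρ φ t|)
      atTop (𝓝 0) := by
  obtain ⟨C, hC0, hC⟩ := ofReal_abs_integral_le_normWneg hφ
  have h1 : Tendsto (fun k => ENNReal.ofReal C * ∫⁻ t in Ioo 0 S,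
      normWneg L R (fun x => Beps n (ε k) (U k t x) - ρ t x)) atTop (𝓝 0) := by
    simpa using ENNReal.Tendsto.const_mul (tendsto_lintegral_of_rpow hp hlim)
      (Or.inr ENNReal.ofReal_ne_top)
  refine tendsto_of_tendsto_of_tendsto_of_le_of_le tendsto_const_nhds h1 (fun _ => zero_le)
    fun k => ?_
  have hρ' : Integrable (fun q : ℝ × ℝ => ρ q.1 q.2)
      ((volume.restrict (Ioo 0 S)).prod (volume.restrict (Ioo L R))) := by
    rw [← restrict_prod_eq]; exact hρ
  have i1 := hρ'.prod_right_ae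
  have i2 := ((h.sol k).integrable_Beps_mul h.exponent (h.eps k) (h.le_sup k) (S := S)
    hφ.1.continuous).prod_right_ae
  obtain ⟨D, -, hD⟩ := ContDiff.exists_abs_bound (a := L) (b := R)
    hφ.1.continuous.continuousOn
  have hb : ∀ᵐ x ∂(volume.restrict (Ioo L R)), ‖φ x‖ ≤ D :=
    (ae_restrict_iff' measurableSet_Ioo).2
      (Eventually.of_forall fun x hx => hD x (Ioo_subset_Icc_self hx))
  simp only
  rw [← lintegral_const_mul' _ _ ENNReal.ofReal_ne_top]
  refine lintegral_mono_ae ?_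
  filter_upwards [i1, i2] with t ht1 ht2
  have ht1' : Integrable (fun x => ρ t x * φ x) (volume.restrict (Ioo L R)) :=
    (ht1.bdd_mul hφ.1.continuous.aestronglyMeasurable hb).congr
      (Eventually.of_forall fun x => mul_comm _ _)
  refine le_trans (le_of_eq ?_) (hC _)
  rw [mean, mean, ← integral_sub ht2 ht1']
  congr 2
  refine integral_congr_ae (Eventually.of_forall fun x => ?_)
  simp only
  ring

theorem mean_le (h : SolutionSeq L R n u₀ ε U U1 U2 U3 E M K) (k : ℕ) {t : ℝ} (ht : 0 < t)
    {φ : ℝ → ℝ} (hφ : Continuous φ) (hφ0 : ∀ x, 0 ≤ φ x) :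
    mean L R (fun t x => Beps n (ε k) (U k t x)) φ t
      ≤ Beps n (ε k) M * ∫ x in Ioo L R, φ x := by
  have hc : ContinuousOn (fun x => Beps n (ε k) (U k t x)) (Icc L R) :=
    (continuousOn_Beps h.exponent (h.eps k)).comp ((h.sol k).continuousOn_slice ht.le)
      fun x hx => (h.sol k).nonneg t ht.le x hx
  have hi : IntegrableOn φ (Ioo L R) :=
    hφ.continuousOn.integrableOn_Icc.mono_set Ioo_subset_Icc_self
  rw [mean, ← integral_const_mul]
  refine setIntegral_mono_on ((hc.mul hφ.continuousOn).integrableOn_Icc.mono_set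
    Ioo_subset_Icc_self) (hi.const_mul _) measurableSet_Ioo fun x hx => ?_
  have hx' := Ioo_subset_Icc_self hx
  have h0 := (h.sol k).nonneg t ht.le x hx'
  exact mul_le_mul_of_nonneg_right (monotoneOn_Beps h.exponent (h.eps k) h0 h.M_pos.le
    (h.le_sup k t ht x hx')) (hφ0 x)

/-- By monotonicity `B^ε(u) ≤ B^ε(M)`, and the right-hand side tends to one. -/
theorem mean_limit_le (h : SolutionSeq L R n u₀ ε U U1 U2 U3 E M K) {t μ : ℝ} (ht : 0 < t)
    {φ : ℝ → ℝ} (hφ : Continuous φ) (hφ0 : ∀ x, 0 ≤ φ x) {σ : ℕ → ℕ} (hσ : StrictMono σ)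
    (hlim : Tendsto (fun k => ENNReal.ofReal
      |mean L R (fun t x => Beps n (ε (σ k)) (U (σ k) t x)) φ t - μ|) atTop (𝓝 0)) :
    μ ≤ ∫ x in Ioo L R, φ x := by
  have h1 := (ENNReal.tendsto_toReal ENNReal.zero_ne_top).comp hlim
  simp only [Function.comp_def, ENNReal.toReal_ofReal (abs_nonneg _), ENNReal.toReal_zero] at h1
  have h2 := (tendsto_zero_iff_abs_tendsto_zero _).2 h1
  have h3 : Tendsto (fun k => Beps n (ε (σ k)) M * ∫ x in Ioo L R, φ x) atTop
      (𝓝 (∫ x in Ioo L R, φ x)) := by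
    have := ((tendsto_Beps h.exponent h.eps h.lim h.M_pos).comp hσ.tendsto_atTop).mul_const
      (∫ x in Ioo L R, φ x)
    simpa using this
  have h4 : Tendsto (fun k => Beps n (ε (σ k)) M * (∫ x in Ioo L R, φ x)
      - (mean L R (fun t x => Beps n (ε (σ k)) (U (σ k) t x)) φ t - μ)) atTop
      (𝓝 (∫ x in Ioo L R, φ x)) := by simpa using h3.sub h2
  exact ge_of_tendsto' h4 fun k => by linarith [h.mean_le (σ k) ht hφ hφ0]

theorem aemeasurable_mean_sub (h : SolutionSeq L R n u₀ ε U U1 U2 U3 E M K) (k : ℕ) {S : ℝ}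
    {ρ : ℝ → ℝ → ℝ} (hρ : IntegrableOn (Function.uncurry ρ) (Ioo 0 S ×ˢ Ioo L R))
    {φ : ℝ → ℝ} (hφ : Continuous φ) :
    AEMeasurable (fun t => ENNReal.ofReal
      |mean L R (fun t x => Beps n (ε k) (U k t x)) φ t - mean L R ρ φ t|)
      (volume.restrict (Ioo 0 S)) :=
  ((h.integrableOn_mean_Beps k S hφ).sub
    (integrableOn_mean hρ hφ)).aestronglyMeasurable.aemeasurable.abs.ennreal_ofReal

/-- The bound on `ρ` is needed before the common subsequence exists, so a separate subsequence is
extracted; the conclusion does not depend on it. -/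
theorem ae_mean_le (h : SolutionSeq L R n u₀ ε U U1 U2 U3 E M K) {p S : ℝ} (hp : 1 ≤ p)
    {ρ : ℝ → ℝ → ℝ} (hρ : IntegrableOn (Function.uncurry ρ) (Ioo 0 S ×ˢ Ioo L R))
    (hlim : Tendsto (fun k => ∫⁻ t in Ioo 0 S,
      normWneg L R (fun x => Beps n (ε k) (U k t x) - ρ t x) ^ p) atTop (𝓝 0))
    {φ : ℝ → ℝ} (hφ : IsTest (Ioo L R) φ) (hφ0 : ∀ x, 0 ≤ φ x) :
    ∀ᵐ t, t ∈ Ioo 0 S → mean L R ρ φ t ≤ ∫ x in Ioo L R, φ x := by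
  obtain ⟨σ, hσ, H⟩ := exists_subseq_tendsto_ae (ι := Unit)
    (fun _ k => h.aemeasurable_mean_sub k hρ hφ.1.continuous)
    (fun _ => h.tendsto_mean hp hρ hlim hφ)
  filter_upwards [(ae_restrict_iff' measurableSet_Ioo).1 (H ())] with t ht htS
  exact h.mean_limit_le htS.1 hφ.1.continuous hφ0 hσ (ht htS)

/-- The source term vanishes asymptotically after a time at which the mean value of `ρ` is
maximal. -/
theorem ae_tendsto_source (h : SolutionSeq L R n u₀ ε U U1 U2 U3 E M K) {p S : ℝ} (hp : 1 ≤ p)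
    (hS : 0 < S)
    {ρ : ℝ → ℝ → ℝ} (hρ : IntegrableOn (Function.uncurry ρ) (Ioo 0 S ×ˢ Ioo L R))
    (hlim : Tendsto (fun k => ∫⁻ t in Ioo 0 S,
      normWneg L R (fun x => Beps n (ε k) (U k t x) - ρ t x) ^ p) atTop (𝓝 0))
    {ψ : ℝ → ℝ} (hψ : IsTest (Ioo L R) ψ) :
    ∀ᵐ t0, t0 ∈ Ioo 0 S → mean L R ρ (fun x => ψ x ^ 2) t0 = ∫ x in Ioo L R, ψ x ^ 2 →
      ∀ α β, t0 < α → α < β → β < S →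
      Tendsto (fun k => ∫⁻ t in Ioo α β,
        ENNReal.ofReal |source L R (U k) (U1 k) (U3 k) (fun x => ψ x ^ 2) t|) atTop (𝓝 0) := by
  have hφ : IsTest (Ioo L R) (fun x => ψ x ^ 2) := by
    have hsub : tsupport (fun x => ψ x ^ 2) ⊆ tsupport ψ :=
      closure_mono fun x hx => by
        simp only [Function.mem_support, ne_eq] at hx ⊢
        exact fun h0 => hx (by rw [h0]; simp)
    exact ⟨hψ.1.pow 2, hψ.2.1.isCompact.of_isClosed_subset (isClosed_tsupport _) hsub,
      hsub.trans hψ.2.2⟩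
  have hφc := hφ.1.continuous
  set φ : ℝ → ℝ := fun x => ψ x ^ 2
  obtain ⟨C, hC0, hC⟩ := Slice.exists_lower_bound hψ
  have hg : ∀ k, IntegrableOn (source L R (U k) (U1 k) (U3 k) φ) (Ioo 0 S) := fun k =>
    (h.sol k).integrableOn_source (h.energy k) hS hφc
  have hμ := integrableOn_mean hρ hφc
  have hneg : Tendsto (fun k => ∫⁻ t in Ioo 0 S,
      ENNReal.ofReal (-source L R (U k) (U1 k) (U3 k) φ t)) atTop (𝓝 0) := by
    refine ennreal_tendsto_zero_of_forall_le (h.tendsto_diss hS)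
      (tendsto_ofReal_mul_one_div (C * E * S))
      (c := fun j => ENNReal.ofReal (C / (1 / ((j : ℝ) + 1)) ^ 2)) (fun _ => ENNReal.ofReal_ne_top)
      fun j k => ?_
    exact IsSolutionWith.lintegral_neg_source_le (h.eps k) h.E_nonneg (fun t ht => (h.energy k t ht).2)
      (by filter_upwards [h.slice] with t ht h0 using ht h0 k) hC0 hC (by positivity)
  -- `ν = ∫ φ - ∫ ρ φ` is the room left for growth: it is nonnegative, its zeros are the times at
  -- which the mean value is maximal, and the source converges to `-ν'`.
  have hν : IntegrableOn (fun t => (∫ x in Ioo L R, φ x) - mean L R ρ φ t) (Ioo 0 S) :=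
    (integrable_const _).sub hμ
  have key := ae_tendsto_zero_after_zero hg hneg hν (by
    filter_upwards [h.ae_mean_le hp hρ hlim hφ fun x => sq_nonneg _] with t ht htS
    linarith [ht htS]) fun χ hχ => ?_
  · filter_upwards [key] with t0 ht0 htS hz
    exact ht0 htS (by rw [hz, sub_self])
  have hbound : ∀ {k : ℝ → ℝ} {f : ℝ → ℝ}, Continuous k → IntegrableOn f (Ioo 0 S) →
      IntegrableOn (fun t => k t * f t) (Ioo 0 S) := by
    intro k f hk hf
    obtain ⟨C, -, hC⟩ := ContDiff.exists_abs_bound (a := 0) (b := S) hk.continuousOn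
    refine Integrable.bdd_mul (c := C) hf hk.aestronglyMeasurable ?_
    exact (ae_restrict_iff' measurableSet_Ioo).2 (Eventually.of_forall fun x hx =>
      hC x (Ioo_subset_Icc_self hx))
  have hχd : Continuous (deriv χ) := hχ.1.continuous_deriv (by simp)
  have hχ0 : ∫ t in Ioo 0 S, deriv χ t = 0 := by
    have z : ∀ t, t ∉ Ioo 0 S → χ t = 0 := fun t ht =>
      image_eq_zero_of_notMem_tsupport fun h => ht (hχ.2.2 h)
    rw [setIntegral_congr_set Ioo_ae_eq_Ioc, ← intervalIntegral.integral_of_le hS.le,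
      intervalIntegral.integral_deriv_eq_sub' χ rfl
        (fun t _ => (hχ.1.differentiable (by simp)).differentiableAt) hχd.continuousOn,
      z S (by simp), z 0 (by simp), sub_zero]
  obtain ⟨C1, hC1⟩ := hχ.2.1.exists_bound_of_continuous hχ.1.continuous
  obtain ⟨C2, hC2⟩ := hφ.2.1.deriv.exists_bound_of_continuous (hφ.1.continuous_deriv (by simp))
  obtain ⟨C3, hC3⟩ := hχ.2.1.deriv.exists_bound_of_continuous hχd
  have hC10 : 0 ≤ C1 := (norm_nonneg _).trans (hC1 0)
  have hC20 : 0 ≤ C2 := (norm_nonneg _).trans (hC2 0)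
  have hC30 : 0 ≤ C3 := (norm_nonneg _).trans (hC3 0)
  set m : ℕ → ℝ → ℝ := fun k => mean L R (fun t x => Beps n (ε k) (U k t x)) φ with hm
  have hmi : ∀ k, IntegrableOn (m k) (Ioo 0 S) := fun k => h.integrableOn_mean_Beps k S hφc
  have r1 : Tendsto (fun k => (∫ t in Ioo 0 S, χ t * source L R (U k) (U1 k) (U3 k) φ t)
      + ∫ t in Ioo 0 S, deriv χ t * m k t) atTop (𝓝 0) := by
    rw [tendsto_iff_edist_tendsto_0]
    simp only [edist_zero_right]
    refine ennreal_tendsto_zero_of_forall_le (h.tendsto_diss hS)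
      (tendsto_ofReal_mul_one_div ((C1 * C2) * ((9 / n ^ 2 + 1) * (1 + M)) * (R - L) * S))
      (c := fun j => ENNReal.ofReal ((C1 * C2) / (1 / ((j : ℝ) + 1))))
      (fun _ => ENNReal.ofReal_ne_top) fun j k => ?_
    refine (h.sol k).enorm_source_add_le h.exponent (h.eps k) (h.le_sup k) hχ hφ
      (mul_nonneg hC10 hC20) (fun t x => ?_) (by positivity)
    rw [abs_mul]
    exact mul_le_mul (hC1 t) (hC2 x) (abs_nonneg _) hC10
  have r2 : Tendsto (fun k => ∫ t in Ioo 0 S, deriv χ t * (m k t - mean L R ρ φ t)) atTop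
      (𝓝 0) := by
    rw [tendsto_iff_edist_tendsto_0]
    simp only [edist_zero_right]
    have := ENNReal.Tendsto.const_mul (a := ENNReal.ofReal C3) (h.tendsto_mean hp hρ hlim hφ)
      (Or.inr ENNReal.ofReal_ne_top)
    rw [mul_zero] at this
    refine tendsto_of_tendsto_of_tendsto_of_le_of_le tendsto_const_nhds this (fun _ => zero_le)
      fun k => ?_
    simp only
    refine (enorm_integral_le_lintegral_enorm _).trans ?_
    rw [← lintegral_const_mul' _ _ ENNReal.ofReal_ne_top]
    refine lintegral_mono fun t => ?_
    rw [← ENNReal.ofReal_mul hC30, ← ofReal_norm, norm_mul, Real.norm_eq_abs (m k t - _)]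
    exact ENNReal.ofReal_le_ofReal (mul_le_mul_of_nonneg_right (hC3 t) (abs_nonneg _))
  have e : ∀ k, ∫ t in Ioo 0 S, deriv χ t * (m k t - mean L R ρ φ t)
      = (∫ t in Ioo 0 S, deriv χ t * m k t) - ∫ t in Ioo 0 S, deriv χ t * mean L R ρ φ t := by
    intro k
    rw [← integral_sub (hbound hχd (hmi k)) (hbound hχd hμ)]
    congr 1; ext t; ring
  -- The constant `∫ φ` drops out because `χ'` has mean zero.
  have e2 : ∫ t in Ioo 0 S, deriv χ t * ((∫ x in Ioo L R, φ x) - mean L R ρ φ t)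
      = - ∫ t in Ioo 0 S, deriv χ t * mean L R ρ φ t := by
    have i1 : IntegrableOn (fun t => deriv χ t * ∫ x in Ioo L R, φ x) (Ioo 0 S) :=
      hbound hχd (integrable_const _)
    simp only [mul_sub]
    rw [integral_sub i1 (hbound hχd hμ), integral_mul_const, hχ0]
    ring
  rw [e2]
  have r3 := (r1.sub r2).sub_const (∫ t in Ioo 0 S, deriv χ t * mean L R ρ φ t)
  simp only [sub_zero, zero_sub] at r3
  refine r3.congr fun k => ?_
  rw [e k]
  ring

end SolutionSeq

/-! ### A family of bump functions -/

/-- A smooth bump function that is `1` on `[c - r, c + r]` and `0` outside `(c - 2r, c + 2r)`. -/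
noncomputable def bump (r c x : ℝ) : ℝ :=
  if h : 0 < r then (⟨r, 2 * r, h, by linarith⟩ : ContDiffBump (0 : ℝ)) (c - x) else 0

theorem bump_nonneg (r c x : ℝ) : 0 ≤ bump r c x := by
  unfold bump; split_ifs
  · exact ContDiffBump.nonneg _
  · rfl

theorem bump_eq_one {r c x : ℝ} (hr : 0 < r) (h : |c - x| ≤ r) : bump r c x = 1 := by
  rw [bump, dif_pos hr]
  refine ContDiffBump.one_of_mem_closedBall _ ?_
  rw [Metric.mem_closedBall, Real.dist_eq, sub_zero]; exact h

theorem bump_eq_zero {r c x : ℝ} (h : 2 * r ≤ |c - x|) : bump r c x = 0 := by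
  rw [bump]; split_ifs with hr
  · refine ContDiffBump.zero_of_le_dist _ ?_
    rw [Real.dist_eq, sub_zero]; exact h
  · rfl

theorem contDiff_bump (r c : ℝ) : ContDiff ℝ ∞ (bump r c) := by
  unfold bump; split_ifs
  · exact (ContDiffBump.contDiff _).comp (contDiff_const.sub contDiff_id)
  · exact contDiff_const

theorem isTest_bump {r c L R : ℝ} (hL : L < c - 2 * r) (hR : c + 2 * r < R) :
    IsTest (Ioo L R) (bump r c) := by
  have hsub : tsupport (bump r c) ⊆ Icc (c - 2 * r) (c + 2 * r) := by
    refine closure_minimal (fun x hx => ?_) isClosed_Icc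
    by_contra hn
    apply hx
    apply bump_eq_zero
    by_contra hlt
    rw [not_le, abs_lt] at hlt
    exact hn ⟨by linarith, by linarith⟩
  exact ⟨contDiff_bump r c, isCompact_Icc.of_isClosed_subset (isClosed_tsupport _) hsub,
    hsub.trans fun x hx => ⟨hL.trans_le hx.1, hx.2.trans_lt hR⟩⟩

/-- A function whose mean values with respect to bump functions are at most `1` is at most `1`. -/
theorem ae_le_one_of_bump {L R : ℝ} {w : ℝ → ℝ} (hw : IntegrableOn w (Ioo L R))
    (H : ∀ r c : ℚ, 0 < r → L < (c : ℝ) - 2 * r → (c : ℝ) + 2 * r < R →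
      ∫ x in Ioo L R, w x * bump r c x ≤ ∫ x in Ioo L R, bump r c x) :
    ∀ᵐ x, x ∈ Ioo L R → w x ≤ 1 := by
  set w' : ℝ → ℝ := (Ioo L R).indicator w
  have hw' : Integrable w' := (integrable_indicator_iff measurableSet_Ioo).2 hw
  have hpos : ∀ i : ℕ, (0 : ℝ) < 1 / ((i : ℝ) + 1) := fun i => by positivity
  let η : ℕ → ContDiffBump (0 : ℝ) := fun i =>
    ⟨1 / ((i : ℝ) + 1), 2 * (1 / ((i : ℝ) + 1)), hpos i, by linarith [hpos i]⟩
  have hη0 : Tendsto (fun i => (η i).rOut) atTop (𝓝 0) := by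
    have := (tendsto_one_div_add_atTop_nhds_zero_nat (𝕜 := ℝ)).const_mul 2
    rwa [mul_zero] at this
  have hconv := ContDiffBump.ae_convolution_tendsto_right_of_locallyIntegrable (μ := volume)
    (φ := η) (K := 2) hη0 (Eventually.of_forall fun i => le_rfl) hw'.locallyIntegrable
  filter_upwards [hconv] with x0 hc hx0
  have hx : w' x0 = w x0 := indicator_of_mem hx0 w
  rw [hx] at hc
  refine le_of_tendsto hc ?_
  filter_upwards [hη0.eventually_lt_const (show 0 < x0 - L by linarith [hx0.1]),
    hη0.eventually_lt_const (show 0 < R - x0 by linarith [hx0.2])] with i h1 h2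
  have hr : (η i).rOut = 2 * (1 / ((i : ℝ) + 1)) := rfl
  set h : ℝ → ℝ := MeasureTheory.convolution ((η i).normed volume) w'
    (ContinuousLinearMap.lsmul ℝ ℝ) volume with hh
  have hcont : Continuous h := HasCompactSupport.continuous_convolution_left _
    (η i).hasCompactSupport_normed (η i).continuous_normed hw'.locallyIntegrable
  by_contra hlt
  rw [not_le] at hlt
  -- The mollification `h` is continuous, so a value above one at `x0` would persist at some
  -- rational centre, where it is excluded; countably many bumps therefore suffice.
  have hopen : IsOpen (h ⁻¹' Ioi 1 ∩ Ioo (L + (η i).rOut) (R - (η i).rOut)) :=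
    (isOpen_Ioi.preimage hcont).inter isOpen_Ioo
  obtain ⟨c, ⟨hc1, hc2⟩⟩ := Rat.isDenseEmbedding_coe_real.dense.exists_mem_open hopen
    ⟨x0, hlt, by linarith, by linarith⟩
  rw [hr] at hc2
  set r : ℚ := 1 / ((i : ℚ) + 1) with hrdef
  have hrr : (r : ℝ) = 1 / ((i : ℝ) + 1) := by rw [hrdef]; push_cast; rfl
  have hr0 : 0 < r := by positivity
  have hb := H r c hr0 (by rw [hrr]; linarith [hc2.1]) (by rw [hrr]; linarith [hc2.2])
  have hbe : ∀ x, bump r c x = η i (c - x) := fun x => by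
    have hr0' : (0 : ℝ) < (r : ℝ) := by exact_mod_cast hr0
    rw [bump, dif_pos hr0']
    congr 2; rw [hrr]
  have htot : ∫ x in Ioo L R, bump r c x = ∫ x, η i x := by
    rw [setIntegral_eq_integral_of_forall_compl_eq_zero]
    · simp only [hbe]
      exact integral_sub_left_eq_self (fun x => η i x) volume (c : ℝ)
    · intro x hx
      apply bump_eq_zero
      by_contra hlt'
      rw [not_le, abs_lt, hrr] at hlt'
      exact hx ⟨by linarith [hc2.1], by linarith [hc2.2]⟩
  have hpos' : 0 < ∫ x, η i x := (η i).integral_pos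
  have hval : h c = (∫ x in Ioo L R, w x * bump r c x) / ∫ x, η i x := by
    rw [hh, convolution_eq_swap, ← integral_div, ← integral_indicator measurableSet_Ioo]
    congr 1; ext t
    by_cases ht : t ∈ Ioo L R
    · simp only [w', indicator_of_mem ht, ContDiffBump.normed_def, hbe,
        ContinuousLinearMap.lsmul_apply, smul_eq_mul]
      ring
    · simp [w', ht]
  have : h c ≤ 1 := by
    rw [hval, div_le_one hpos', ← htot]; exact hb
  exact absurd hc1 (not_lt.2 this)

/-- The exceptional points are least elements of `A`, of which there is at most one. Applied to the
times after which the source vanishes, it provides an earlier such time. -/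
theorem ae_exists_lt_mem (A : Set ℝ) : ∀ᵐ t, t ∈ A → ∃ t0 ∈ A, t0 < t := by
  have hs : {t | t ∈ A ∧ ∀ t0 ∈ A, t ≤ t0}.Subsingleton := fun t ht s hs =>
    le_antisymm (ht.2 s hs.1) (hs.2 t ht.1)
  filter_upwards [measure_eq_zero_iff_ae_notMem.1 (hs.measure_zero volume)] with t ht htA
  by_contra hcon
  push Not at hcon
  exact ht ⟨htA, hcon⟩

/-! ### One subsequence for all test functions -/

namespace SolutionSeq

variable {L R n E M : ℝ} {u₀ : ℝ → ℝ} {ε : ℕ → ℝ} {U U1 U2 U3 : ℕ → ℝ → ℝ → ℝ} {K : ℝ≥0∞}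

/-- The source vanishes in `L¹` on intervals that lie after times of maximal mean value; these times
form a possibly uncountable set depending on the test function. Indexing by all rational intervals
on which the convergence holds, for whatever reason, leaves countably many sequences. Almost every
time of maximal mean value has an earlier such time `t0`, and a rational interval around it and to
the right of `t0` belongs to the family. -/
theorem exists_subseq (h : SolutionSeq L R n u₀ ε U U1 U2 U3 E M K) {p : ℝ} (hp : 1 ≤ p)
    {ρ : ℝ → ℝ → ℝ} {𝒮 : Set ℝ} (h𝒮 : 𝒮.Countable) (hpos : ∀ S ∈ 𝒮, 0 < S)
    (hρ : ∀ S ∈ 𝒮, IntegrableOn (Function.uncurry ρ) (Ioo 0 S ×ˢ Ioo L R))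
    (hlim : ∀ S ∈ 𝒮, Tendsto (fun k => ∫⁻ t in Ioo 0 S,
      normWneg L R (fun x => Beps n (ε k) (U k t x) - ρ t x) ^ p) atTop (𝓝 0))
    {𝒯 : Set (ℝ → ℝ)} (h𝒯 : 𝒯.Countable) (htest : ∀ ψ ∈ 𝒯, IsTest (Ioo L R) ψ) :
    ∃ σ : ℕ → ℕ, StrictMono σ ∧ ∀ S ∈ 𝒮, ∀ᵐ t, t ∈ Ioo 0 S →
      Tendsto (fun k => diss L R n (ε (σ k)) (U (σ k)) (U3 (σ k)) t) atTop (𝓝 0) ∧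
      ∀ ψ ∈ 𝒯,
        Tendsto (fun k => ENNReal.ofReal |mean L R (fun t x => Beps n (ε (σ k)) (U (σ k) t x)) ψ t
          - mean L R ρ ψ t|) atTop (𝓝 0) ∧
        (mean L R ρ (fun x => ψ x ^ 2) t = ∫ x in Ioo L R, ψ x ^ 2 →
          Tendsto (fun k => ENNReal.ofReal
            |source L R (U (σ k)) (U1 (σ k)) (U3 (σ k)) (fun x => ψ x ^ 2) t|) atTop (𝓝 0)) := by
  have : Countable 𝒮 := h𝒮.to_subtype
  have : Countable 𝒯 := h𝒯.to_subtype
  let G (ψ : ℝ → ℝ) (k : ℕ) (t : ℝ) : ℝ≥0∞ :=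
    ENNReal.ofReal |source L R (U k) (U1 k) (U3 k) (fun x => ψ x ^ 2) t|
  let J := {x : 𝒮 × 𝒯 × ℚ × ℚ // Ioo (x.2.2.1 : ℝ) x.2.2.2 ⊆ Ioo 0 (x.1 : ℝ) ∧
    Tendsto (fun k => ∫⁻ t in Ioo (x.2.2.1 : ℝ) x.2.2.2, G x.2.1 k t) atTop (𝓝 0)}
  let μ : 𝒮 ⊕ (𝒮 × 𝒯) ⊕ J → Measure ℝ := Sum.elim (fun S => volume.restrict (Ioo 0 (S : ℝ)))
    (Sum.elim (fun q => volume.restrict (Ioo 0 (q.1 : ℝ)))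
      (fun j => volume.restrict (Ioo (j.1.2.2.1 : ℝ) j.1.2.2.2)))
  let F : 𝒮 ⊕ (𝒮 × 𝒯) ⊕ J → ℕ → ℝ → ℝ≥0∞ := Sum.elim
    (fun _ k t => diss L R n (ε k) (U k) (U3 k) t)
    (Sum.elim (fun q k t => ENNReal.ofReal
      |mean L R (fun t x => Beps n (ε k) (U k t x)) q.2 t - mean L R ρ q.2 t|)
      (fun j k t => G j.1.2.1 k t))
  obtain ⟨σ, hσ, H⟩ := exists_subseq_tendsto_ae (μ := μ) (F := F) (by
    rintro (S | q | j) k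
    · exact ((h.sol k).aemeasurable_diss h.exponent).mono_measure
        (Measure.restrict_mono_set _ Ioo_subset_Ioi_self)
    · exact h.aemeasurable_mean_sub k (hρ _ q.1.2) (htest _ q.2.2).1.continuous
    · exact (((h.sol k).integrableOn_source (h.energy k) (hpos _ j.1.1.2)
        ((htest _ j.1.2.1.2).1.continuous.pow 2)).mono_set
        j.2.1).aestronglyMeasurable.aemeasurable.abs.ennreal_ofReal) (by
    rintro (S | q | j)
    · exact h.tendsto_diss (hpos _ S.2)
    · exact h.tendsto_mean hp (hρ _ q.1.2) (hlim _ q.1.2) (htest _ q.2.2)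
    · exact j.2.2)
  refine ⟨σ, hσ, fun S hS => ?_⟩
  have H1 : ∀ᵐ t, t ∈ Ioo 0 S →
      Tendsto (fun k => diss L R n (ε (σ k)) (U (σ k)) (U3 (σ k)) t) atTop (𝓝 0) :=
    (ae_restrict_iff' measurableSet_Ioo).1 (H (Sum.inl ⟨S, hS⟩))
  have H2 : ∀ᵐ t, ∀ ψ : 𝒯, t ∈ Ioo 0 S → Tendsto (fun k => ENNReal.ofReal
      |mean L R (fun t x => Beps n (ε (σ k)) (U (σ k) t x)) ψ t - mean L R ρ ψ t|) atTop (𝓝 0) :=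
    ae_all_iff.2 fun ψ =>
      (ae_restrict_iff' measurableSet_Ioo).1 (H (Sum.inr (Sum.inl (⟨S, hS⟩, ψ))))
  have H3 : ∀ᵐ t, ∀ j : J, t ∈ Ioo (j.1.2.2.1 : ℝ) j.1.2.2.2 →
      Tendsto (fun k => G j.1.2.1 (σ k) t) atTop (𝓝 0) :=
    ae_all_iff.2 fun j =>
      (ae_restrict_iff' measurableSet_Ioo).1 (H (Sum.inr (Sum.inr j)))
  let A (ψ : 𝒯) : Set ℝ := {t0 | t0 ∈ Ioo 0 S ∧ ∀ α β, t0 < α → α < β → β < S →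
    Tendsto (fun k => ∫⁻ t in Ioo α β, G ψ k t) atTop (𝓝 0)}
  have H4 : ∀ᵐ t, ∀ ψ : 𝒯, t ∈ Ioo 0 S →
      mean L R ρ (fun x => (ψ : ℝ → ℝ) x ^ 2) t = ∫ x in Ioo L R, (ψ : ℝ → ℝ) x ^ 2 → t ∈ A ψ := by
    refine ae_all_iff.2 fun ψ => ?_
    filter_upwards [h.ae_tendsto_source hp (hpos S hS) (hρ S hS) (hlim S hS) (htest ψ ψ.2)]
      with t ht htS hz
    exact ⟨htS, ht htS hz⟩
  have H5 : ∀ᵐ t, ∀ ψ : 𝒯, t ∈ A ψ → ∃ t0 ∈ A ψ, t0 < t :=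
    ae_all_iff.2 fun ψ => ae_exists_lt_mem (A ψ)
  filter_upwards [H1, H2, H3, H4, H5] with t h1 h2 h3 h4 h5 htS
  refine ⟨h1 htS, fun ψ hψ => ⟨h2 ⟨ψ, hψ⟩ htS, fun hz => ?_⟩⟩
  obtain ⟨t0, ht0, hlt⟩ := h5 ⟨ψ, hψ⟩ (h4 ⟨ψ, hψ⟩ htS hz)
  obtain ⟨α, hα1, hα2⟩ := exists_rat_btwn hlt
  obtain ⟨β, hβ1, hβ2⟩ := exists_rat_btwn htS.2
  exact h3 ⟨(⟨S, hS⟩, ⟨ψ, hψ⟩, α, β),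
    Ioo_subset_Ioo (ht0.1.1.trans hα1).le hβ2.le,
    ht0.2 α β hα1 (hα2.trans hβ1) hβ2⟩ ⟨hα2, hβ1⟩

end SolutionSeq

/-! ### Accumulation points at a fixed time -/

theorem exists_rat_bump {x a b : ℝ} (hax : a < x) (hxb : x < b) :
    ∃ r c : ℚ, (0 : ℝ) < r ∧ a < (c : ℝ) - 2 * r ∧ (c : ℝ) + 2 * r < b ∧ |(c : ℝ) - x| < r := by
  obtain ⟨r, hr0, hr⟩ := exists_rat_btwn
    (show (0 : ℝ) < min (x - a) (b - x) / 4 by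
      have := lt_min (sub_pos.2 hax) (sub_pos.2 hxb); linarith)
  have h1 := min_le_left (x - a) (b - x)
  have h2 := min_le_right (x - a) (b - x)
  obtain ⟨c, hc1, hc2⟩ := exists_rat_btwn (show x < x + r by linarith)
  exact ⟨r, c, hr0, by linarith, by linarith, by rw [abs_lt]; constructor <;> linarith⟩

/-- The properties of the sequence of solutions at almost every time, after extraction of a
subsequence; `q` stands for `ρ(t,·)`. -/
structure TimeSlice (L R n : ℝ) (ε : ℕ → ℝ) (f f1 f3 : ℕ → ℝ → ℝ) (E M : ℝ) (q : ℝ → ℝ) :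
    Prop where
  lt : L < R
  exponent : n ∈ Ioo (0 : ℝ) 3
  eps : ∀ k, ε k ∈ Ioo (0 : ℝ) 1
  lim : Tendsto ε atTop (𝓝 0)
  slice : ∀ k, Slice L R (f k) (f1 k) (f3 k)
  h1 : ∀ k, HasH1Deriv L R (f k) (f1 k)
  int : ∀ k, IntegrableOn (fun x => f k x ^ 3 * f3 k x ^ 2) (Ioo L R)
  diss : Tendsto (fun k => ∫ x in Ioo L R, f k x ^ 3 * f3 k x ^ 2) atTop (𝓝 0)
  energy : ∀ k, ∫ x in Ioo L R, f1 k x ^ 2 ≤ E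
  M_pos : 0 < M
  le_sup : ∀ k, ∀ x ∈ Icc L R, f k x ≤ M
  holder : ∀ k, ∀ κ, 0 < κ → ∀ x ∈ Icc L R, ∀ y ∈ Icc L R,
    |f k x - f k y| ≤ κ * |x - y| + E / κ
  mass : ∀ k, ∫ x in Ioo L R, f k x = 1
  q_int : IntegrableOn q (Ioo L R)
  q_le : ∀ᵐ x, x ∈ Ioo L R → q x ≤ 1
  mean : ∀ r c : ℚ, (0 : ℝ) < r → L < (c : ℝ) - 2 * r → (c : ℝ) + 2 * r < R →
    Tendsto (fun k => ∫ x in Ioo L R, Beps n (ε k) (f k x) * bump r c x) atTop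
      (𝓝 (∫ x in Ioo L R, q x * bump r c x))
  source : ∀ r c : ℚ, (0 : ℝ) < r → L < (c : ℝ) - 2 * r → (c : ℝ) + 2 * r < R →
    ∫ x in Ioo L R, q x * bump r c x ^ 2 = ∫ x in Ioo L R, bump r c x ^ 2 →
    Tendsto (fun k => ∫ x in Ioo L R, -(f k x * f1 k x * f3 k x) * bump r c x ^ 2) atTop (𝓝 0)

namespace TimeSlice

variable {L R n E M : ℝ} {ε : ℕ → ℝ} {f f1 f3 : ℕ → ℝ → ℝ} {q : ℝ → ℝ} {j : ℕ → ℕ} {v : ℝ → ℝ}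

theorem limit_continuousOn (h : TimeSlice L R n ε f f1 f3 E M q)
    (hv : TendstoUniformlyOn (fun k => f (j k)) v atTop (Icc L R)) : ContinuousOn v (Icc L R) :=
  hv.continuousOn (Frequently.of_forall fun k => (h.slice (j k)).cont)

theorem limit_nonneg (h : TimeSlice L R n ε f f1 f3 E M q)
    (hv : TendstoUniformlyOn (fun k => f (j k)) v atTop (Icc L R)) {x : ℝ} (hx : x ∈ Icc L R) :
    0 ≤ v x :=
  ge_of_tendsto' (hv.tendsto_at hx) fun k => (h.slice (j k)).nonneg x hx

theorem limit_mass (h : TimeSlice L R n ε f f1 f3 E M q)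
    (hv : TendstoUniformlyOn (fun k => f (j k)) v atTop (Icc L R)) :
    ∫ x in Ioo L R, v x = 1 := by
  have h1 : Tendsto (fun k => ∫ x in Ioo L R, f (j k) x) atTop (𝓝 (∫ x in Ioo L R, v x)) := by
    refine tendsto_integral_of_dominated_convergence (fun _ => M) (fun k => ?_)
      (integrable_const _) (fun k => ?_) ?_
    · exact ((h.slice (j k)).cont.mono Ioo_subset_Icc_self).aestronglyMeasurable measurableSet_Ioo
    · refine (ae_restrict_iff' measurableSet_Ioo).2 (Eventually.of_forall fun x hx => ?_)
      have hx' := Ioo_subset_Icc_self hx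
      rw [Real.norm_of_nonneg ((h.slice (j k)).nonneg x hx')]
      exact h.le_sup _ x hx'
    · exact (ae_restrict_iff' measurableSet_Ioo).2 (Eventually.of_forall fun x hx =>
        hv.tendsto_at (Ioo_subset_Icc_self hx))
  simp only [h.mass] at h1
  exact tendsto_nhds_unique h1 tendsto_const_nhds

theorem quadraticWherePos (h : TimeSlice L R n ε f f1 f3 E M q) (hj : Tendsto j atTop atTop)
    (hv : TendstoUniformlyOn (fun k => f (j k)) v atTop (Icc L R)) : QuadraticWherePos L R v :=
  quadraticWherePos_of_limit (fun k => h.slice (j k)) (fun k => h.int (j k))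
    (h.diss.comp hj) hv

theorem integrable_one_sub_mul (h : TimeSlice L R n ε f f1 f3 E M q) {φ : ℝ → ℝ}
    (hφ : Continuous φ) : IntegrableOn (fun x => (1 - q x) * φ x) (Ioo L R) := by
  obtain ⟨C, -, hC⟩ := ContDiff.exists_abs_bound (a := L) (b := R) hφ.continuousOn
  have h1 : IntegrableOn (fun x => 1 - q x) (Ioo L R) := (integrable_const 1).sub h.q_int
  exact (h1.bdd_mul hφ.aestronglyMeasurable ((ae_restrict_iff' measurableSet_Ioo).2
    (Eventually.of_forall fun x hx => hC x (Ioo_subset_Icc_self hx)))).congr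
    (Eventually.of_forall fun x => mul_comm _ _)

/-- Near a point where `v > 0` the solutions lie between positive constants `η` and `M`, and `B^ε`
of both tends to one. The mean value of `q` against a bump there equals that of `1`, and `q ≤ 1`
forces `q = 1` where the bump is positive. -/
theorem pos_subset (h : TimeSlice L R n ε f f1 f3 E M q) (hj : Tendsto j atTop atTop)
    (hv : TendstoUniformlyOn (fun k => f (j k)) v atTop (Icc L R)) :
    {x ∈ Ioo L R | 0 < v x} ⊆ apparentSupport L R q := by
  rintro x ⟨hx, hvx⟩
  have hx' := Ioo_subset_Icc_self hx
  have hca : ContinuousAt v x := (h.limit_continuousOn hv).continuousAt (Icc_mem_nhds hx.1 hx.2)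
  set η := v x / 3
  have hη : 0 < η := by simp only [η]; linarith
  have hnb : {y | 2 * η < v y} ∩ Ioo L R ∈ 𝓝 x :=
    inter_mem (hca.eventually_const_lt (by simp only [η]; linarith)) (Ioo_mem_nhds hx.1 hx.2)
  obtain ⟨a, b, hxab, hab⟩ := mem_nhds_iff_exists_Ioo_subset.1 hnb
  obtain ⟨r, c, hr, hra, hrb, hcx⟩ := exists_rat_bump hxab.1 hxab.2
  have hIoo : Ioo a b ⊆ Ioo L R := fun y hy => (hab hy).2
  have hrL : L < (c : ℝ) - 2 * r := (hIoo ⟨hra, by linarith⟩ : (c : ℝ) - 2 * r ∈ Ioo L R).1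
  have hrR : (c : ℝ) + 2 * r < R := (hIoo ⟨by linarith, hrb⟩ : (c : ℝ) + 2 * r ∈ Ioo L R).2
  have hbz : ∀ y, y ∉ Ioo a b → bump r c y = 0 := fun y hy => by
    apply bump_eq_zero
    by_contra hlt
    rw [not_le, abs_lt] at hlt
    exact hy ⟨by linarith, by linarith⟩
  have hbc : Continuous (bump r c) := (contDiff_bump r c).continuous
  have hm := (h.mean r c hr hrL hrR).comp hj
  have hB : ∀ s, 0 < s → Tendsto (fun k => Beps n (ε (j k)) s * ∫ y in Ioo L R, bump r c y) atTop
      (𝓝 (∫ y in Ioo L R, bump r c y)) := fun s hs => by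
    have := ((tendsto_Beps h.exponent h.eps h.lim hs).comp hj).mul_const
      (∫ y in Ioo L R, bump r c y)
    simpa using this
  have hlow : ∀ᶠ k in atTop, Beps n (ε (j k)) η * ∫ y in Ioo L R, bump r c y
      ≤ ∫ y in Ioo L R, Beps n (ε (j k)) (f (j k) y) * bump r c y := by
    filter_upwards [Metric.tendstoUniformlyOn_iff.1 hv η hη] with k hk
    have hcB : ContinuousOn (fun y => Beps n (ε (j k)) (f (j k) y)) (Icc L R) :=
      (continuousOn_Beps h.exponent (h.eps _)).comp (h.slice _).cont (h.slice _).nonneg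
    rw [← integral_const_mul]
    refine setIntegral_mono_on ?_ ?_ measurableSet_Ioo fun y hy => ?_
    · exact (continuousOn_const.mul hbc.continuousOn).integrableOn_Icc.mono_set Ioo_subset_Icc_self
    · exact (hcB.mul hbc.continuousOn).integrableOn_Icc.mono_set Ioo_subset_Icc_self
    · by_cases hyab : y ∈ Ioo a b
      · refine mul_le_mul_of_nonneg_right ?_ (bump_nonneg _ _ _)
        have h1 := hk y (Ioo_subset_Icc_self hy)
        rw [Real.dist_eq, abs_lt] at h1
        have h2 : 2 * η < v y := (hab hyab).1
        exact monotoneOn_Beps h.exponent (h.eps _) hη.le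
          ((h.slice _).nonneg y (Ioo_subset_Icc_self hy)) (by linarith)
      · rw [hbz y hyab]; simp
  have hup : ∀ k, ∫ y in Ioo L R, Beps n (ε (j k)) (f (j k) y) * bump r c y
      ≤ Beps n (ε (j k)) M * ∫ y in Ioo L R, bump r c y := by
    intro k
    have hcB : ContinuousOn (fun y => Beps n (ε (j k)) (f (j k) y)) (Icc L R) :=
      (continuousOn_Beps h.exponent (h.eps _)).comp (h.slice _).cont (h.slice _).nonneg
    rw [← integral_const_mul]
    refine setIntegral_mono_on ?_ ?_ measurableSet_Ioo fun y hy => ?_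
    · exact (hcB.mul hbc.continuousOn).integrableOn_Icc.mono_set Ioo_subset_Icc_self
    · exact (continuousOn_const.mul hbc.continuousOn).integrableOn_Icc.mono_set Ioo_subset_Icc_self
    · exact mul_le_mul_of_nonneg_right (monotoneOn_Beps h.exponent (h.eps _)
        ((h.slice _).nonneg y (Ioo_subset_Icc_self hy)) h.M_pos.le
        (h.le_sup _ y (Ioo_subset_Icc_self hy))) (bump_nonneg _ _ _)
  have hsq := tendsto_of_tendsto_of_tendsto_of_le_of_le' (hB η hη) (hB M h.M_pos) hlow
    (Eventually.of_forall hup)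
  have heq : ∫ y in Ioo L R, q y * bump r c y = ∫ y in Ioo L R, bump r c y :=
    tendsto_nhds_unique hm hsq
  have hqi : IntegrableOn (fun y => q y * bump r c y) (Ioo L R) := by
    have hb : IntegrableOn (bump r c) (Ioo L R) :=
      hbc.continuousOn.integrableOn_Icc.mono_set Ioo_subset_Icc_self
    refine (hb.sub (h.integrable_one_sub_mul hbc)).congr (Eventually.of_forall fun y => ?_)
    simp only [Pi.sub_apply]; ring
  have hz : ∫ y in Ioo L R, (1 - q y) * bump r c y = 0 := by
    have hb : IntegrableOn (bump r c) (Ioo L R) :=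
      hbc.continuousOn.integrableOn_Icc.mono_set Ioo_subset_Icc_self
    simp only [sub_mul, one_mul]
    rw [integral_sub hb hqi, heq, sub_self]
  have hnn : 0 ≤ᵐ[volume.restrict (Ioo L R)] fun y => (1 - q y) * bump r c y := by
    refine (ae_restrict_iff' measurableSet_Ioo).2 ?_
    filter_upwards [h.q_le] with y hy hyI
    exact mul_nonneg (by linarith [hy hyI]) (bump_nonneg _ _ _)
  have hae := (ae_restrict_iff' measurableSet_Ioo).1
    ((setIntegral_eq_zero_iff_of_nonneg_ae hnn (h.integrable_one_sub_mul hbc)).1 hz)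
  refine ⟨hx, r - |(c : ℝ) - x|, by linarith, ?_⟩
  refine setIntegral_eq_zero_of_ae_eq_zero ?_
  filter_upwards [hae] with y hy hyB
  have h1 : |x - y| < r - |(c : ℝ) - x| := by
    have := hyB.1
    rwa [Metric.mem_ball, dist_comm, Real.dist_eq] at this
  have h2 : |(c : ℝ) - y| ≤ r := by
    have := abs_sub_le (c : ℝ) x y
    linarith
  have h3 := hy hyB.2
  simp only [Pi.zero_apply, bump_eq_one hr h2, mul_one] at h3
  exact h3

/-- At a frontier point in `(L,R)` the limit vanishes, with positive values arbitrarily close. In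
the apparent support `q = 1` nearby since `q ≤ 1`, so the source tested with a squared bump tends to
zero, which a contact point forbids. -/
theorem frontier_inter (h : TimeSlice L R n ε f f1 f3 E M q) (hj : Tendsto j atTop atTop)
    (hv : TendstoUniformlyOn (fun k => f (j k)) v atTop (Icc L R)) :
    frontier {x ∈ Ioo L R | 0 < v x} ∩ apparentSupport L R q = ∅ := by
  have hvc := h.limit_continuousOn hv
  have hopen : IsOpen {x ∈ Ioo L R | 0 < v x} :=
    (hvc.mono Ioo_subset_Icc_self).isOpen_inter_preimage isOpen_Ioo isOpen_Ioi
  refine eq_empty_of_forall_notMem ?_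
  rintro x ⟨hxf, hx, δ, hδ, hint⟩
  rw [hopen.frontier_eq] at hxf
  have hvx : v x = 0 := by
    refine le_antisymm (not_lt.1 fun hlt => hxf.2 ⟨hx, hlt⟩)
      (h.limit_nonneg hv (Ioo_subset_Icc_self hx))
  have hsub : Metric.ball x δ ∩ Ioo L R ⊆ Ioo L R := inter_subset_right
  have hmeas : MeasurableSet (Metric.ball x δ ∩ Ioo L R) :=
    measurableSet_ball.inter measurableSet_Ioo
  have hi : IntegrableOn (fun y => 1 - q y) (Metric.ball x δ ∩ Ioo L R) :=
    IntegrableOn.mono_set ((integrable_const 1).sub h.q_int) hsub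
  have hnn : 0 ≤ᵐ[volume.restrict (Metric.ball x δ ∩ Ioo L R)] fun y => 1 - q y := by
    refine (ae_restrict_iff' hmeas).2 ?_
    filter_upwards [h.q_le] with y hy hyI
    exact sub_nonneg.2 (hy hyI.2)
  have hae := (ae_restrict_iff' hmeas).1
    ((setIntegral_eq_zero_iff_of_nonneg_ae hnn hi).1 hint)
  obtain ⟨r, c, hr, hra, hrb, hcx⟩ := exists_rat_bump
    (show max L (x - δ) < x from max_lt hx.1 (by linarith))
    (show x < min R (x + δ) from lt_min hx.2 (by linarith))
  rw [max_lt_iff] at hra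
  rw [lt_min_iff] at hrb
  rw [abs_lt] at hcx
  have hIoo : Ioo ((c : ℝ) - r) (c + r) ∈ 𝓝 x := Ioo_mem_nhds (by linarith) (by linarith)
  obtain ⟨y, hy1, hy2, hy3⟩ := mem_closure_iff_nhds.1 hxf.1 _ hIoo
  -- The bump is supported in the ball on which `q = 1`, so its mean value is maximal.
  have hsrc := h.source r c hr hra.1 hrb.1 (by
    refine setIntegral_congr_ae measurableSet_Ioo ?_
    filter_upwards [hae] with z hz hzI
    by_cases hzb : z ∈ Metric.ball x δ
    · have : 1 - q z = 0 := hz ⟨hzb, hzI⟩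
      rw [show q z = 1 by linarith, one_mul]
    · rw [bump_eq_zero]
      · simp
      · by_contra hlt
        rw [not_le, abs_lt] at hlt
        apply hzb
        rw [Metric.mem_ball, Real.dist_eq, abs_lt]
        constructor <;> linarith [hra.2, hrb.2])
  refine not_tendsto_zero_of_contact (fun k => h.slice (j k)) (fun k => h.int (j k))
    (h.diss.comp hj) (fun k => h.energy (j k)) hv (isTest_bump hra.1 hrb.1) hx hy2 hvx hy3
    (fun z hz => bump_eq_one hr ?_) (hsrc.comp hj)
  -- The point `y` of positivity was chosen on the plateau of the bump, so the whole segment from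
  -- `x` to `y` lies on it.
  have hzI : z ∈ Ioo ((c : ℝ) - r) (c + r) :=
    ordConnected_Ioo.uIcc_subset ⟨by linarith, by linarith⟩ hy1 hz
  rw [abs_le]; constructor <;> linarith [hzI.1, hzI.2]

theorem third_deriv (h : TimeSlice L R n ε f f1 f3 E M q) (hj : Tendsto j atTop atTop)
    (hv : TendstoUniformlyOn (fun k => f (j k)) v atTop (Icc L R)) {x : ℝ} (hx : x ∈ Ioo L R)
    (hvx : 0 < v x) : HasDerivAt v (deriv v x) x ∧ HasDerivAt (deriv v) (deriv (deriv v) x) x ∧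
      HasDerivAt (deriv (deriv v)) 0 x := by
  have hca : ContinuousAt v x := (h.limit_continuousOn hv).continuousAt (Icc_mem_nhds hx.1 hx.2)
  have hnb : {y | 0 < v y} ∩ Ioo L R ∈ 𝓝 x :=
    inter_mem (hca.eventually_const_lt hvx) (Ioo_mem_nhds hx.1 hx.2)
  obtain ⟨a, b, hxab, hab⟩ := mem_nhds_iff_exists_Ioo_subset.1 hnb
  have hsub : Icc ((a + x) / 2) ((x + b) / 2) ⊆ Ioo a b := fun y hy =>
    ⟨by linarith [hy.1, hxab.1], by linarith [hy.2, hxab.2]⟩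
  have hc : (a + x) / 2 < x := by linarith [hxab.1]
  have hd : x < (x + b) / 2 := by linarith [hxab.2]
  obtain ⟨A, B, C, hq, -, -⟩ := h.quadraticWherePos hj hv ((a + x) / 2) ((x + b) / 2)
    (hab (hsub (left_mem_Icc.2 (hc.trans hd).le))).2.1.le (hc.trans hd)
    (hab (hsub (right_mem_Icc.2 (hc.trans hd).le))).2.2.le fun y hy => (hab (hsub hy)).1
  have e0 : v =ᶠ[𝓝 x] fun y => A + B * y + C * y ^ 2 := by
    filter_upwards [Icc_mem_nhds hc hd] with y hy using hq y hy
  have d1 : ∀ y, HasDerivAt (fun y => A + B * y + C * y ^ 2) (B + 2 * C * y) y := fun y => by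
    convert! (((hasDerivAt_id y).const_mul B).const_add A).add
      (((hasDerivAt_id y).fun_pow 2).const_mul C) using 1
    simp; ring
  have d2 : ∀ y, HasDerivAt (fun y => B + 2 * C * y) (2 * C) y := fun y => by
    convert! ((hasDerivAt_id y).const_mul (2 * C)).const_add B using 1
    simp
  have e1 : deriv v =ᶠ[𝓝 x] fun y => B + 2 * C * y := by
    filter_upwards [e0.deriv] with y hy using hy.trans (d1 y).deriv
  have e2 : deriv (deriv v) =ᶠ[𝓝 x] fun _ => 2 * C := by
    filter_upwards [e1.deriv] with y hy using hy.trans (d2 y).deriv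
  refine ⟨?_, ?_, ?_⟩
  · rw [e1.eq_of_nhds]; exact (d1 x).congr_of_eventuallyEq e0
  · rw [e2.eq_of_nhds]; exact (d2 x).congr_of_eventuallyEq e1
  · exact (hasDerivAt_const x (2 * C)).congr_of_eventuallyEq e2

theorem isProfile (h : TimeSlice L R n ε f f1 f3 E M q) (hj : Tendsto j atTop atTop)
    (hv : TendstoUniformlyOn (fun k => f (j k)) v atTop (Icc L R)) :
    IsProfile L R (apparentSupport L R q) v :=
  ⟨⟨deriv v, deriv (deriv v), fun _ hx hvx => h.third_deriv hj hv hx hvx⟩,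
    h.limit_mass hv, h.pos_subset hj hv, h.frontier_inter hj hv⟩

end TimeSlice

/-! ### The parabola -/

/-- The parabola of unit mass over `(a,b)`, extended by zero. -/
noncomputable def parabola (a b x : ℝ) : ℝ := 6 / (b - a) ^ 3 * (max (x - a) 0 * max (b - x) 0)

/-- The derivative of `parabola a b`. -/
noncomputable def parabolaDeriv (a b : ℝ) : ℝ → ℝ :=
  (Ioo a b).indicator fun x => 6 / (b - a) ^ 3 * (a + b - 2 * x)

theorem parabola_of_mem {a b x : ℝ} (hx : x ∈ Icc a b) :
    parabola a b x = 6 / (b - a) ^ 3 * ((x - a) * (b - x)) := by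
  rw [parabola, max_eq_left (by linarith [hx.1]), max_eq_left (by linarith [hx.2])]

theorem parabola_of_notMem {a b x : ℝ} (hx : x ∉ Ioo a b) : parabola a b x = 0 := by
  rw [parabola]
  by_cases h : a < x
  · rw [max_eq_right (a := b - x) (by linarith [not_lt.1 fun h' => hx ⟨h, h'⟩])]; ring
  · rw [max_eq_right (a := x - a) (by linarith [not_lt.1 h])]; ring

theorem continuous_parabola (a b : ℝ) : Continuous (parabola a b) := by
  unfold parabola; fun_prop

theorem hasDerivAt_parabola_formula (a b x : ℝ) :
    HasDerivAt (fun x => 6 / (b - a) ^ 3 * ((x - a) * (b - x)))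
      (6 / (b - a) ^ 3 * (a + b - 2 * x)) x := by
  convert! (((hasDerivAt_id x).sub_const a).fun_mul ((hasDerivAt_id x).const_sub b)).const_mul
    (6 / (b - a) ^ 3) using 1
  simp only [id_eq]; ring

theorem parabola_integral_mul {a b L R : ℝ} (hLa : L ≤ a) (hab : a < b) (hbR : b ≤ R)
    {g : ℝ → ℝ} (hg : ContDiff ℝ ∞ g) :
    ∫ x in Ioo L R, parabola a b x * deriv g x = -∫ x in Ioo L R, parabolaDeriv a b x * g x := by
  have hsub : Ioo a b ⊆ Ioo L R := Ioo_subset_Ioo hLa hbR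
  have e1 : ∫ x in Ioo L R, parabola a b x * deriv g x
      = ∫ x in a..b, (6 / (b - a) ^ 3 * ((x - a) * (b - x))) * deriv g x := by
    rw [intervalIntegral.integral_of_le hab.le, ← setIntegral_congr_set Ioo_ae_eq_Ioc,
      setIntegral_eq_of_subset_of_forall_sdiff_eq_zero measurableSet_Ioo hsub
        (f := fun x => parabola a b x * deriv g x) fun x hx => by
        rw [parabola_of_notMem hx.2, zero_mul]]
    refine setIntegral_congr_fun measurableSet_Ioo fun x hx => ?_
    simp only [parabola_of_mem (Ioo_subset_Icc_self hx)]
  have e2 : ∫ x in Ioo L R, parabolaDeriv a b x * g x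
      = ∫ x in a..b, (6 / (b - a) ^ 3 * (a + b - 2 * x)) * g x := by
    rw [intervalIntegral.integral_of_le hab.le, ← setIntegral_congr_set Ioo_ae_eq_Ioc,
      setIntegral_eq_of_subset_of_forall_sdiff_eq_zero measurableSet_Ioo hsub
        (f := fun x => parabolaDeriv a b x * g x) fun x hx => by
        rw [parabolaDeriv, indicator_of_notMem hx.2, zero_mul]]
    refine setIntegral_congr_fun measurableSet_Ioo fun x hx => ?_
    simp only [parabolaDeriv, indicator_of_mem hx]
  have hgd : Continuous (deriv g) := hg.continuous_deriv (by simp)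
  rw [e1, e2, intervalIntegral.integral_mul_deriv_eq_deriv_mul
    (fun x _ => hasDerivAt_parabola_formula a b x)
    (fun x _ => (hg.differentiable (by simp)).differentiableAt.hasDerivAt)
    (Continuous.intervalIntegrable (by fun_prop) _ _) (hgd.intervalIntegrable _ _)]
  simp

theorem integral_parabola {a b : ℝ} (hab : a < b) : ∫ x in Ioo a b, parabola a b x = 1 := by
  have hd : ∀ x, HasDerivAt (fun x => 6 / (b - a) ^ 3 * ((a + b) * x ^ 2 / 2 - x ^ 3 / 3 - a * b * x))
      (6 / (b - a) ^ 3 * ((x - a) * (b - x))) x := fun x => by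
    convert! ((((((hasDerivAt_id x).fun_pow 2).const_mul (a + b)).div_const 2).sub
      (((hasDerivAt_id x).fun_pow 3).div_const 3)).sub
      ((hasDerivAt_id x).const_mul (a * b))).const_mul (6 / (b - a) ^ 3) using 1
    simp only [id_eq, Nat.cast_ofNat]; ring
  rw [setIntegral_congr_fun measurableSet_Ioo fun x hx => parabola_of_mem (Ioo_subset_Icc_self hx),
    setIntegral_congr_set Ioo_ae_eq_Ioc, ← intervalIntegral.integral_of_le hab.le,
    intervalIntegral.integral_eq_sub_of_hasDerivAt (fun x _ => hd x)
      (Continuous.intervalIntegrable (by fun_prop) _ _)]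
  have : b - a ≠ 0 := by linarith
  field_simp
  ring

theorem memLp_parabolaDeriv (a b L R : ℝ) :
    MemLp (parabolaDeriv a b) 2 (volume.restrict (Ioo L R)) := by
  have hc : Continuous fun x : ℝ => 6 / (b - a) ^ 3 * (a + b - 2 * x) := by fun_prop
  obtain ⟨C, hC0, hC⟩ := ContDiff.exists_abs_bound (a := a) (b := b) hc.continuousOn
  refine MemLp.of_bound (hc.aestronglyMeasurable.indicator measurableSet_Ioo) C
    (Eventually.of_forall fun x => ?_)
  by_cases hx : x ∈ Ioo a b
  · rw [parabolaDeriv, indicator_of_mem hx]; exact hC x (Ioo_subset_Icc_self hx)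
  · rw [parabolaDeriv, indicator_of_notMem hx, norm_zero]; exact hC0

theorem hasH1Deriv_parabola {a b L R : ℝ} (hLa : L ≤ a) (hab : a < b) (hbR : b ≤ R) :
    HasH1Deriv L R (parabola a b) (parabolaDeriv a b) := by
  have h1 := memLp_parabolaDeriv a b L R
  have h0 : MemLp (parabola a b) 2 (volume.restrict (Ioo L R)) := by
    obtain ⟨C, -, hC⟩ := ContDiff.exists_abs_bound (a := L) (b := R)
      (continuous_parabola a b).continuousOn
    exact MemLp.of_bound (continuous_parabola a b).aestronglyMeasurable C
      ((ae_restrict_iff' measurableSet_Ioo).2 (Eventually.of_forall fun x hx =>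
        hC x (Ioo_subset_Icc_self hx)))
  refine ⟨h0, h1, (continuous_parabola a b).locallyIntegrable.locallyIntegrableOn _,
    IntegrableOn.locallyIntegrableOn (h1.integrable (by norm_num)), fun φ hφ => ?_⟩
  simp only [iteratedDeriv_one, pow_one, neg_mul, one_mul]
  exact parabola_integral_mul hLa hab hbR hφ.1

/-! ### Weak convergence in `L²` -/

/-- Smooth functions of compact support are dense in `L²`, and the error of approximation is
controlled uniformly in `k` by the bound on the norms. -/
theorem tendsto_integral_mul_of_bounded {μ : Measure ℝ} [IsFiniteMeasure μ] {h : ℕ → ℝ → ℝ} {C : ℝ}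
    (hm : ∀ k, MemLp (h k) 2 μ) (hC : ∀ k, ∫ x, h k x ^ 2 ∂μ ≤ C)
    (hg : ∀ g : ℝ → ℝ, HasCompactSupport g → ContDiff ℝ ∞ g →
      Tendsto (fun k => ∫ x, h k x * g x ∂μ) atTop (𝓝 0)) {d : ℝ → ℝ} (hd : MemLp d 2 μ) :
    Tendsto (fun k => ∫ x, h k x * d x ∂μ) atTop (𝓝 0) := by
  have hC0 : 0 ≤ C := (integral_nonneg fun x => sq_nonneg _).trans (hC 0)
  rw [Metric.tendsto_atTop]
  intro e he
  -- In Young's inequality the term with `h k ^ 2` then costs at most `κ C ≤ e / 4`, and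
  -- approximating `d` with squared error `κ e / 4` makes the other term `e / 4` as well.
  set κ := e / (4 * (C + 1)) with hκ
  have hκ0 : 0 < κ := by positivity
  have hs : 0 < κ * e / 4 := by positivity
  obtain ⟨g, hgc, hgs, hgd⟩ := MeasureTheory.MemLp.exist_eLpNorm_sub_le (p := 2) (by norm_num)
    (by norm_num) hd (Real.sqrt_pos.2 hs)
  have hgm : MemLp g 2 μ := hgs.continuous.memLp_of_hasCompactSupport hgc
  have hdg : MemLp (fun x => d x - g x) 2 μ := hd.sub hgm
  have hsq : ∫ x, (d x - g x) ^ 2 ∂μ ≤ κ * e / 4 := by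
    have e1 := hdg.eLpNorm_eq_integral_rpow_norm (by norm_num) (by norm_num)
    have e2 : eLpNorm (fun x => d x - g x) 2 μ ≤ ENNReal.ofReal √(κ * e / 4) := hgd
    rw [e1, ENNReal.ofReal_le_ofReal_iff (Real.sqrt_nonneg _)] at e2
    simp only [ENNReal.toReal_ofNat, Real.rpow_ofNat, Real.norm_eq_abs, sq_abs] at e2
    rw [show (2 : ℝ)⁻¹ = 1 / 2 by norm_num, ← Real.sqrt_eq_rpow] at e2
    exact (Real.sqrt_le_sqrt_iff hs.le).1 e2
  have i2 := (memLp_two_iff_integrable_sq hdg.1).1 hdg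
  obtain ⟨N, hN⟩ := Metric.tendsto_atTop.1 (hg g hgc hgs) (e / 4) (by positivity)
  refine ⟨N, fun k hk => ?_⟩
  have i1 := (memLp_two_iff_integrable_sq (hm k).1).1 (hm k)
  have j1 : Integrable (fun x => h k x * g x) μ := (hm k).integrable_mul hgm
  have j2 : Integrable (fun x => h k x * (d x - g x)) μ := (hm k).integrable_mul hdg
  have hN' := hN k hk
  rw [Real.dist_eq, sub_zero] at hN' ⊢
  have hsplit : ∫ x, h k x * d x ∂μ = (∫ x, h k x * g x ∂μ) + ∫ x, h k x * (d x - g x) ∂μ := by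
    rw [← integral_add j1 j2]
    congr 1; ext x; ring
  have hrem : |∫ x, h k x * (d x - g x) ∂μ| ≤ κ * C + (κ * e / 4) / κ := by
    calc |∫ x, h k x * (d x - g x) ∂μ| ≤ ∫ x, |h k x * (d x - g x)| ∂μ :=
          abs_integral_le_integral_abs
      _ ≤ ∫ x, (κ * h k x ^ 2 + (d x - g x) ^ 2 / κ) ∂μ := by
          refine integral_mono j2.abs ((i1.const_mul κ).add (i2.div_const κ)) fun x => ?_
          simp only
          have e1 : 0 ≤ (κ * |h k x| - |d x - g x|) ^ 2 / κ := by positivity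
          have e2 : (κ * |h k x| - |d x - g x|) ^ 2 / κ
              = κ * h k x ^ 2 - 2 * (|h k x| * |d x - g x|) + (d x - g x) ^ 2 / κ := by
            rw [← sq_abs (h k x), ← sq_abs (d x - g x)]; field_simp; ring
          have e3 : 0 ≤ |h k x| * |d x - g x| := by positivity
          rw [abs_mul]; linarith
      _ ≤ _ := by
          rw [integral_add (i1.const_mul κ) (i2.div_const κ), integral_const_mul, integral_div]
          have := hC k
          gcongr
  have h3 : (κ * e / 4) / κ = e / 4 := by field_simp
  have h4 : κ * C ≤ e / 4 := by
    have h5 : κ * (C + 1) = e / 4 := by rw [hκ]; field_simp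
    nlinarith
  rw [hsplit]
  have := abs_add_le (∫ x, h k x * g x ∂μ) (∫ x, h k x * (d x - g x) ∂μ)
  linarith

theorem integrable_mul_of_memLp_two {μ : Measure ℝ} {f g : ℝ → ℝ} (hf : MemLp f 2 μ)
    (hg : MemLp g 2 μ) : Integrable (fun x => f x * g x) μ :=
  hf.integrable_mul hg

namespace TimeSlice

variable {L R n E M : ℝ} {ε : ℕ → ℝ} {f f1 f3 : ℕ → ℝ → ℝ} {q : ℝ → ℝ} {j : ℕ → ℕ} {v : ℝ → ℝ}

/-- Within `(a,b)` the positivity set is open, closed because its frontier avoids `(a,b)`, and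
nonempty because the mass is one; connectedness makes it all of `(a,b)`. A quadratic vanishing at
`a` and `b` is determined by its mass. -/
theorem eqOn_parabola (h : TimeSlice L R n ε f f1 f3 E M q) (hj : Tendsto j atTop atTop)
    (hv : TendstoUniformlyOn (fun k => f (j k)) v atTop (Icc L R)) {a b : ℝ} (hLa : L < a)
    (hab : a < b) (hbR : b < R) (hq : apparentSupport L R q = Ioo a b) :
    EqOn v (parabola a b) (Icc L R) := by
  have hvc := h.limit_continuousOn hv
  have hopen : IsOpen {x ∈ Ioo L R | 0 < v x} :=
    (hvc.mono Ioo_subset_Icc_self).isOpen_inter_preimage isOpen_Ioo isOpen_Ioi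
  have hsub : {x ∈ Ioo L R | 0 < v x} ⊆ Ioo a b := hq ▸ h.pos_subset hj hv
  have hfr := h.frontier_inter hj hv
  rw [hq] at hfr
  have hz : ∀ x ∈ Ioo L R, x ∉ Ioo a b → v x = 0 := fun x hx hxab =>
    le_antisymm (not_lt.1 fun hlt => hxab (hsub ⟨hx, hlt⟩))
      (h.limit_nonneg hv (Ioo_subset_Icc_self hx))
  have hIoo : Ioo a b ⊆ Ioo L R := Ioo_subset_Ioo hLa.le hbR.le
  have hmass := h.limit_mass hv
  have hpos : Ioo a b ⊆ {x ∈ Ioo L R | 0 < v x} := by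
    refine isPreconnected_Ioo.subset_of_closure_inter_subset hopen ?_ ?_
    · by_contra hne
      rw [not_nonempty_iff_eq_empty] at hne
      have h0 : ∀ x ∈ Ioo L R, v x = 0 := fun x hx => by
        by_cases hxab : x ∈ Ioo a b
        · refine le_antisymm (not_lt.1 fun hlt => ?_) (h.limit_nonneg hv (Ioo_subset_Icc_self hx))
          exact (hne ▸ (⟨hxab, hx, hlt⟩ : x ∈ Ioo a b ∩ {x ∈ Ioo L R | 0 < v x}) : x ∈ (∅ : Set ℝ))
        · exact hz x hx hxab
      rw [setIntegral_congr_fun measurableSet_Ioo h0] at hmass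
      simp at hmass
    · rintro x ⟨hxc, hxab⟩
      by_contra hxP
      have : x ∈ frontier {x ∈ Ioo L R | 0 < v x} ∩ Ioo a b :=
        ⟨by rw [hopen.frontier_eq]; exact ⟨hxc, hxP⟩, hxab⟩
      rw [hfr] at this
      exact this
  obtain ⟨A, B, C, hABC, -⟩ := (h.quadraticWherePos hj hv).exists_on_component hvc hLa.le hab hbR.le
    fun x hx => (hpos hx).2
  have ha := hABC a (left_mem_Icc.2 hab.le)
  have hb := hABC b (right_mem_Icc.2 hab.le)
  rw [hz a ⟨hLa, hab.trans hbR⟩ (by simp)] at ha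
  rw [hz b ⟨hLa.trans hab, hbR⟩ (by simp)] at hb
  have hba : b - a ≠ 0 := by linarith
  have hB : B = -C * (a + b) := by
    have : (b - a) * (B + C * (a + b)) = 0 := by linarith
    linarith [(mul_eq_zero.1 this).resolve_left hba]
  have hform : ∀ x ∈ Ioo a b, v x = -C * (b - a) ^ 3 / 6 * parabola a b x := by
    intro x hx
    rw [parabola_of_mem (Ioo_subset_Icc_self hx), hABC x (Ioo_subset_Icc_self hx)]
    have hA : A = C * (a * b) := by rw [hB] at ha; linarith
    rw [hA, hB]
    field_simp
    ring
  have hC : -C * (b - a) ^ 3 / 6 = 1 := by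
    rw [setIntegral_eq_of_subset_of_forall_sdiff_eq_zero measurableSet_Ioo hIoo
      (f := v) fun x hx => hz x hx.1 hx.2, setIntegral_congr_fun measurableSet_Ioo hform,
      integral_const_mul, integral_parabola hab, mul_one] at hmass
    exact hmass
  have heq : EqOn v (parabola a b) (Ioo L R) := fun x hx => by
    by_cases hxab : x ∈ Ioo a b
    · rw [hform x hxab, hC, one_mul]
    · rw [hz x hx hxab, parabola_of_notMem hxab]
  exact heq.of_subset_closure hvc (continuous_parabola a b).continuousOn Ioo_subset_Icc_self
    (by rw [closure_Ioo h.lt.ne])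

theorem E_nonneg (h : TimeSlice L R n ε f f1 f3 E M q) : 0 ≤ E :=
  (integral_nonneg fun _ => sq_nonneg _).trans (h.energy 0)

/-- If all uniform limits of subsequences agree, then the whole sequence converges uniformly. -/
theorem tendstoUniformlyOn_of_unique (h : TimeSlice L R n ε f f1 f3 E M q) {w : ℝ → ℝ}
    (hw : ContinuousOn w (Icc L R))
    (huniq : ∀ (j : ℕ → ℕ) (v : ℝ → ℝ), Tendsto j atTop atTop →
      TendstoUniformlyOn (fun k => f (j k)) v atTop (Icc L R) → EqOn v w (Icc L R)) :
    TendstoUniformlyOn f w atTop (Icc L R) := by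
  let toB (g : ℝ → ℝ) (hg : ContinuousOn g (Icc L R)) : BoundedContinuousFunction (Icc L R) ℝ :=
    BoundedContinuousFunction.mkOfCompact ⟨(Icc L R).domRestrict g, hg.domRestrict⟩
  let g : ℕ → BoundedContinuousFunction (Icc L R) ℝ := fun k => toB (f k) (h.slice k).cont
  have hgval : ∀ k (x : Icc L R), g k x = f k x := fun _ _ => rfl
  have hcomp : IsCompact (closure (range g)) := by
    refine BoundedContinuousFunction.arzela_ascoli (Icc 0 M) isCompact_Icc (range g) ?_ ?_
    · rintro _ x ⟨k, rfl⟩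
      exact ⟨(h.slice k).nonneg x x.2, h.le_sup k x x.2⟩
    · intro x0
      rw [Metric.equicontinuousAt_iff]
      intro e he
      have hE := h.E_nonneg
      -- This makes `E / κ ≤ e / 2`; `E + 1` instead of `E` keeps `κ` positive.
      set κ := 2 * (E + 1) / e with hκ
      have hκ0 : 0 < κ := by positivity
      refine ⟨e / (2 * κ), by positivity, ?_⟩
      rintro x hx ⟨_, k, rfl⟩
      have h1 := h.holder k κ hκ0 x0 x0.2 x x.2
      rw [Subtype.dist_eq, dist_comm, Real.dist_eq] at hx
      have h2 : κ * |(x0 : ℝ) - x| < e / 2 := by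
        calc κ * |(x0 : ℝ) - x| < κ * (e / (2 * κ)) := by gcongr
          _ = e / 2 := by field_simp
      have h3 : E / κ ≤ e / 2 := by
        rw [div_le_iff₀ hκ0, hκ]; field_simp; linarith
      change dist (f k x0) (f k x) < e
      rw [Real.dist_eq]
      linarith
  have hlim : Tendsto g atTop (𝓝 (toB w hw)) := by
    -- The index sequence `ns` tends to infinity without being increasing, which is why uniqueness
    -- is assumed along all such sequences.
    refine tendsto_of_subseq_tendsto fun ns hns => ?_
    obtain ⟨G, -, φ, hφ, hG⟩ := hcomp.tendsto_subseq
      (x := fun k => g (ns k)) fun k => subset_closure (mem_range_self _)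
    refine ⟨φ, ?_⟩
    let v : ℝ → ℝ := fun x => if hx : x ∈ Icc L R then G ⟨x, hx⟩ else 0
    have hv : ∀ x : Icc L R, v x = G x := fun x => dif_pos x.2
    have hu := BoundedContinuousFunction.tendsto_iff_tendstoUniformly.1 hG
    have hu' : TendstoUniformlyOn (fun k => f (ns (φ k))) v atTop (Icc L R) := by
      rw [tendstoUniformlyOn_iff_tendstoUniformly_comp_coe]
      have e : v ∘ (Subtype.val : Icc L R → ℝ) = G := funext hv
      rw [e]
      exact hu
    have heq := huniq _ v (hns.comp hφ.tendsto_atTop) hu'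
    have : G = toB w hw := by
      ext x
      rw [← hv x]
      exact heq x.2
    rw [← this]
    exact hG
  rw [tendstoUniformlyOn_iff_tendstoUniformly_comp_coe]
  exact BoundedContinuousFunction.tendsto_iff_tendstoUniformly.1 hlim

theorem integral_deriv_mul (h : TimeSlice L R n ε f f1 f3 E M q) (k : ℕ) {g : ℝ → ℝ}
    (hg : ContDiff ℝ ∞ g) : ∫ x in Ioo L R, f1 k x * g x
      = f k R * g R - f k L * g L - ∫ x in Ioo L R, f k x * deriv g x := by
  have hgd : Continuous (deriv g) := hg.continuous_deriv (by simp)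
  have hs := h.slice k
  rw [setIntegral_congr_set Ioo_ae_eq_Ioc, ← intervalIntegral.integral_of_le h.lt.le,
    setIntegral_congr_set (Ioo_ae_eq_Ioc (a := L) (b := R)),
    ← intervalIntegral.integral_of_le h.lt.le,
    intervalIntegral.integral_mul_deriv_eq_deriv_mul_of_hasDerivAt (u' := f1 k)
      (by rw [uIcc_of_le h.lt.le]; exact hs.cont) hg.continuous.continuousOn
      (by rw [min_eq_left h.lt.le, max_eq_right h.lt.le]; exact hs.hasDerivAt)
      (fun x _ => (hg.differentiable (by simp)).differentiableAt.hasDerivAt)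
      (ContinuousOn.intervalIntegrable (by rw [uIcc_of_le h.lt.le]; exact hs.cont1))
      (hgd.intervalIntegrable _ _)]
  ring

theorem tendsto_integral_mul (h : TimeSlice L R n ε f f1 f3 E M q) {w ψ : ℝ → ℝ}
    (hw : TendstoUniformlyOn f w atTop (Icc L R)) (hψ : IntegrableOn ψ (Ioo L R)) :
    Tendsto (fun k => ∫ x in Ioo L R, f k x * ψ x) atTop (𝓝 (∫ x in Ioo L R, w x * ψ x)) := by
  refine tendsto_integral_of_dominated_convergence (fun x => M * |ψ x|) (fun k => ?_)
    (hψ.abs.const_mul M) (fun k => ?_) ?_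
  · exact (((h.slice k).cont.mono Ioo_subset_Icc_self).aestronglyMeasurable
      measurableSet_Ioo).mul hψ.aestronglyMeasurable
  · refine (ae_restrict_iff' measurableSet_Ioo).2 (Eventually.of_forall fun x hx => ?_)
    have hx' := Ioo_subset_Icc_self hx
    rw [norm_mul, Real.norm_of_nonneg ((h.slice k).nonneg x hx'), Real.norm_eq_abs]
    exact mul_le_mul_of_nonneg_right (h.le_sup k x hx') (abs_nonneg _)
  · exact (ae_restrict_iff' measurableSet_Ioo).2 (Eventually.of_forall fun x hx =>
      (hw.tendsto_at (Ioo_subset_Icc_self hx)).mul_const _)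

/-- The derivatives are bounded in `L²`, so smooth test functions suffice, and against these one
integrates by parts and uses uniform convergence. The test functions need not vanish at `L` and `R`;
the boundary terms disappear in the limit because the parabola vanishes there. -/
theorem tendstoWeakH1 (h : TimeSlice L R n ε f f1 f3 E M q) {a b : ℝ} (hLa : L < a)
    (hab : a < b) (hbR : b < R) (hw : TendstoUniformlyOn f (parabola a b) atTop (Icc L R)) :
    TendstoWeakH1 L R f (parabola a b) := by
  have hH := hasH1Deriv_parabola hLa.le hab hbR.le
  refine ⟨f1, parabolaDeriv a b, h.h1, hH, fun ψ dψ hψ => ?_⟩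
  have hd := hH.2.1
  have hdi := (memLp_two_iff_integrable_sq hd.1).1 hd
  have hfi : ∀ k, IntegrableOn (fun x => f1 k x ^ 2) (Ioo L R) := fun k =>
    (memLp_two_iff_integrable_sq (h.h1 k).2.1.1).1 (h.h1 k).2.1
  have hj2 : IntegrableOn (fun x => parabolaDeriv a b x * dψ x) (Ioo L R) :=
    integrable_mul_of_memLp_two hd hψ.2.1
  have hj1 : ∀ k, IntegrableOn (fun x => f1 k x * dψ x) (Ioo L R) := fun k =>
    integrable_mul_of_memLp_two (h.h1 k).2.1 hψ.2.1
  have key := tendsto_integral_mul_of_bounded (μ := volume.restrict (Ioo L R))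
    (h := fun k x => f1 k x - parabolaDeriv a b x)
    (C := 2 * E + 2 * ∫ x in Ioo L R, parabolaDeriv a b x ^ 2)
    (fun k => (h.h1 k).2.1.sub hd) (fun k => ?_) (fun g hgc hg => ?_) hψ.2.1
  · have h1 : Tendsto (fun k => ∫ x in Ioo L R, f1 k x * dψ x) atTop
        (𝓝 (∫ x in Ioo L R, parabolaDeriv a b x * dψ x)) := by
      have := key.add_const (∫ x in Ioo L R, parabolaDeriv a b x * dψ x)
      rw [zero_add] at this
      refine this.congr fun k => ?_
      simp only [sub_mul]
      rw [integral_sub (hj1 k) hj2, sub_add_cancel]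
    have h2 := h.tendsto_integral_mul hw (hψ.1.integrable (by norm_num))
    have h3 := h2.add h1
    rw [← integral_add (integrable_mul_of_memLp_two hH.1 hψ.1) hj2] at h3
    refine h3.congr fun k => ?_
    rw [← integral_add (integrable_mul_of_memLp_two (h.h1 k).1 hψ.1) (hj1 k)]
  · calc ∫ x in Ioo L R, (f1 k x - parabolaDeriv a b x) ^ 2
        ≤ ∫ x in Ioo L R, (2 * f1 k x ^ 2 + 2 * parabolaDeriv a b x ^ 2) := by
          refine integral_mono ?_ (((hfi k).const_mul 2).add (hdi.const_mul 2)) fun x => ?_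
          · have hm := (h.h1 k).2.1.sub hd
            exact (memLp_two_iff_integrable_sq hm.1).1 hm
          · simp only; nlinarith [sq_nonneg (f1 k x + parabolaDeriv a b x)]
      _ ≤ _ := by
          rw [integral_add ((hfi k).const_mul 2) (hdi.const_mul 2), integral_const_mul,
            integral_const_mul]
          have := h.energy k
          linarith
  · have hgd : Continuous (deriv g) := hg.continuous_deriv (by simp)
    have hgi : IntegrableOn (deriv g) (Ioo L R) :=
      hgd.continuousOn.integrableOn_Icc.mono_set Ioo_subset_Icc_self
    have hgm : MemLp g 2 (volume.restrict (Ioo L R)) :=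
      hg.continuous.memLp_of_hasCompactSupport hgc
    have hL : parabola a b L = 0 := parabola_of_notMem fun hx => by linarith [hx.1]
    have hR : parabola a b R = 0 := parabola_of_notMem fun hx => by linarith [hx.2]
    have t1 := (hw.tendsto_at (right_mem_Icc.2 h.lt.le)).mul_const (g R)
    have t2 := (hw.tendsto_at (left_mem_Icc.2 h.lt.le)).mul_const (g L)
    have t3 := ((t1.sub t2).sub (h.tendsto_integral_mul hw hgi)).sub_const
      (∫ x in Ioo L R, parabolaDeriv a b x * g x)
    rw [hL, hR, parabola_integral_mul hLa.le hab hbR.le hg] at t3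
    simp only [zero_mul, sub_self, zero_sub, neg_neg] at t3
    refine t3.congr fun k => ?_
    simp only [sub_mul]
    rw [integral_sub (integrable_mul_of_memLp_two (h.h1 k).2.1 hgm)
        (integrable_mul_of_memLp_two hd hgm),
      h.integral_deriv_mul k hg]

end TimeSlice

theorem hasDerivAt_parabola {a b x : ℝ} (hx : x ∈ Ioo a b) :
    HasDerivAt (parabola a b) (6 / (b - a) ^ 3 * (a + b - 2 * x)) x ∧
      HasDerivAt (fun x => 6 / (b - a) ^ 3 * (a + b - 2 * x)) (-(12 / (b - a) ^ 3)) x := by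
  refine ⟨(hasDerivAt_parabola_formula a b x).congr_of_eventuallyEq ?_, ?_⟩
  · filter_upwards [Ioo_mem_nhds hx.1 hx.2] with y hy
    exact parabola_of_mem (Ioo_subset_Icc_self hy)
  · convert! (((hasDerivAt_id x).const_mul 2).const_sub (a + b)).const_mul (6 / (b - a) ^ 3) using 1
    ring

/-! ### The solutions at almost every time -/

/-- The solutions `u^{ε k}` form a `SolutionSeq`. -/
theorem exists_solutionSeq {L R n : ℝ} (hLR : L < R) (hn : n ∈ Ioo (0 : ℝ) 3) {u₀ : ℝ → ℝ}
    (hu₀ : MemH1 L R u₀) (hmass : ∫ x in Ioo L R, u₀ x = 1) {ε : ℕ → ℝ}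
    (hε : ∀ k, ε k ∈ Ioo (0 : ℝ) 1) (hlim : Tendsto ε atTop (𝓝 0)) {U : ℕ → ℝ → ℝ → ℝ}
    (hU : ∀ k, IsSolution L R n (ε k) u₀ (U k)) :
    ∃ (U1 U2 U3 : ℕ → ℝ → ℝ → ℝ) (E M : ℝ) (K : ℝ≥0∞),
      SolutionSeq L R n u₀ ε U U1 U2 U3 E M K := by
  choose U1 U2 U3 hsol using hU
  have hg := hu₀.choose_spec.2.1
  have hgi := (memLp_two_iff_integrable_sq hg.1).1 hg
  set E := ∫ x in Ioo L R, hu₀.choose x ^ 2 with hE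
  have hE0 : 0 ≤ E := integral_nonneg fun x => sq_nonneg _
  have hinit : ∀ k, ∫⁻ x in Ioo L R, ENNReal.ofReal ((1 / 2) * U1 k 0 x ^ 2)
      ≤ ENNReal.ofReal (E / 2) := fun k => by
    rw [(hsol k).lintegral_initial hu₀, ← ofReal_integral_eq_lintegral_ofReal (hgi.const_mul _)
      (Eventually.of_forall fun x => by positivity), integral_const_mul]
    exact ENNReal.ofReal_le_ofReal (by linarith)
  have hen : ∀ k t, 0 < t → IntegrableOn (fun x => U1 k t x ^ 2) (Ioo L R) ∧
      ∫ x in Ioo L R, U1 k t x ^ 2 ≤ E := fun k t ht =>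
    (hsol k).integral_sq_le hE0 (hinit k) ht
  have hRL : 0 < R - L := sub_pos.2 hLR
  refine ⟨U1, U2, U3, E, 1 / (R - L) + ((R - L) + E), ENNReal.ofReal (E / 2), hLR, hn, hε, hlim,
    hsol, hmass, hE0, by positivity, hen, fun k t ht x hx => ?_, ENNReal.ofReal_ne_top,
    fun k S hS => ((hsol k).lintegral_diss_le hS).trans (hinit k), ?_⟩
  · exact (hsol k).le_sup_bound hLR ht.le (hen k t ht).1 (hen k t ht).2 hmass hx
  · have : ∀ᵐ t : ℝ, ∀ k, 0 < t → Slice L R (U k t) (U1 k t) (U3 k t) ∧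
        diss L R n (ε k) (U k) (U3 k) t < ⊤ :=
      ae_all_iff.2 fun k => (hsol k).ae_slice (hε k) hn hu₀
    filter_upwards [this] with t ht h0 k using ht k h0

/-- Rational horizons `S ≤ T` exhaust the times below `T`, and rational bumps are countable, so a
single null set of times is discarded. -/
theorem SolutionSeq.ae_timeSlice {L R n E M : ℝ} {u₀ : ℝ → ℝ} {ε : ℕ → ℝ}
    {U U1 U2 U3 : ℕ → ℝ → ℝ → ℝ} {K : ℝ≥0∞} (h : SolutionSeq L R n u₀ ε U U1 U2 U3 E M K) {p : ℝ}
    (hp : 1 ≤ p) {T : EReal} {ρ : ℝ → ℝ → ℝ}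
    (hρ : ∀ S : ℝ, 0 < S → (S : EReal) ≤ T →
      IntegrableOn (Function.uncurry ρ) (Ioo 0 S ×ˢ Ioo L R))
    (hlim : ∀ S : ℝ, 0 < S → (S : EReal) ≤ T → Tendsto (fun k => ∫⁻ t in Ioo 0 S,
      normWneg L R (fun x => Beps n (ε k) (U k t x) - ρ t x) ^ p) atTop (𝓝 0)) :
    ∃ σ : ℕ → ℕ, StrictMono σ ∧ ∀ᵐ t : ℝ, 0 < t → (t : EReal) < T →
      TimeSlice L R n (fun k => ε (σ k)) (fun k => U (σ k) t) (fun k => U1 (σ k) t)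
        (fun k => U3 (σ k) t) E M (ρ t) := by
  set 𝒮 : Set ℝ := range (Rat.cast : ℚ → ℝ) ∩ {S | 0 < S ∧ (S : EReal) ≤ T}
  have h𝒮 : 𝒮.Countable := (countable_range _).mono inter_subset_left
  set 𝒯 : Set (ℝ → ℝ) := (fun rc : ℚ × ℚ => bump rc.1 rc.2) ''
    {rc | L < (rc.2 : ℝ) - 2 * rc.1 ∧ (rc.2 : ℝ) + 2 * rc.1 < R}
  have h𝒯 : 𝒯.Countable := (to_countable _).image _
  obtain ⟨σ, hσ, H⟩ := h.exists_subseq hp (ρ := ρ) h𝒮 (fun S hS => hS.2.1)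
    (fun S hS => hρ S hS.2.1 hS.2.2) (fun S hS => hlim S hS.2.1 hS.2.2) h𝒯 (by
      rintro _ ⟨rc, hrc, rfl⟩
      exact isTest_bump hrc.1 hrc.2)
  refine ⟨σ, hσ, ?_⟩
  have hint : ∀ S ∈ 𝒮, ∀ᵐ t, t ∈ Ioo 0 S → IntegrableOn (ρ t) (Ioo L R) := by
    intro S hS
    have hi : Integrable (Function.uncurry ρ)
        ((volume.restrict (Ioo 0 S)).prod (volume.restrict (Ioo L R))) := by
      rw [← restrict_prod_eq]; exact hρ S hS.2.1 hS.2.2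
    exact (ae_restrict_iff' measurableSet_Ioo).1 hi.prod_right_ae
  filter_upwards [h.slice, (ae_ball_iff h𝒮).2 H, (ae_ball_iff h𝒮).2 hint] with t h1 h2 h3 ht htT
  obtain ⟨S, htS, hST⟩ := EReal.lt_iff_exists_rat_btwn.1 htT
  have htS' : t < (S : ℝ) := by exact_mod_cast htS
  have hS : (S : ℝ) ∈ 𝒮 := ⟨⟨S, rfl⟩, ht.trans htS', hST.le⟩
  obtain ⟨hd, hb⟩ := h2 S hS ⟨ht, htS'⟩
  have hq := h3 S hS ⟨ht, htS'⟩
  have hi : ∀ k, _ := fun k => IsSolutionWith.integrable_dissipation (h.eps (σ k))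
    (h1 ht (σ k)).1 (h1 ht (σ k)).2
  have hmem : ∀ r c : ℚ, L < (c : ℝ) - 2 * r → (c : ℝ) + 2 * r < R →
      bump (r : ℝ) (c : ℝ) ∈ 𝒯 := fun r c hL hR => ⟨(r, c), ⟨hL, hR⟩, rfl⟩
  refine
    { lt := h.lt
      exponent := h.exponent
      eps := fun k => h.eps _
      lim := h.lim.comp hσ.tendsto_atTop
      slice := fun k => (h1 ht (σ k)).1
      h1 := fun k => (h.sol (σ k)).deriv1 t ht.le
      int := fun k => (hi k).1
      diss := ?_
      energy := fun k => (h.energy (σ k) t ht).2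
      M_pos := h.M_pos
      le_sup := fun k => h.le_sup (σ k) t ht
      holder := fun k κ hκ x hx y hy => (h.sol (σ k)).holder ht.le (h.energy (σ k) t ht).1
        (h.energy (σ k) t ht).2 hκ hx hy
      mass := fun k => ((h.sol (σ k)).mass t ht.le).trans h.mass
      q_int := hq
      q_le := ?_
      mean := fun r c _ hL hR => ?_
      source := fun r c _ hL hR hz => ?_ }
  · have h4 := tendsto_of_tendsto_of_tendsto_of_le_of_le tendsto_const_nhds hd
      (fun _ => zero_le) fun k => (hi k).2
    have h5 := (ENNReal.tendsto_toReal ENNReal.zero_ne_top).comp h4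
    refine h5.congr fun k => ?_
    rw [Function.comp_apply, ENNReal.toReal_ofReal]
    exact setIntegral_nonneg measurableSet_Ioo fun x hx => mul_nonneg
      (pow_nonneg ((h1 ht (σ k)).1.nonneg x (Ioo_subset_Icc_self hx)) 3) (sq_nonneg _)
  · refine ae_le_one_of_bump hq fun r c _ hL hR => ?_
    exact h.mean_limit_le ht (contDiff_bump r c).continuous (bump_nonneg r c) hσ
      (hb _ (hmem r c hL hR)).1
  · have h5 := (ENNReal.tendsto_toReal ENNReal.zero_ne_top).comp (hb _ (hmem r c hL hR)).1
    simp only [Function.comp_def, ENNReal.toReal_ofReal (abs_nonneg _), ENNReal.toReal_zero] at h5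
    exact tendsto_sub_nhds_zero_iff.1 ((tendsto_zero_iff_abs_tendsto_zero _).2 h5)
  · have h5 := (ENNReal.tendsto_toReal ENNReal.zero_ne_top).comp
      ((hb _ (hmem r c hL hR)).2 hz)
    simp only [Function.comp_def, ENNReal.toReal_ofReal (abs_nonneg _), ENNReal.toReal_zero] at h5
    exact (tendsto_zero_iff_abs_tendsto_zero _).2 h5

end ThinFilm

theorem corollary2 (L R n p : ℝ) (hLR : L < R) (hn : n ∈ Ioo (0 : ℝ) 3) (hp : 1 ≤ p)
    (u₀ : ℝ → ℝ) (hu₀ : ThinFilm.MemH1 L R u₀) (hu₀_nonneg : ∀ x ∈ Icc L R, 0 ≤ u₀ x)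
    (hu₀_mass : ∫ x in Ioo L R, u₀ x = 1)
    (u : ℝ → ℝ → ℝ → ℝ)
    (hu : ∀ e ∈ Ioo (0 : ℝ) 1, ThinFilm.IsSolution L R n e u₀ (u e))
    (ε : ℕ → ℝ) (hε : ∀ k, ε k ∈ Ioo (0 : ℝ) 1) (hε_lim : Tendsto ε atTop (𝓝 0))
    (T : EReal) (hT : 0 < T)
    (ρ : ℝ → ℝ → ℝ)
    (hρ : ∀ S : ℝ, 0 < S → (S : EReal) ≤ T →
      IntegrableOn (Function.uncurry ρ) (Ioo 0 S ×ˢ Ioo L R))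
    (hρ_lim : ∀ S : ℝ, 0 < S → (S : EReal) ≤ T →
      Tendsto (fun k => ∫⁻ t in Ioo 0 S,
        ThinFilm.normWneg L R
          (fun x => ThinFilm.Beps n (ε k) (u (ε k) t x) - ρ t x) ^ p) atTop (𝓝 0)) :
    ∃ σ : ℕ → ℕ, StrictMono σ ∧
      (∀ᵐ t : ℝ, 0 < t → (t : EReal) < T →
        ∀ v, ThinFilm.IsAccPoint L R (fun k => u (ε (σ k)) t) v →
          ThinFilm.IsProfile L R (ThinFilm.apparentSupport L R (ρ t)) v) ∧
      (∀ᵐ t : ℝ, 0 < t → (t : EReal) < T →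
        ∀ a b : ℝ, L < a → a < b → b < R →
          ThinFilm.apparentSupport L R (ρ t) = Ioo a b →
          ∃ v : ℝ → ℝ,
            ThinFilm.IsAccPoint L R (fun k => u (ε (σ k)) t) v ∧
            (∀ w, ThinFilm.IsAccPoint L R (fun k => u (ε (σ k)) t) w → EqOn w v (Icc L R)) ∧
            (∀ x ∈ Icc L R, x ∉ Ioo a b → v x = 0) ∧
            (∃ (lam : ℝ) (dv : ℝ → ℝ), ∀ x ∈ Ioo a b,
              HasDerivAt v (dv x) x ∧ HasDerivAt dv (-lam) x) ∧
            (∫ x in Ioo a b, v x = 1) ∧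
            TendstoUniformlyOn (fun k => u (ε (σ k)) t) v atTop (Icc L R) ∧
            ThinFilm.TendstoWeakH1 L R (fun k => u (ε (σ k)) t) v) := by

  obtain ⟨U1, U2, U3, E, M, K, h⟩ := ThinFilm.exists_solutionSeq hLR hn hu₀ hu₀_mass hε hε_lim
    (U := fun k => u (ε k)) fun k => hu _ (hε k)
  obtain ⟨σ, hσ, H⟩ := h.ae_timeSlice hp hρ hρ_lim
  refine ⟨σ, hσ, ?_, ?_⟩
  · filter_upwards [H] with t ht h0 hT'
    rintro v ⟨-, -, j, hj, hv⟩
    exact (ht h0 hT').isProfile hj.tendsto_atTop hv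
  · filter_upwards [H] with t ht h0 hT' a b hLa hab hbR hq
    have ts := ht h0 hT'
    have hc := ThinFilm.continuous_parabola a b
    have hu := ts.tendstoUniformlyOn_of_unique hc.continuousOn fun j v hj hv =>
      ts.eqOn_parabola hj hv hLa hab hbR hq
    refine ⟨ThinFilm.parabola a b, ⟨hc.continuousOn,
      ⟨_, ThinFilm.hasH1Deriv_parabola hLa.le hab hbR.le⟩, id, strictMono_id, hu⟩, ?_,
      fun x _ hx => ThinFilm.parabola_of_notMem hx,
      -- The constant is `12 / (b - a) ^ 3`, fixed by the unit mass.
      ⟨_, _, fun x hx => ThinFilm.hasDerivAt_parabola hx⟩, ThinFilm.integral_parabola hab, hu,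
      ts.tendstoWeakH1 hLa hab hbR hu⟩
    rintro w ⟨-, -, j, hj, hw⟩
    exact ts.eqOn_parabola hj.tendsto_atTop hw hLa hab hbR hq
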